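/- Let $M$ be a smooth (Hausdorff, second countable, finite dimensional) manifold and let $A\to M$ be a Lie algebroid: a smooth vector bundle of finite rank with a smooth bundle map $\rho:A\to TM$ (the anchor) and a Lie bracket $[\cdot,\cdot]$ on $\Gamma(A)$ such that $[\alpha,f\beta]=f[\alpha,\beta]+L_{\rho(\alpha)}(f)\beta$ for all $\alpha,\beta\in\Gamma(A)$, $f\in C^\infty(M)$. *Representations up to homotopy.* For a vector bundle $F$ let $\Omega^k(A;F)=\Gamma(\Lambda^kA^*\otimes F)$, let $\Omega^k(A)$ be the $A$-forms with values in $\mathbb R$, and let $d_A$ be the De Rham operator of $A$ on $\Omega(A)$. For a graded vector bundle $\mathcal E=\bigoplus_{j\in\mathbb Z}\mathcal E^j$ of finite rank put $\Omega(A;\mathcal E)^n=\bigoplus_{k+j=n}\Omega^k(A;\mathcal E^j)$. A representation up to homotopy of $A$ is such an $\mathcal E$ with an operator $D$ of degree $1$ on $\Omega(A;\mathcal E)$ satisfying $D^2=0$ and $D(\omega\wedge\eta)=d_A\omega\wedge\eta+(-1)^k\omega\wedge D\eta$ for $\omega\in\Omega^k(A)$. A morphism is a degree $0$, $\Omega(A)$-linear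 map commuting with the operators $D$. $\mathrm{Rep}^\infty(A)$ is the set of isomorphism classes, and $H^\bullet(A;\mathcal E)$ is the cohomology of $(\Omega(A;\mathcal E),D)$. *The adjoint complex.* For a connection $\nabla$ on the vector bundle $A$ put $$\nabla^{\mathrm{bas}}_\alpha\beta=\nabla_{\rho(\beta)}\alpha+[\alpha,\beta],\qquad \nabla^{\mathrm{bas}}_\alpha X=\rho(\nabla_X\alpha)+[\rho(\alpha),X],$$ $$R^{\mathrm{bas}}_\nabla(\alpha,\beta)(X)=\nabla_X[\alpha,\beta]-[\nabla_X\alpha,\beta]-[\alpha,\nabla_X\beta]-\nabla_{\nabla^{\mathrm{bas}}_\beta X}\alpha+\nabla_{\nabla^{\mathrm{bas}}_\alpha X}\beta ,$$ for $\alpha,\beta\in\Gamma(A)$ and vector fields $X$. Let $\mathrm{Ad}_\nabla$ be the graded bundle with $A$ in degree $0$ and $TM$ in degree $1$, together with the operator $D_\nabla=\rho+\nabla^{\mathrm{bas}}+R^{\mathrm{bas}}_\nabla$ on $\Omega(A;A)\oplus\Omega(A;TM)$, i.e. $$D_\nabla\eta=(-1)^k\rho\circ\eta+d_{\nabla^{\mathrm{bas}}}\eta\quad(\eta\in\Omega^k(A;A)),\qquad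 D_\nabla\eta=d_{\nabla^{\mathrm{bas}}}\eta+(-1)^kR^{\mathrm{bas}}_\nabla\wedge\eta\quad(\eta\in\Omega^k(A;TM)),$$ where $d_{\nabla^{\mathrm{bas}}}$ is the Koszul operator of the $A$-connection $\nabla^{\mathrm{bas}}$ and $\wedge$ is the sum over shuffles with the sign of the shuffle only. *Deformation cohomology.* Let $C^0_{\mathrm{def}}(A)=\Gamma(A)$. For $k\ge1$ let $C^k_{\mathrm{def}}(A)$ be the space of pairs $(c,\sigma_c)$ of an antisymmetric $\mathbb R$-multilinear map $c:\Gamma(A)^k\to\Gamma(A)$ and a symbol $\sigma_c\in\Omega^{k-1}(A;TM)$ such that $c(\alpha_1,\dots,\alpha_{k-1},f\alpha_k)=f\,c(\alpha_1,\dots,\alpha_k)+L_{\sigma_c(\alpha_1,\dots,\alpha_{k-1})}(f)\,\alpha_k$ (the symbol is determined by $c$ as soon as $A$ has positive rank). For $c\in C^k_{\mathrm{def}}(A)$ let $$\delta c(\alpha_1,\dots,\alpha_{k+1})=\sum_{i<j}(-1)^{i+j}c([\alpha_i,\alpha_j],\dots,\widehat{\alpha_i},\dots,\widehat{\alpha_j},\dots)+\sum_i(-1)^{i+1}[\alpha_i,c(\alpha_1,\dots,\widehat{\alpha_i},\dots,\alpha_{k+1})],$$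 with symbol $\sigma_{\delta\gamma}=-\rho(\gamma)$ for $\gamma\in C^0_{\mathrm{def}}(A)$, and, for $k\ge1$, $$\sigma_{\delta c}(\alpha_1,\dots,\alpha_k)=\sum_{i<j}(-1)^{i+j}\sigma_c([\alpha_i,\alpha_j],\dots,\widehat{\alpha_i},\dots,\widehat{\alpha_j},\dots)+\sum_i(-1)^{i+1}[\rho(\alpha_i),\sigma_c(\dots,\widehat{\alpha_i},\dots)]+(-1)^{k-1}\rho(c(\alpha_1,\dots,\alpha_k)).$$ $H^\bullet_{\mathrm{def}}(A)$ is the cohomology of $(C^\bullet_{\mathrm{def}}(A),\delta)$. **Theorem.** 1. For every connection $\nabla$ on $A$, $\mathrm{Ad}_\nabla$ is a representation up to homotopy of $A$. 2. Its isomorphism class $\mathrm{Ad}\in\mathrm{Rep}^\infty(A)$ does not depend on $\nabla$. 3. There is a natural isomorphism $H^\bullet_{\mathrm{def}}(A)\cong H^\bullet(A;\mathrm{Ad})$. Precisely: for every $\nabla$ and every $n\in\mathbb Z$ there is a linear isomorphism $e^n_\nabla:H^n_{\mathrm{def}}(A)\to H^n(A;\mathrm{Ad}_\nabla)$, given on cocycles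 by $[c]\mapsto[\Psi_\nabla(c)]$, where $\Psi_\nabla(\gamma)=\gamma\in\Omega^0(A;A)$ for $\gamma\in C^0_{\mathrm{def}}(A)$ and, for $c\in C^k_{\mathrm{def}}(A)$ with $k\ge1$, $\Psi_\nabla(c)=(c_\nabla,-\sigma_c)\in\Omega^k(A;A)\oplus\Omega^{k-1}(A;TM)$ with $$c_\nabla(\alpha_1,\dots,\alpha_k)=c(\alpha_1,\dots,\alpha_k)+(-1)^{k-1}\sum_{i=1}^k(-1)^i\nabla_{\sigma_c(\alpha_1,\dots,\widehat{\alpha_i},\dots,\alpha_k)}\alpha_i ;$$ and for any two connections $\nabla,\nabla'$ there is an isomorphism $\varphi:\mathrm{Ad}_\nabla\to\mathrm{Ad}_{\nabla'}$ of representations up to homotopy with $H^n(\varphi)\circ e^n_\nabla=e^n_{\nabla'}$ for all $n$. -/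

import Mathlib

open scoped Manifold ContDiff Bundle DirectSum
open Bundle

set_option linter.unusedSectionVars false

universe u w

noncomputable section

namespace AdjointRep

/-- A smooth real vector bundle of finite rank over the manifold `M`. -/
structure SmoothVectorBundle (E : Type u) [NormedAddCommGroup E] [NormedSpace ℝ E]
    (M : Type w) [TopologicalSpace M] [ChartedSpace E M] where
  /-- the typical fibre -/
  F : Type u
  /-- the fibres -/
  V : M → Type u
  [normedAddCommGroup : NormedAddCommGroup F]
  [normedSpace : NormedSpace ℝ F]
  [finiteDimensional : FiniteDimensional ℝ F]
  [addCommGroup : ∀ x, AddCommGroup (V x)]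
  [module : ∀ x, Module ℝ (V x)]
  [topologicalSpaceFibre : ∀ x, TopologicalSpace (V x)]
  [topologicalSpaceTotal : TopologicalSpace (TotalSpace F V)]
  [fiberBundle : FiberBundle F V]
  [vectorBundle : VectorBundle ℝ F V]
  [contMDiffVectorBundle : ContMDiffVectorBundle ∞ F V 𝓘(ℝ, E)]

attribute [instance] SmoothVectorBundle.normedAddCommGroup SmoothVectorBundle.normedSpace
  SmoothVectorBundle.finiteDimensional SmoothVectorBundle.addCommGroup SmoothVectorBundle.module
  SmoothVectorBundle.topologicalSpaceFibre SmoothVectorBundle.topologicalSpaceTotal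
  SmoothVectorBundle.fiberBundle SmoothVectorBundle.vectorBundle
  SmoothVectorBundle.contMDiffVectorBundle

variable {E : Type u} [NormedAddCommGroup E] [NormedSpace ℝ E]
  {M : Type w} [TopologicalSpace M] [ChartedSpace E M]

variable (E M) in
/-- The ring `C^∞(M)` of smooth real functions on `M`. -/
abbrev Cinf := C^∞⟮𝓘(ℝ, E), M; ℝ⟯

/-- The space `Γ(A)` of smooth sections of the vector bundle `A`. -/
abbrev Sec (A : SmoothVectorBundle E M) := Cₛ^∞⟮𝓘(ℝ, E); A.F, A.V⟯

section SectionModule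

variable (A : SmoothVectorBundle E M)

instance : SMul (Cinf E M) (Sec A) :=
  ⟨fun f s ↦ ⟨(f : M → ℝ) • (s : ∀ x, A.V x), f.contMDiff.smul_section s.contMDiff⟩⟩

@[simp] theorem smul_sec_apply (f : Cinf E M) (s : Sec A) (x : M) : (f • s) x = f x • s x := rfl

instance : Module (Cinf E M) (Sec A) where
  one_smul s := by ext x; simp
  mul_smul f g s := by ext x; simp [mul_smul]
  smul_zero f := by ext x; simp
  smul_add f s t := by ext x; simp
  add_smul f g s := by ext x; simp [add_smul]
  zero_smul s := by ext x; simp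

instance : IsScalarTower ℝ (Cinf E M) (Sec A) where
  smul_assoc c f s := by ext x; simp [mul_smul]

instance : SMulCommClass ℝ (Cinf E M) (Sec A) where
  smul_comm c f s := by ext x; simp [smul_comm c]

instance : SMulCommClass (Cinf E M) ℝ (Sec A) where
  smul_comm f c s := by ext x; simp [smul_comm c]

end SectionModule

variable [FiniteDimensional ℝ E] [IsManifold 𝓘(ℝ, E) ∞ M]

variable (E M) in
/-- The tangent bundle of `M`. -/
def TM : SmoothVectorBundle E M where
  F := E
  V := fun x ↦ TangentSpace 𝓘(ℝ, E) x

variable (E M) in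
/-- The zero vector bundle over `M`. -/
def zeroBundle : SmoothVectorBundle E M where
  F := PUnit.{u + 1}
  V := Bundle.Trivial M PUnit.{u + 1}

/-- The section `X` of the tangent bundle as a function with values in the tangent spaces. -/
def vf (X : Sec (TM E M)) (x : M) : TangentSpace 𝓘(ℝ, E) x := X x

theorem mdiffAt (f : Cinf E M) (x : M) : MDifferentiableAt 𝓘(ℝ, E) 𝓘(ℝ, ℝ) f x :=
  f.contMDiff.mdifferentiable (by simp) x

/-- The Lie derivative `L_X f = X(f)` of a function along a vector field. -/
def lieDeriv (X : Sec (TM E M)) (f : Cinf E M) : Cinf E M where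
  val x := mvfderiv 𝓘(ℝ, E) f x (vf X x)
  property := by
    have h1 : ContMDiff 𝓘(ℝ, E).tangent 𝓘(ℝ, ℝ).tangent ∞ (tangentMap 𝓘(ℝ, E) 𝓘(ℝ, ℝ) f) :=
      f.contMDiff.contMDiff_tangentMap (by simp)
    exact (contMDiff_snd_tangentBundle_modelSpace ℝ 𝓘(ℝ, ℝ)).comp (h1.comp X.contMDiff)

theorem lieDeriv_apply (X : Sec (TM E M)) (f : Cinf E M) (x : M) :
    lieDeriv X f x = mvfderiv 𝓘(ℝ, E) f x (vf X x) := rfl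

theorem lieDeriv_mul (X : Sec (TM E M)) (f g : Cinf E M) :
    lieDeriv X (f * g) = f * lieDeriv X g + lieDeriv X f * g := by
  ext x
  have h := mvfderiv_mul (mdiffAt f x) (mdiffAt g x)
  have h2 : mvfderiv 𝓘(ℝ, E) (f * g : Cinf E M) x = mvfderiv 𝓘(ℝ, E) (⇑f * ⇑g) x := rfl
  simp only [lieDeriv_apply, h, ContMDiffMap.coe_add, ContMDiffMap.coe_mul, Pi.add_apply,
    Pi.mul_apply]
  simp [mul_comm]

/-- The Lie derivative of functions along a vector field, as an `ℝ`-linear operator on `C^∞(M)`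
depending `C^∞(M)`-linearly on the vector field. -/
def lieD : Sec (TM E M) →ₗ[Cinf E M] Cinf E M →ₗ[ℝ] Cinf E M where
  toFun X :=
    { toFun := lieDeriv X
      map_add' := fun f g ↦ by
        ext x
        have h := mvfderiv_add (mdiffAt f x) (mdiffAt g x)
        have h2 : mvfderiv 𝓘(ℝ, E) (f + g : Cinf E M) x = mvfderiv 𝓘(ℝ, E) (⇑f + ⇑g) x := rfl
        simp only [lieDeriv_apply, h, ContMDiffMap.coe_add, Pi.add_apply]
        rfl
      map_smul' := fun c f ↦ by
        ext x
        have h := mvfderiv_smul (I := 𝓘(ℝ, E)) (a := fun _ : M ↦ c) (x := x)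
          mdifferentiableAt_const (mdiffAt f x)
        have h2 : mvfderiv 𝓘(ℝ, E) (c • f : Cinf E M) x =
          mvfderiv 𝓘(ℝ, E) ((fun _ : M ↦ c) • ⇑f) x := rfl
        rw [lieDeriv_apply, h2, h, mvfderiv_const]
        simp [lieDeriv_apply] }
  map_add' X Y := by
    ext f x
    exact (mvfderiv 𝓘(ℝ, E) f x).map_add (vf X x) (vf Y x)
  map_smul' g X := by
    ext f x
    exact (mvfderiv 𝓘(ℝ, E) f x).map_smul (g x) (vf X x)

theorem lieD_mul (X : Sec (TM E M)) (f g : Cinf E M) :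
    lieD X (f * g) = f * lieD X g + lieD X f * g := lieDeriv_mul X f g

theorem vf_mdiffAt (X : Sec (TM E M)) (x : M) :
    MDifferentiableAt 𝓘(ℝ, E) 𝓘(ℝ, E).tangent (fun y ↦ (⟨y, vf X y⟩ : TangentBundle 𝓘(ℝ, E) M)) x :=
  X.mdifferentiableAt

theorem vf_contMDiff (X : Sec (TM E M)) :
    ContMDiff 𝓘(ℝ, E) 𝓘(ℝ, E).tangent ∞ (fun y ↦ (⟨y, vf X y⟩ : TangentBundle 𝓘(ℝ, E) M)) :=
  X.contMDiff

/-- The Lie bracket of vector fields. -/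
def vfLie (X Y : Sec (TM E M)) : Sec (TM E M) where
  toFun := VectorField.mlieBracket 𝓘(ℝ, E) (vf X) (vf Y)
  contMDiff_toFun := by
    have := FiniteDimensional.complete ℝ E
    have : IsManifold 𝓘(ℝ, E) (minSmoothness ℝ 2) M := by
      rw [minSmoothness_of_isRCLikeNormedField]; infer_instance
    have : IsManifold 𝓘(ℝ, E) ((⊤ : ℕ∞) + 1) M := by simpa using ‹IsManifold 𝓘(ℝ, E) ∞ M›
    exact ContDiff.mlieBracket_vectorField (m := ⊤) (n := ⊤) X.contMDiff Y.contMDiff (by simp)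

theorem vfLie_apply (X Y : Sec (TM E M)) (x : M) :
    vf (vfLie X Y) x = VectorField.mlieBracket 𝓘(ℝ, E) (vf X) (vf Y) x := rfl

theorem vfLie_swap (X Y : Sec (TM E M)) : vfLie X Y = - vfLie Y X := by
  ext x
  exact VectorField.mlieBracket_swap_apply

theorem vfLie_self (X : Sec (TM E M)) : vfLie X X = 0 := by
  ext x
  exact congrFun VectorField.mlieBracket_self x

theorem vfLie_add_right (X Y Z : Sec (TM E M)) : vfLie X (Y + Z) = vfLie X Y + vfLie X Z := by
  have := FiniteDimensional.complete ℝ E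
  ext x
  exact VectorField.mlieBracket_add_right (vf_mdiffAt Y x) (vf_mdiffAt Z x)

theorem vfLie_smul_right (X Y : Sec (TM E M)) (f : Cinf E M) :
    vfLie X (f • Y) = f • vfLie X Y + lieD X f • Y := by
  have := FiniteDimensional.complete ℝ E
  ext x
  rw [add_comm]
  exact VectorField.mlieBracket_smul_right (mdiffAt f x) (vf_mdiffAt Y x)

theorem vfLie_jacobi (X Y Z : Sec (TM E M)) :
    vfLie X (vfLie Y Z) = vfLie (vfLie X Y) Z + vfLie Y (vfLie X Z) := by
  have := FiniteDimensional.complete ℝ E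
  have : IsManifold 𝓘(ℝ, E) (minSmoothness ℝ 3) M := by
    rw [minSmoothness_of_isRCLikeNormedField]; infer_instance
  have h : minSmoothness ℝ 2 ≤ (∞ : ℕ∞ω) := by
    rw [minSmoothness_of_isRCLikeNormedField]; exact ENat.LEInfty.out
  ext x
  exact VectorField.leibniz_identity_mlieBracket_apply ((vf_contMDiff X).of_le h x)
    ((vf_contMDiff Y).of_le h x) ((vf_contMDiff Z).of_le h x)

theorem smul_const_eq (c : ℝ) (A : SmoothVectorBundle E M) (s : Sec A) :
    c • s = (algebraMap ℝ (Cinf E M) c) • s := by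
  rw [algebraMap_smul]

/-- The Lie bracket of vector fields as an `ℝ`-bilinear map. -/
def vfBracket : Sec (TM E M) →ₗ[ℝ] Sec (TM E M) →ₗ[ℝ] Sec (TM E M) :=
  have hr : ∀ (c : ℝ) (X Y : Sec (TM E M)), vfLie X (c • Y) = c • vfLie X Y := fun c X Y ↦ by
    rw [smul_const_eq, vfLie_smul_right, smul_const_eq]
    have : lieD X (algebraMap ℝ (Cinf E M) c) = 0 := by
      have h1 := lieD_mul X 1 1
      rw [Algebra.algebraMap_eq_smul_one, map_smul]
      simp only [mul_one, one_mul, left_eq_add] at h1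
      rw [h1, smul_zero]
    rw [this]; simp
  LinearMap.mk₂ ℝ vfLie
    (fun X Y Z ↦ by
      rw [vfLie_swap, vfLie_add_right, vfLie_swap Z X, vfLie_swap Z Y]; abel)
    (fun c X Y ↦ by rw [vfLie_swap, hr, vfLie_swap Y X]; simp)
    vfLie_add_right (fun c X Y ↦ hr c X Y)

theorem lieD_vfLie_smul (X Y : Sec (TM E M)) (f : Cinf E M) (p : M)
    (Z : ∀ x : M, TangentSpace 𝓘(ℝ, E) x)
    (hZ : ContMDiffAt 𝓘(ℝ, E) 𝓘(ℝ, E).tangent ∞ (fun y ↦ (⟨y, Z y⟩ : TangentBundle 𝓘(ℝ, E) M)) p) :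
    lieD (vfLie X Y) f p • Z p = (lieD X (lieD Y f) - lieD Y (lieD X f)) p • Z p := by
  have := FiniteDimensional.complete ℝ E
  have : IsManifold 𝓘(ℝ, E) (minSmoothness ℝ 3) M := by
    rw [minSmoothness_of_isRCLikeNormedField]; infer_instance
  have h2 : minSmoothness ℝ 2 ≤ (∞ : ℕ∞ω) := by
    rw [minSmoothness_of_isRCLikeNormedField]; exact ENat.LEInfty.out
  have : IsManifold 𝓘(ℝ, E) ((⊤ : ℕ∞) + 1) M := by simpa using ‹IsManifold 𝓘(ℝ, E) ∞ M›
  have hsm : ∀ W : Sec (TM E M), ContMDiffAt 𝓘(ℝ, E) 𝓘(ℝ, E).tangent ∞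
      (fun y ↦ (⟨y, VectorField.mlieBracket 𝓘(ℝ, E) (vf W) Z y⟩ : TangentBundle 𝓘(ℝ, E) M)) p :=
    fun W ↦ ContMDiffAt.mlieBracket_vectorField (m := ⊤) (n := ⊤) (vf_contMDiff W p) hZ (by simp)
  have hZd : MDifferentiableAt 𝓘(ℝ, E) 𝓘(ℝ, E).tangent
      (fun y ↦ (⟨y, Z y⟩ : TangentBundle 𝓘(ℝ, E) M)) p := hZ.mdifferentiableAt (by simp)
  have hsm' : ∀ g : Cinf E M, ContMDiffAt 𝓘(ℝ, E) 𝓘(ℝ, E).tangent ∞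
      (fun y ↦ (⟨y, ((g : M → ℝ) • Z) y⟩ : TangentBundle 𝓘(ℝ, E) M)) p :=
    fun g ↦ ContMDiffAt.smul_section (V := fun x ↦ TangentSpace 𝓘(ℝ, E) x)
      (g.contMDiff p) hZ
  have hsm'' : ∀ (g : Cinf E M) (W : Sec (TM E M)), ContMDiffAt 𝓘(ℝ, E) 𝓘(ℝ, E).tangent ∞
      (fun y ↦ (⟨y, ((g : M → ℝ) • VectorField.mlieBracket 𝓘(ℝ, E) (vf W) Z) y⟩ :
        TangentBundle 𝓘(ℝ, E) M)) p :=
    fun g W ↦ ContMDiffAt.smul_section (V := fun x ↦ TangentSpace 𝓘(ℝ, E) x)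
      (g.contMDiff p) (hsm W)
  -- the first brackets with `f • Z`, near `p`
  have hev : ∀ W : Sec (TM E M), VectorField.mlieBracket 𝓘(ℝ, E) (vf W) ((f : M → ℝ) • Z) =ᶠ[nhds p]
      ((lieD W f : Cinf E M) : M → ℝ) • Z +
        (f : M → ℝ) • VectorField.mlieBracket 𝓘(ℝ, E) (vf W) Z := by
    intro W
    have h1 := (contMDiffAt_iff_contMDiffAt_nhds (n := 1) (by simp)).1
      (hZ.of_le ENat.LEInfty.out)
    filter_upwards [h1] with q hq
    exact VectorField.mlieBracket_smul_right (mdiffAt f q) (hq.mdifferentiableAt (by simp))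
  have key : ∀ V W : Sec (TM E M), VectorField.mlieBracket 𝓘(ℝ, E) (vf V)
      (VectorField.mlieBracket 𝓘(ℝ, E) (vf W) ((f : M → ℝ) • Z)) p =
      (lieD V (lieD W f) p • Z p +
        lieD W f p • VectorField.mlieBracket 𝓘(ℝ, E) (vf V) Z p) +
      (lieD V f p • VectorField.mlieBracket 𝓘(ℝ, E) (vf W) Z p +
        f p • VectorField.mlieBracket 𝓘(ℝ, E) (vf V)
          (VectorField.mlieBracket 𝓘(ℝ, E) (vf W) Z) p) := by
    intro V W
    rw [Filter.EventuallyEq.mlieBracket_vectorField_eq (Filter.EventuallyEq.refl _ (vf V)) (hev W),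
      VectorField.mlieBracket_add_right ((hsm' _).mdifferentiableAt (by simp))
        ((hsm'' _ _).mdifferentiableAt (by simp)),
      VectorField.mlieBracket_smul_right (mdiffAt _ p) hZd,
      VectorField.mlieBracket_smul_right (mdiffAt _ p) ((hsm W).mdifferentiableAt (by simp))]
    rfl
  have jac := VectorField.leibniz_identity_mlieBracket_apply (U := vf X) (V := vf Y)
    (W := (f : M → ℝ) • Z) (x := p)
    ((vf_contMDiff X).of_le h2 p) ((vf_contMDiff Y).of_le h2 p) ((hsm' f).of_le h2)
  have jac0 := VectorField.leibniz_identity_mlieBracket_apply (U := vf X) (V := vf Y)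
    (W := Z) (x := p)
    ((vf_contMDiff X).of_le h2 p) ((vf_contMDiff Y).of_le h2 p) (hZ.of_le h2)
  have l1 : VectorField.mlieBracket 𝓘(ℝ, E) (VectorField.mlieBracket 𝓘(ℝ, E) (vf X) (vf Y))
      ((f : M → ℝ) • Z) p = lieD (vfLie X Y) f p • Z p + f p •
      VectorField.mlieBracket 𝓘(ℝ, E) (VectorField.mlieBracket 𝓘(ℝ, E) (vf X) (vf Y)) Z p :=
    VectorField.mlieBracket_smul_right (mdiffAt _ p) hZd
  rw [key X Y, key Y X, jac0, l1, smul_add] at jac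
  have e : (lieD X (lieD Y f) - lieD Y (lieD X f)) p =
    lieD X (lieD Y f) p - lieD Y (lieD X f) p := rfl
  rw [e, sub_smul]
  generalize lieD X (lieD Y f) p • Z p = a at *
  generalize lieD Y (lieD X f) p • Z p = b at *
  generalize lieD (vfLie X Y) f p • Z p = c at *
  rw [eq_sub_iff_add_eq]
  have := sub_eq_zero.mpr jac
  rw [← sub_eq_zero, ← neg_eq_zero, ← this]
  abel

/-- `L_{[X, Y]} = L_X L_Y - L_Y L_X` on functions. -/
theorem lieD_vfLie (X Y : Sec (TM E M)) (f : Cinf E M) :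
    lieD (vfLie X Y) f = lieD X (lieD Y f) - lieD Y (lieD X f) := by
  ext p
  by_cases h : Nontrivial (TangentSpace 𝓘(ℝ, E) p)
  · obtain ⟨z, hz⟩ := exists_ne (0 : TangentSpace 𝓘(ℝ, E) p)
    have := lieD_vfLie_smul X Y f p
      (FiberBundle.extend E (E := fun x : M ↦ TangentSpace 𝓘(ℝ, E) x) z)
      (FiberBundle.contMDiffAt_extend 𝓘(ℝ, E) E z)
    simp only [FiberBundle.extend_apply_self] at this
    exact smul_left_injective ℝ hz this
  · rw [not_nontrivial_iff_subsingleton] at h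
    have hz : ∀ (X : Sec (TM E M)) (g : Cinf E M), lieD X g p = 0 := fun X g ↦ by
      have : vf X p = 0 := Subsingleton.elim _ _
      change mvfderiv 𝓘(ℝ, E) g p (vf X p) = 0
      rw [this, map_zero]
    have e : (lieD X (lieD Y f) - lieD Y (lieD X f)) p =
      lieD X (lieD Y f) p - lieD Y (lieD X f) p := rfl
    rw [e, hz, hz, hz, sub_zero]

/-! ### The Koszul operator on alternating maps -/

section Koszul

variable {L N : Type*} [AddCommGroup L] [Module ℝ L] [AddCommGroup N] [Module ℝ N]

/-- The alternating map
`(v₀, …, v_k) ↦ ∑_i (-1)^i ∇_{v_i} (η(v₀, …, v̂_i, …, v_k))`. -/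
def connTerm (D : L →ₗ[ℝ] N →ₗ[ℝ] N) {k : ℕ} :
    (L [⋀^Fin k]→ₗ[ℝ] N) →ₗ[ℝ] L [⋀^Fin (k + 1)]→ₗ[ℝ] N where
  toFun η := AlternatingMap.alternatizeUncurryFin
    { toFun := fun x ↦ (D x).compAlternatingMap η
      map_add' := fun x y ↦ by ext; simp
      map_smul' := fun c x ↦ by ext; simp }
  map_add' η θ := by
    ext v; simp [AlternatingMap.alternatizeUncurryFin_apply, Finset.sum_add_distrib]
  map_smul' c η := by
    ext v; simp [AlternatingMap.alternatizeUncurryFin_apply, Finset.smul_sum, smul_comm c]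

theorem connTerm_apply (D : L →ₗ[ℝ] N →ₗ[ℝ] N) {k : ℕ} (η : L [⋀^Fin k]→ₗ[ℝ] N)
    (v : Fin (k + 1) → L) :
    connTerm D η v = ∑ i : Fin (k + 1), (-1) ^ (i : ℕ) • D (v i) (η (i.removeNth v)) := by
  simp [connTerm, AlternatingMap.alternatizeUncurryFin_apply]

/-- The expression `∑_{p < q} (-1)^{p+q} η([v_p, v_q], v₀, …, v̂_p, …, v̂_q, …, v_k)`. A pair of
positions `p < q` is written as `p = i`, `q = j + 1` with `i ≤ j`. -/
def bracketSum (br : L →ₗ[ℝ] L →ₗ[ℝ] L) : (k : ℕ) → (L [⋀^Fin k]→ₗ[ℝ] N) → (Fin (k + 1) → L) → N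
  | 0, _, _ => 0
  | n + 1, η, v => ∑ i : Fin (n + 1), ∑ j : Fin (n + 1),
      if i ≤ j then (-1) ^ (i + (j + 1) : ℕ) •
        η (Matrix.vecCons (br (v i.castSucc) (v j.succ)) (j.removeNth (i.castSucc.removeNth v)))
      else 0

theorem br_swap (br : L →ₗ[ℝ] L →ₗ[ℝ] L) (hbr : ∀ x, br x x = 0) (x y : L) : br y x = - br x y := by
  have := hbr (x + y)
  simp only [map_add, LinearMap.add_apply, hbr, zero_add, add_zero] at this
  exact eq_neg_of_add_eq_zero_left this

/-- An auxiliary form of `bracketSum`, visibly alternating. -/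
def bracketAux (br : L →ₗ[ℝ] L →ₗ[ℝ] L) {n : ℕ} (η : L [⋀^Fin (n + 1)]→ₗ[ℝ] N) :
    L [⋀^Fin (n + 2)]→ₗ[ℝ] N :=
  (-(1 / 2) : ℝ) • AlternatingMap.alternatizeUncurryFin
    (AlternatingMap.alternatizeUncurryFinLM ∘ₗ
      (LinearMap.mk₂ ℝ (fun x y ↦ η.curryLeft (br x y))
        (by intros; simp) (by intros; simp) (by intros; simp) (by intros; simp)))

theorem bracketAux_apply (br : L →ₗ[ℝ] L →ₗ[ℝ] L) (hbr : ∀ x, br x x = 0) {n : ℕ}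
    (η : L [⋀^Fin (n + 1)]→ₗ[ℝ] N) (v : Fin (n + 2) → L) :
    bracketAux br η v = bracketSum br (n + 1) η v := by
  have hsw := br_swap br hbr
  simp only [bracketAux, AlternatingMap.smul_apply,
    AlternatingMap.alternatizeUncurryFin_alternatizeUncurryFinLM_comp_apply, bracketSum,
    Finset.smul_sum]
  refine Finset.sum_congr rfl fun i _ ↦ ?_
  rw [← Finset.sum_filter]
  refine Finset.sum_congr (by ext; simp) fun j _ ↦ ?_
  simp only [LinearMap.mk₂_apply, hsw (v i.castSucc) (v j.succ), map_neg,
    AlternatingMap.neg_apply, sub_neg_eq_add, AlternatingMap.curryLeft_apply_apply]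
  rw [← two_smul ℝ, smul_comm _ (2 : ℝ), smul_smul, ← add_assoc, pow_succ]
  norm_num

/-- `bracketSum` as a linear operator from alternating `k`-forms to alternating
`(k + 1)`-forms. -/
def bracketTerm (br : L →ₗ[ℝ] L →ₗ[ℝ] L) (hbr : ∀ x, br x x = 0) {k : ℕ} :
    (L [⋀^Fin k]→ₗ[ℝ] N) →ₗ[ℝ] L [⋀^Fin (k + 1)]→ₗ[ℝ] N where
  toFun η :=
    have h : ∃ θ : L [⋀^Fin (k + 1)]→ₗ[ℝ] N, ∀ v, bracketSum br k η v = θ v := by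
      cases k with
      | zero => exact ⟨0, fun _ ↦ rfl⟩
      | succ n => exact ⟨bracketAux br η, fun v ↦ (bracketAux_apply br hbr η v).symm⟩
    { toFun := bracketSum br k η
      map_update_add' := fun v i x y ↦ by
        obtain ⟨θ, h⟩ := h; simp only [h]; convert θ.map_update_add v i x y
      map_update_smul' := fun v i c x ↦ by
        obtain ⟨θ, h⟩ := h; simp only [h]; convert θ.map_update_smul v i c x
      map_eq_zero_of_eq' := fun v i j hv hij ↦ by
        obtain ⟨θ, h⟩ := h
        exact (h v).trans (θ.map_eq_zero_of_eq v hv hij) }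
  map_add' η θ := by
    ext v
    change bracketSum br k (η + θ) v = bracketSum br k η v + bracketSum br k θ v
    cases k with
    | zero => simp [bracketSum]
    | succ n =>
      simp only [bracketSum, ← Finset.sum_add_distrib]
      refine Finset.sum_congr rfl fun i _ ↦ Finset.sum_congr rfl fun j _ ↦ ?_
      split_ifs <;> simp
  map_smul' c η := by
    ext v
    change bracketSum br k (c • η) v = c • bracketSum br k η v
    cases k with
    | zero => simp [bracketSum]
    | succ n =>
      simp only [bracketSum, Finset.smul_sum]
      refine Finset.sum_congr rfl fun i _ ↦ Finset.sum_congr rfl fun j _ ↦ ?_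
      split_ifs <;> simp [smul_comm c]

theorem bracketTerm_apply (br : L →ₗ[ℝ] L →ₗ[ℝ] L) (hbr : ∀ x, br x x = 0) {k : ℕ}
    (η : L [⋀^Fin k]→ₗ[ℝ] N) (v : Fin (k + 1) → L) :
    bracketTerm br hbr η v = bracketSum br k η v := rfl

/-- The Koszul operator
`(Dη)(v₀, …, v_k) = ∑_{p<q} (-1)^{p+q} η([v_p, v_q], v₀, …, v̂_p, …, v̂_q, …, v_k)
  + ∑_i (-1)^i ∇_{v_i} (η(v₀, …, v̂_i, …, v_k))`
on `ℝ`-multilinear alternating maps (the arguments are numbered from `0`). -/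
def koszul (br : L →ₗ[ℝ] L →ₗ[ℝ] L) (hbr : ∀ x, br x x = 0) (D : L →ₗ[ℝ] N →ₗ[ℝ] N) {k : ℕ} :
    (L [⋀^Fin k]→ₗ[ℝ] N) →ₗ[ℝ] L [⋀^Fin (k + 1)]→ₗ[ℝ] N :=
  bracketTerm br hbr + connTerm D

theorem removeNth_succ_cons {k : ℕ} (x : L) (w : Fin (k + 1) → L) (i : Fin (k + 1)) :
    i.succ.removeNth (Matrix.vecCons x w) = Matrix.vecCons x (i.removeNth w) := by
  funext j
  refine Fin.cases ?_ (fun j ↦ ?_) j <;> simp [Fin.removeNth]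

theorem map_cons_cons {k : ℕ} (η : L [⋀^Fin (k + 2)]→ₗ[ℝ] N) (x y : L) (w : Fin k → L) :
    η (Matrix.vecCons x (Matrix.vecCons y w)) = - η (Matrix.vecCons y (Matrix.vecCons x w)) := by
  rw [← η.map_swap (i := 0) (j := 1) _ (by simp)]
  congr 1
  funext j
  refine Fin.cases ?_ (fun j ↦ Fin.cases ?_ (fun j ↦ ?_) j) j
  · simp
  · simp
  · simp only [Matrix.cons_val_succ, Function.comp]
    rw [Equiv.swap_apply_of_ne_of_ne (by simp [Fin.ext_iff]) (by simp [Fin.ext_iff])]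
    simp

theorem bracketSum_cons (br : L →ₗ[ℝ] L →ₗ[ℝ] L) {k : ℕ}
    (η : L [⋀^Fin (k + 1)]→ₗ[ℝ] N) (x : L) (w : Fin (k + 1) → L) :
    bracketSum br (k + 1) η (Matrix.vecCons x w) =
      - ∑ j : Fin (k + 1), (-1) ^ (j : ℕ) • η (Matrix.vecCons (br x (w j)) (j.removeNth w))
      - bracketSum br k (η.curryLeft x) w := by
  have e0 : ∀ j : Fin (k + 1),
      j.removeNth ((0 : Fin (k + 1)).castSucc.removeNth (Matrix.vecCons x w)) = j.removeNth w := by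
    intro j; rfl
  simp only [bracketSum]
  rw [Fin.sum_univ_succ]
  simp only [Fin.zero_le, if_true, e0]
  rw [sub_eq_add_neg, ← Finset.sum_neg_distrib]
  congr 1
  · refine Finset.sum_congr rfl fun j _ ↦ ?_
    simp [pow_succ]
  · cases k with
    | zero => simp
    | succ n =>
      simp only [← Finset.sum_neg_distrib]
      refine Finset.sum_congr rfl fun i _ ↦ ?_
      rw [Fin.sum_univ_succ]
      have : ¬ (i.succ ≤ 0) := by simp
      simp only [this, if_false, zero_add]
      refine Finset.sum_congr rfl fun j _ ↦ ?_
      simp only [Fin.succ_le_succ_iff]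
      split_ifs
      · rw [← Fin.succ_castSucc, removeNth_succ_cons, removeNth_succ_cons, map_cons_cons]
        simp [pow_succ, pow_add]
      · simp

theorem connTerm_cons (D : L →ₗ[ℝ] N →ₗ[ℝ] N) {k : ℕ}
    (η : L [⋀^Fin (k + 1)]→ₗ[ℝ] N) (x : L) (w : Fin (k + 1) → L) :
    connTerm D η (Matrix.vecCons x w) = D x (η w) - connTerm D (η.curryLeft x) w := by
  rw [connTerm_apply, connTerm_apply, Fin.sum_univ_succ, sub_eq_add_neg, ← Finset.sum_neg_distrib]
  congr 1
  · simp
  · refine Finset.sum_congr rfl fun i _ ↦ ?_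
    rw [removeNth_succ_cons]
    simp [pow_succ]

theorem koszul_apply (br : L →ₗ[ℝ] L →ₗ[ℝ] L) (hbr : ∀ x, br x x = 0) (D : L →ₗ[ℝ] N →ₗ[ℝ] N)
    {k : ℕ} (η : L [⋀^Fin k]→ₗ[ℝ] N) (v : Fin (k + 1) → L) :
    koszul br hbr D η v = bracketSum br k η v +
      ∑ i : Fin (k + 1), (-1) ^ (i : ℕ) • D (v i) (η (i.removeNth v)) := by
  rw [← connTerm_apply]; rfl

theorem koszul_cons (br : L →ₗ[ℝ] L →ₗ[ℝ] L) (hbr : ∀ x, br x x = 0) (D : L →ₗ[ℝ] N →ₗ[ℝ] N)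
    {k : ℕ} (η : L [⋀^Fin (k + 1)]→ₗ[ℝ] N) (x : L) (w : Fin (k + 1) → L) :
    koszul br hbr D η (Matrix.vecCons x w) = D x (η w) -
      ∑ j : Fin (k + 1), (-1) ^ (j : ℕ) • η (Matrix.vecCons (br x (w j)) (j.removeNth w))
      - koszul br hbr D (η.curryLeft x) w := by
  have h1 := bracketSum_cons br η x w
  have h2 := connTerm_cons D η x w
  change bracketSum br (k + 1) η _ + connTerm D η _ = _ - (bracketSum br k _ _ + connTerm D _ _)
  rw [h1, h2]; abel

theorem koszul_zero_cons (br : L →ₗ[ℝ] L →ₗ[ℝ] L) (hbr : ∀ x, br x x = 0)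
    (D : L →ₗ[ℝ] N →ₗ[ℝ] N) (η : L [⋀^Fin 0]→ₗ[ℝ] N) (x : L) (w : Fin 0 → L) :
    koszul br hbr D η (Matrix.vecCons x w) = D x (η w) := by
  rw [koszul_apply]
  simp [bracketSum]

end Koszul

section Tensorial

variable {R L N N' : Type*} [CommRing R] [Algebra ℝ R] [AddCommGroup L] [Module ℝ L] [Module R L]
  [IsScalarTower ℝ R L] [AddCommGroup N] [Module ℝ N] [Module R N] [IsScalarTower ℝ R N]
  [AddCommGroup N'] [Module ℝ N'] [Module R N'] [IsScalarTower ℝ R N']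

/-- An `R`-multilinear alternating map, regarded as an `ℝ`-multilinear one. -/
def toReal {ι : Type*} : (L [⋀^ι]→ₗ[R] N) →ₗ[ℝ] L [⋀^ι]→ₗ[ℝ] N where
  toFun η := { η.toMultilinearMap.restrictScalars ℝ with
    map_eq_zero_of_eq' := η.map_eq_zero_of_eq' }
  map_add' _ _ := rfl
  map_smul' _ _ := rfl

@[simp] theorem toReal_apply {ι : Type*} (η : L [⋀^ι]→ₗ[R] N) (v : ι → L) :
    toReal η v = η v := rfl

/-- An `ℝ`-multilinear alternating map which is `R`-homogeneous in the first argument,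
regarded as an `R`-multilinear map. -/
def ofReal {k : ℕ} (η : L [⋀^Fin (k + 1)]→ₗ[ℝ] N)
    (h : ∀ (f : R) (x : L) (w : Fin k → L),
      η (Matrix.vecCons (f • x) w) = f • η (Matrix.vecCons x w)) :
    L [⋀^Fin (k + 1)]→ₗ[R] N where
  toFun := η
  map_update_add' v i x y := by convert η.map_update_add v i x y
  map_update_smul' v i c x := by
    have e : ∀ z : L, η (Function.update v i z) =
        (-1) ^ (i : ℕ) • η (Matrix.vecCons z (i.removeNth v)) := by
      intro z
      rw [← η.map_insertNth, Fin.insertNth_removeNth]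
      convert rfl
    have e1 := e (c • x)
    have e2 := e x
    rw [h, smul_comm, ← e2] at e1
    convert e1
  map_eq_zero_of_eq' v i j hv hij := η.map_eq_zero_of_eq v hv hij

@[simp] theorem ofReal_apply {k : ℕ} (η : L [⋀^Fin (k + 1)]→ₗ[ℝ] N)
    (h : ∀ (f : R) (x : L) (w : Fin k → L),
      η (Matrix.vecCons (f • x) w) = f • η (Matrix.vecCons x w)) (v) :
    ofReal η h v = η v := rfl

theorem map_cons_smul {k : ℕ} (η : L [⋀^Fin (k + 1)]→ₗ[R] N) (f : R) (x : L) (w : Fin k → L) :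
    η (Matrix.vecCons (f • x) w) = f • η (Matrix.vecCons x w) := by
  have := η.curryLeft.map_smul f x
  exact congrArg (fun g ↦ g w) this

variable (a : L →ₗ[R] R →ₗ[ℝ] R) (br : L →ₗ[ℝ] L →ₗ[ℝ] L) (hbr : ∀ x, br x x = 0)

theorem bracketSum_smul {k : ℕ} (f : R) (η : L [⋀^Fin k]→ₗ[ℝ] N) (v : Fin (k + 1) → L) :
    bracketSum br k (f • η) v = f • bracketSum br k η v := by
  cases k with
  | zero => simp [bracketSum]
  | succ n =>
    simp only [bracketSum, Finset.smul_sum]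
    refine Finset.sum_congr rfl fun i _ ↦ Finset.sum_congr rfl fun j _ ↦ ?_
    split_ifs <;> simp [smul_comm f]

theorem koszul_smul (D : L →ₗ[ℝ] N →ₗ[ℝ] N)
    (hD : ∀ x (f : R) n, D x (f • n) = f • D x n + a x f • n)
    {k : ℕ} (f : R) (η : L [⋀^Fin k]→ₗ[ℝ] N) (v : Fin (k + 1) → L) :
    koszul br hbr D (f • η) v = f • koszul br hbr D η v +
      ∑ i : Fin (k + 1), (-1) ^ (i : ℕ) • (a (v i) f • η (i.removeNth v)) := by
  simp only [koszul_apply, bracketSum_smul, AlternatingMap.smul_apply,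
    hD, smul_add, Finset.sum_add_distrib, Finset.smul_sum, smul_comm f]
  abel

theorem br_smul_left (hbr : ∀ x, br x x = 0)
    (hbrl : ∀ x (f : R) y, br x (f • y) = f • br x y + a x f • y) (f : R) (x y : L) :
    br (f • x) y = f • br x y - a y f • x := by
  rw [br_swap br hbr y, hbrl, br_swap br hbr x y]; simp; abel

theorem koszul_cons_smul (hbrl : ∀ x (f : R) y, br x (f • y) = f • br x y + a x f • y)
    (D : L →ₗ[ℝ] N →ₗ[ℝ] N) (hD : ∀ x (f : R) n, D x (f • n) = f • D x n + a x f • n)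
    {k : ℕ} (η : L [⋀^Fin k]→ₗ[R] N) (f : R) (x : L) (w : Fin k → L) :
    koszul br hbr D (toReal η) (Matrix.vecCons (f • x) w) =
      f • koszul br hbr D (toReal η) (Matrix.vecCons x w) +
        (D (f • x) (η w) - f • D x (η w)) := by
  cases k with
  | zero => simp [koszul_zero_cons]
  | succ n =>
    have hc : (toReal η).curryLeft (f • x) = f • (toReal η).curryLeft x := by
      ext u; exact map_cons_smul η f x u
    rw [koszul_cons, koszul_cons, hc, koszul_smul a br hbr D hD]
    have h1 : ∀ u v z, η (Matrix.vecCons (u - v) z) =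
        η (Matrix.vecCons u z) - η (Matrix.vecCons v z) := fun u v z ↦
      congrArg (fun g ↦ g z) (η.curryLeft.map_sub u v)
    simp only [br_smul_left a br hbr hbrl, h1, toReal_apply, map_cons_smul,
      smul_sub, Finset.sum_sub_distrib, Finset.smul_sum,
      AlternatingMap.curryLeft_apply_apply, smul_comm f]
    abel

/-- The Koszul operator `d_∇` on `R`-multilinear forms. -/
def koszulR (hbrl : ∀ x (f : R) y, br x (f • y) = f • br x y + a x f • y)
    (D : L →ₗ[R] N →ₗ[ℝ] N) (hD : ∀ x (f : R) n, D x (f • n) = f • D x n + a x f • n) {k : ℕ} :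
    (L [⋀^Fin k]→ₗ[R] N) →ₗ[ℝ] L [⋀^Fin (k + 1)]→ₗ[R] N where
  toFun η := ofReal (koszul br hbr (LinearMap.restrictScalars ℝ D) (toReal η)) (fun f x w ↦ by
    rw [koszul_cons_smul a br hbr hbrl _ hD]; simp)
  map_add' η θ := by ext v; simp
  map_smul' c η := by ext v; simp

/-- The wedge product `η ∧_h θ` of forms with values in modules, with respect to a bilinear map
`h`, without any sign coming from degrees of coefficients:
`(v₀, …, v_{p+q-1}) ↦ ∑_σ sgn(σ) h(η(v_{σ(0)}, …, v_{σ(p-1)}), θ(v_{σ(p)}, …, v_{σ(p+q-1)}))`,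
the sum being over all `(p, q)`-shuffles `σ`. -/
def wedge {p q : ℕ} {N₁ N₂ N₃ : Type*} [AddCommGroup N₁] [Module R N₁] [AddCommGroup N₂]
    [Module R N₂] [AddCommGroup N₃] [Module R N₃] (h : N₁ →ₗ[R] N₂ →ₗ[R] N₃) :
    (L [⋀^Fin p]→ₗ[R] N₁) →ₗ[R] (L [⋀^Fin q]→ₗ[R] N₂) →ₗ[R] L [⋀^Fin (p + q)]→ₗ[R] N₃ :=
  LinearMap.mk₂ R
    (fun η θ ↦ ((TensorProduct.lift h).compAlternatingMap (η.domCoprod θ)).domDomCongr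
      finSumFinEquiv)
    (fun η η' θ ↦ by
      rw [← AlternatingMap.domCoprod'_apply, TensorProduct.add_tmul, map_add]; ext; simp)
    (fun c η θ ↦ by
      rw [← AlternatingMap.domCoprod'_apply, ← TensorProduct.smul_tmul', map_smul]; ext; simp)
    (fun η θ θ' ↦ by
      rw [← AlternatingMap.domCoprod'_apply, TensorProduct.tmul_add, map_add]; ext; simp)
    (fun c η θ ↦ by
      rw [← AlternatingMap.domCoprod'_apply, TensorProduct.tmul_smul, map_smul]; ext; simp)

end Tensorial

/-! ### Lie algebroids, connections and differential forms -/

/-- A family of linear maps between the fibres is smooth if it is smooth as a map between the total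
spaces. -/
def IsSmoothFamily {A B : SmoothVectorBundle E M} (φ : ∀ x, A.V x →ₗ[ℝ] B.V x) : Prop :=
  ContMDiff (𝓘(ℝ, E).prod 𝓘(ℝ, A.F)) (𝓘(ℝ, E).prod 𝓘(ℝ, B.F)) ∞
    (fun v : TotalSpace A.F A.V ↦ (⟨v.1, φ v.1 v.2⟩ : TotalSpace B.F B.V))

/-- A smooth vector bundle map over the identity of `M`. -/
structure BundleMap (A B : SmoothVectorBundle E M) where
  /-- the fibrewise linear maps -/
  toFun : ∀ x, A.V x →ₗ[ℝ] B.V x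
  smooth : IsSmoothFamily toFun

/-- The action of a bundle map on sections. -/
def BundleMap.onSec {A B : SmoothVectorBundle E M} (φ : BundleMap A B) :
    Sec A →ₗ[Cinf E M] Sec B where
  toFun s := ⟨fun x ↦ φ.toFun x (s x), ContMDiff.comp φ.smooth s.contMDiff⟩
  map_add' s t := by ext x; exact (φ.toFun x).map_add (s x) (t x)
  map_smul' f s := by ext x; exact (φ.toFun x).map_smul (f x) (s x)

/-- A Lie algebroid structure on the vector bundle `A`. -/
structure LieAlgebroid (A : SmoothVectorBundle E M) where
  /-- the anchor map -/
  anchor : BundleMap A (TM E M)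
  /-- the Lie bracket on `Γ(A)` -/
  bracket : Sec A →ₗ[ℝ] Sec A →ₗ[ℝ] Sec A
  bracket_self : ∀ α, bracket α α = 0
  jacobi : ∀ α β γ, bracket α (bracket β γ) = bracket (bracket α β) γ + bracket β (bracket α γ)
  leibniz : ∀ α (f : Cinf E M) β,
    bracket α (f • β) = f • bracket α β + lieD (anchor.onSec α) f • β

variable {A B : SmoothVectorBundle E M}

/-- The anchor on sections. -/
abbrev LieAlgebroid.ρ (𝔸 : LieAlgebroid A) : Sec A →ₗ[Cinf E M] Sec (TM E M) := 𝔸.anchor.onSec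

/-- The derivation `f ↦ L_{ρ(α)} f` of `C^∞(M)`. -/
def LieAlgebroid.act (𝔸 : LieAlgebroid A) : Sec A →ₗ[Cinf E M] Cinf E M →ₗ[ℝ] Cinf E M :=
  lieD ∘ₗ 𝔸.ρ

variable (E M) in
/-- The Lie algebroid `TM`, with the identity as anchor. -/
def tangentAlgebroid : LieAlgebroid (TM E M) where
  anchor := { toFun := fun _ ↦ LinearMap.id, smooth := contMDiff_id }
  bracket := vfBracket
  bracket_self := vfLie_self
  jacobi := vfLie_jacobi
  leibniz X f Y := vfLie_smul_right X Y f

/-- An `A`-connection on the vector bundle `B`: `conn α s` is `∇_α s`. -/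
structure AConnection (𝔸 : LieAlgebroid A) (B : SmoothVectorBundle E M) where
  /-- the covariant derivative -/
  conn : Sec A →ₗ[Cinf E M] Sec B →ₗ[ℝ] Sec B
  leibniz : ∀ α (f : Cinf E M) s, conn α (f • s) = f • conn α s + lieD (𝔸.ρ α) f • s

/-- A connection on the vector bundle `B`, i.e. a `TM`-connection. -/
abbrev Connection (B : SmoothVectorBundle E M) := AConnection (tangentAlgebroid E M) B

theorem Connection.leibniz' (nabla : Connection B) (X : Sec (TM E M)) (f : Cinf E M) (s : Sec B) :
    nabla.conn X (f • s) = f • nabla.conn X s + lieD X f • s := nabla.leibniz X f s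

/-- The space `Ω^k(A; B)` of `B`-valued `A`-forms of degree `k`, i.e. the sections of
`Λ^k A^* ⊗ B`, as alternating `C^∞(M)`-multilinear maps `Γ(A)^k → Γ(B)`. -/
abbrev Form (A B : SmoothVectorBundle E M) (k : ℕ) := Sec A [⋀^Fin k]→ₗ[Cinf E M] Sec B

/-- The space `Ω^k(A)` of `A`-forms of degree `k`. -/
abbrev ScalarForm (A : SmoothVectorBundle E M) (k : ℕ) := Sec A [⋀^Fin k]→ₗ[Cinf E M] Cinf E M

/-- The De Rham operator `d_A` on `Ω(A)`. -/
def dA (𝔸 : LieAlgebroid A) {k : ℕ} : ScalarForm A k →ₗ[ℝ] ScalarForm A (k + 1) :=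
  koszulR 𝔸.act 𝔸.bracket 𝔸.bracket_self 𝔸.leibniz 𝔸.act
    (fun α f g ↦ lieD_mul (𝔸.ρ α) f g)

/-- The operator `d_∇` on `Ω(A; B)` induced by an `A`-connection on `B`. -/
def dConn {𝔸 : LieAlgebroid A} (nabla : AConnection 𝔸 B) {k : ℕ} :
    Form A B k →ₗ[ℝ] Form A B (k + 1) :=
  koszulR 𝔸.act 𝔸.bracket 𝔸.bracket_self 𝔸.leibniz nabla.conn nabla.leibniz

section Basic

variable (𝔸 : LieAlgebroid A) (nabla : Connection A)

theorem LieAlgebroid.bracket_smul_left (f : Cinf E M) (α β : Sec A) :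
    𝔸.bracket (f • α) β = f • 𝔸.bracket α β - lieD (𝔸.ρ β) f • α :=
  br_smul_left 𝔸.act 𝔸.bracket 𝔸.bracket_self 𝔸.leibniz f α β

theorem vfBracket_smul_left (f : Cinf E M) (X Y : Sec (TM E M)) :
    vfBracket (f • X) Y = f • vfBracket X Y - lieD Y f • X :=
  (tangentAlgebroid E M).bracket_smul_left f X Y

theorem vfBracket_smul_right (f : Cinf E M) (X Y : Sec (TM E M)) :
    vfBracket X (f • Y) = f • vfBracket X Y + lieD X f • Y :=
  vfLie_smul_right X Y f

theorem lieD_vfBracket (X Y : Sec (TM E M)) (f : Cinf E M) :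
    lieD (vfBracket X Y) f = lieD X (lieD Y f) - lieD Y (lieD X f) := lieD_vfLie X Y f

/-- The basic `A`-connection on `A`: `∇^bas_α β = ∇_{ρ(β)} α + [α, β]`. -/
def basA : AConnection 𝔸 A where
  conn :=
    { toFun := fun α ↦
        { toFun := fun β ↦ nabla.conn (𝔸.ρ β) α + 𝔸.bracket α β
          map_add' := fun β γ ↦ by simp only [map_add, LinearMap.add_apply]; abel
          map_smul' := fun c β ↦ by
            simp only [LinearMap.map_smul_of_tower, map_smul, LinearMap.smul_apply, smul_add,
              RingHom.id_apply] }
      map_add' := fun α β ↦ by ext1 γ; simp; abel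
      map_smul' := fun f α ↦ by
        ext1 β
        simp only [LinearMap.coe_mk, AddHom.coe_mk, nabla.leibniz', 𝔸.bracket_smul_left,
          LinearMap.smul_apply, RingHom.id_apply, smul_add]
        abel }
  leibniz α f β := by
    simp only [LinearMap.coe_mk, AddHom.coe_mk, 𝔸.leibniz, map_smul, LinearMap.smul_apply,
      smul_add]
    abel

/-- The basic `A`-connection on `TM`: `∇^bas_α X = ρ(∇_X α) + [ρ(α), X]`. -/
def basT : AConnection 𝔸 (TM E M) where
  conn :=
    { toFun := fun α ↦
        { toFun := fun X ↦ 𝔸.ρ (nabla.conn X α) + vfBracket (𝔸.ρ α) X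
          map_add' := fun β γ ↦ by simp only [map_add, LinearMap.add_apply]; abel
          map_smul' := fun c X ↦ by
            simp only [LinearMap.map_smul_of_tower, map_smul, LinearMap.smul_apply, smul_add,
              RingHom.id_apply] }
      map_add' := fun α β ↦ by ext1 γ; simp; abel
      map_smul' := fun f α ↦ by
        ext1 X
        simp only [LinearMap.coe_mk, AddHom.coe_mk, nabla.leibniz', vfBracket_smul_left,
          LinearMap.smul_apply, RingHom.id_apply, smul_add, map_add, map_smul]
        abel }
  leibniz α f X := by
    simp only [LinearMap.coe_mk, AddHom.coe_mk, vfBracket_smul_right, map_smul,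
      LinearMap.smul_apply, smul_add]
    abel

/-- The expression
`∇_X [α, β] - [∇_X α, β] - [α, ∇_X β] - ∇_{∇^bas_β X} α + ∇_{∇^bas_α X} β`. -/
def rBasFun (α β : Sec A) (X : Sec (TM E M)) : Sec A :=
  nabla.conn X (𝔸.bracket α β) - 𝔸.bracket (nabla.conn X α) β - 𝔸.bracket α (nabla.conn X β)
    - nabla.conn ((basT 𝔸 nabla).conn β X) α + nabla.conn ((basT 𝔸 nabla).conn α X) β

theorem rBasFun_swap (α β : Sec A) (X : Sec (TM E M)) :
    rBasFun 𝔸 nabla β α X = - rBasFun 𝔸 nabla α β X := by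
  simp only [rBasFun]
  rw [br_swap 𝔸.bracket 𝔸.bracket_self α β, br_swap 𝔸.bracket 𝔸.bracket_self α (nabla.conn X β),
    br_swap 𝔸.bracket 𝔸.bracket_self (nabla.conn X α) β, map_neg]
  abel

theorem rBasFun_add (α α' β : Sec A) (X : Sec (TM E M)) :
    rBasFun 𝔸 nabla (α + α') β X = rBasFun 𝔸 nabla α β X + rBasFun 𝔸 nabla α' β X := by
  simp only [rBasFun, map_add, LinearMap.add_apply]
  abel

theorem basT_conn (α : Sec A) (X : Sec (TM E M)) :
    (basT 𝔸 nabla).conn α X = 𝔸.ρ (nabla.conn X α) + vfBracket (𝔸.ρ α) X := rfl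

theorem rBasFun_smul (f : Cinf E M) (α β : Sec A) (X : Sec (TM E M)) :
    rBasFun 𝔸 nabla (f • α) β X = f • rBasFun 𝔸 nabla α β X := by
  have h : lieD ((basT 𝔸 nabla).conn β X) f = lieD (𝔸.ρ (nabla.conn X β)) f
      + (lieD (𝔸.ρ β) (lieD X f) - lieD X (lieD (𝔸.ρ β) f)) := by
    rw [basT_conn, map_add, LinearMap.add_apply, lieD_vfBracket]
  simp only [rBasFun, 𝔸.bracket_smul_left, nabla.leibniz', map_add, map_sub, map_smul,
    LinearMap.add_apply, LinearMap.smul_apply, smul_add, smul_sub, h, add_smul, sub_smul]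
  abel

theorem rBasFun_add_vf (α β : Sec A) (X Y : Sec (TM E M)) :
    rBasFun 𝔸 nabla α β (X + Y) = rBasFun 𝔸 nabla α β X + rBasFun 𝔸 nabla α β Y := by
  simp only [rBasFun, map_add, LinearMap.add_apply]
  abel

theorem rBasFun_smul_vf (f : Cinf E M) (α β : Sec A) (X : Sec (TM E M)) :
    rBasFun 𝔸 nabla α β (f • X) = f • rBasFun 𝔸 nabla α β X := by
  simp only [rBasFun, (basT 𝔸 nabla).leibniz, 𝔸.bracket_smul_left, 𝔸.leibniz, map_add,
    map_smul, LinearMap.add_apply, LinearMap.smul_apply, smul_add, smul_sub]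
  abel

/-- The basic curvature `R^bas_∇ ∈ Ω²(A; Hom(TM, A))`. -/
def rBas : Sec A [⋀^Fin 2]→ₗ[Cinf E M] (Sec (TM E M) →ₗ[Cinf E M] Sec A) where
  toFun v :=
    { toFun := rBasFun 𝔸 nabla (v 0) (v 1)
      map_add' := rBasFun_add_vf 𝔸 nabla (v 0) (v 1)
      map_smul' := fun f X ↦ rBasFun_smul_vf 𝔸 nabla f (v 0) (v 1) X }
  map_update_add' v i α β := by
    ext1 X
    fin_cases i
    · simp [rBasFun_add]
    · simp only [LinearMap.coe_mk, AddHom.coe_mk, LinearMap.add_apply]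
      rw [rBasFun_swap]
      simp [rBasFun_add, rBasFun_swap 𝔸 nabla α (v 0) X, rBasFun_swap 𝔸 nabla β (v 0) X, add_comm]
  map_update_smul' v i f α := by
    ext1 X
    fin_cases i
    · simp [rBasFun_smul]
    · simp only [LinearMap.coe_mk, AddHom.coe_mk, LinearMap.smul_apply]
      rw [rBasFun_swap]
      simp [rBasFun_smul, rBasFun_swap 𝔸 nabla α (v 0) X]
  map_eq_zero_of_eq' v i j hv hij := by
    ext1 X
    have h : v 0 = v 1 := by fin_cases i <;> fin_cases j <;> simp_all
    simp [h, rBasFun, 𝔸.bracket_self, br_swap 𝔸.bracket 𝔸.bracket_self (nabla.conn X (v 1)) (v 1)]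

end Basic

/-! ### The deformation complex -/

section Deformation

variable (A) in
/-- The multiderivations of `A` with `k + 1` arguments: pairs `(c, σ)` of an alternating
`ℝ`-multilinear map `c : Γ(A)^{k+1} → Γ(A)` and its symbol `σ ∈ Ω^k(A; TM)`, such that
`c(α₁, …, α_k, f α) = f c(α₁, …, α_k, α) + L_{σ(α₁, …, α_k)}(f) α`.
The symbol is a part of the data. -/
def Multiderivation (k : ℕ) :
    Submodule ℝ ((Sec A [⋀^Fin (k + 1)]→ₗ[ℝ] Sec A) × Form A (TM E M) k) where
  carrier := {p | ∀ (v : Fin k → Sec A) (f : Cinf E M) (α : Sec A),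
    p.1 (Fin.snoc (α := fun _ ↦ Sec A) v (f • α)) =
      f • p.1 (Fin.snoc (α := fun _ ↦ Sec A) v α) + lieD (p.2 v) f • α}
  add_mem' {p q} hp hq v f α := by
    simp only [Prod.fst_add, Prod.snd_add, AlternatingMap.add_apply, hp v f α, hq v f α, map_add,
      LinearMap.add_apply, smul_add, add_smul]
    abel
  zero_mem' v f α := by simp
  smul_mem' c p hp v f α := by
    simp only [Prod.smul_fst, Prod.smul_snd, AlternatingMap.smul_apply, hp v f α, smul_add,
      LinearMap.map_smul_of_tower, LinearMap.smul_apply, smul_comm c f, smul_assoc]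

theorem snoc_eq_cons {k : ℕ} (c : Sec A [⋀^Fin (k + 1)]→ₗ[ℝ] Sec A) (v : Fin k → Sec A)
    (α : Sec A) : c (Fin.snoc (α := fun _ ↦ Sec A) v α) =
      (-1 : ℤ) ^ k • c (Matrix.vecCons α v) := by
  rw [← Fin.insertNth_last', c.map_insertNth, Fin.val_last]

/-- The defining identity of multiderivations, with the distinguished argument in front. -/
theorem mem_multiderivation_iff {k : ℕ}
    (p : (Sec A [⋀^Fin (k + 1)]→ₗ[ℝ] Sec A) × Form A (TM E M) k) :
    p ∈ Multiderivation A k ↔ ∀ (v : Fin k → Sec A) (f : Cinf E M) (α : Sec A),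
      p.1 (Matrix.vecCons (f • α) v) =
        f • p.1 (Matrix.vecCons α v) + (-1 : ℤ) ^ k • (lieD (p.2 v) f • α) := by
  have hs : ((-1 : ℤ) ^ k) * (-1) ^ k = 1 := by rw [← pow_add, Even.neg_one_pow ⟨k, rfl⟩]
  change (∀ _, _) ↔ _
  refine forall_congr' fun v ↦ forall_congr' fun f ↦ forall_congr' fun α ↦ ?_
  rw [snoc_eq_cons, snoc_eq_cons]
  constructor
  · intro h
    have := congrArg (fun z ↦ (-1 : ℤ) ^ k • z) h
    simpa only [smul_add, smul_smul, hs, one_smul, smul_comm f] using this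
  · intro h
    have := congrArg (fun z ↦ (-1 : ℤ) ^ k • z) h
    simpa only [smul_add, smul_smul, hs, one_smul, smul_comm f] using this

variable (𝔸 : LieAlgebroid A)

/-- The `ℝ`-bilinear operator `(α, X) ↦ [ρ(α), X]`. -/
def rhoBracket : Sec A →ₗ[ℝ] Sec (TM E M) →ₗ[ℝ] Sec (TM E M) :=
  vfBracket ∘ₗ LinearMap.restrictScalars ℝ 𝔸.ρ

/-- The `C^∞(M)`-homogeneity of the symbol of `δ(c)`. -/
theorem deltaSymbol_tensorial {k : ℕ} (c : Multiderivation A k) (f : Cinf E M) (x : Sec A)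
    (w : Fin k → Sec A) :
    (koszul 𝔸.bracket 𝔸.bracket_self (rhoBracket 𝔸) (toReal c.1.2) +
        (-1 : ℤ) ^ k • (LinearMap.restrictScalars ℝ 𝔸.ρ).compAlternatingMap c.1.1)
        (Matrix.vecCons (f • x) w) =
      f • (koszul 𝔸.bracket 𝔸.bracket_self (rhoBracket 𝔸) (toReal c.1.2) +
        (-1 : ℤ) ^ k • (LinearMap.restrictScalars ℝ 𝔸.ρ).compAlternatingMap c.1.1)
        (Matrix.vecCons x w) := by
  have hs : ((-1 : ℤ) ^ k) * (-1) ^ k = 1 := by rw [← pow_add, Even.neg_one_pow ⟨k, rfl⟩]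
  have h := (mem_multiderivation_iff c.1).1 c.2 w f x
  simp only [AlternatingMap.add_apply, AlternatingMap.smul_apply,
    LinearMap.compAlternatingMap_apply, LinearMap.restrictScalars_apply, h]
  rw [koszul_cons_smul 𝔸.act 𝔸.bracket 𝔸.bracket_self 𝔸.leibniz (rhoBracket 𝔸)
    (fun α f X ↦ vfBracket_smul_right f (𝔸.ρ α) X)]
  simp only [rhoBracket, LinearMap.comp_apply, LinearMap.restrictScalars_apply, map_smul,
    vfBracket_smul_left, map_add, smul_add, map_zsmul, smul_smul, hs, one_smul,
    smul_comm f]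
  abel

theorem bracketSum_comp {L N N' : Type*} [AddCommGroup L] [Module ℝ L] [AddCommGroup N]
    [Module ℝ N] [AddCommGroup N'] [Module ℝ N'] (br : L →ₗ[ℝ] L →ₗ[ℝ] L) (g : N →ₗ[ℝ] N') {k : ℕ}
    (η : L [⋀^Fin k]→ₗ[ℝ] N) (v : Fin (k + 1) → L) :
    bracketSum br k (g.compAlternatingMap η) v = g (bracketSum br k η v) := by
  cases k with
  | zero => simp [bracketSum]
  | succ n =>
    simp only [bracketSum, map_sum]
    refine Finset.sum_congr rfl fun i _ ↦ Finset.sum_congr rfl fun j _ ↦ ?_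
    split_ifs <;> simp

/-- The symbol of `δ(c)`, for a multiderivation `c` with `k + 1` arguments and symbol `σ`:
`∑_{p<q} (-1)^{p+q} σ([α_p, α_q], …) + ∑_i (-1)^i [ρ(α_i), σ(…, α̂_i, …)] + (-1)^k ρ(c(…))`. -/
def deltaSymbol {k : ℕ} (c : Multiderivation A k) : Form A (TM E M) (k + 1) :=
  ofReal (koszul 𝔸.bracket 𝔸.bracket_self (rhoBracket 𝔸) (toReal c.1.2) +
    (-1 : ℤ) ^ k • (LinearMap.restrictScalars ℝ 𝔸.ρ).compAlternatingMap c.1.1)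
    (deltaSymbol_tensorial 𝔸 c)

theorem deltaSymbol_apply {k : ℕ} (c : Multiderivation A k) (w : Fin (k + 1) → Sec A) :
    deltaSymbol 𝔸 c w = koszul 𝔸.bracket 𝔸.bracket_self (rhoBracket 𝔸) (toReal c.1.2) w +
      (-1 : ℤ) ^ k • 𝔸.ρ (c.1.1 w) := rfl

theorem delta_mem {k : ℕ} (c : Multiderivation A k) :
    (koszul 𝔸.bracket 𝔸.bracket_self 𝔸.bracket c.1.1, deltaSymbol 𝔸 c) ∈
      Multiderivation A (k + 1) := by
  rw [mem_multiderivation_iff]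
  intro w f x
  have hc := (mem_multiderivation_iff c.1).1 c.2
  have hsq : ((-1 : ℤ) ^ k) * (-1) ^ k = 1 := by rw [← pow_add, Even.neg_one_pow ⟨k, rfl⟩]
  simp only [pow_succ, mul_neg, mul_one]
  simp only [deltaSymbol_apply]
  generalize hs : (-1 : ℤ) ^ k = s at hc hsq
  set T : Sec (TM E M) →ₗ[ℝ] Sec A :=
    { toFun := fun X ↦ lieD X f • x
      map_add' := fun X Y ↦ by simp [add_smul]
      map_smul' := fun r X ↦ by
        simp only [LinearMap.map_smul_of_tower, LinearMap.smul_apply, smul_assoc,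
          RingHom.id_apply] } with hT
  have hTa : ∀ X, T X = lieD X f • x := fun _ ↦ rfl
  have hcur : c.1.1.curryLeft (f • x) =
      f • c.1.1.curryLeft x + s • T.compAlternatingMap (toReal c.1.2) := by
    ext1 u; exact hc u f x
  have hA : ∑ j : Fin (k + 1), (-1) ^ (j : ℕ) •
      c.1.1 (Matrix.vecCons (𝔸.bracket (f • x) (w j)) (j.removeNth w)) =
      f • (∑ j : Fin (k + 1), (-1) ^ (j : ℕ) •
        c.1.1 (Matrix.vecCons (𝔸.bracket x (w j)) (j.removeNth w)))
      - s • (∑ j : Fin (k + 1), (-1) ^ (j : ℕ) •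
        (lieD (c.1.2 (j.removeNth w)) f • 𝔸.bracket (w j) x))
      - (∑ j : Fin (k + 1), (-1) ^ (j : ℕ) •
        (lieD (𝔸.ρ (w j)) f • c.1.1 (Matrix.vecCons x (j.removeNth w))))
      - s • (∑ j : Fin (k + 1), (-1) ^ (j : ℕ) •
        (lieD (c.1.2 (j.removeNth w)) (lieD (𝔸.ρ (w j)) f) • x)) := by
    simp only [Finset.smul_sum, ← Finset.sum_sub_distrib]
    refine Finset.sum_congr rfl fun j _ ↦ ?_
    have h1 : ∀ u v z, c.1.1 (Matrix.vecCons (u - v) z) =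
        c.1.1 (Matrix.vecCons u z) - c.1.1 (Matrix.vecCons v z) := fun u v z ↦
      congrArg (fun g ↦ g z) (c.1.1.curryLeft.map_sub u v)
    rw [𝔸.bracket_smul_left, h1, hc, hc, br_swap 𝔸.bracket 𝔸.bracket_self x (w j)]
    rw [smul_comm f ((-1 : ℤ) ^ (j : ℕ)), smul_comm s ((-1 : ℤ) ^ (j : ℕ)),
      smul_comm s ((-1 : ℤ) ^ (j : ℕ)), ← smul_sub, ← smul_sub, ← smul_sub]
    congr 1
    simp only [smul_neg]
    abel
  have hB : koszul 𝔸.bracket 𝔸.bracket_self 𝔸.bracket (c.1.1.curryLeft (f • x)) w =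
      f • koszul 𝔸.bracket 𝔸.bracket_self 𝔸.bracket (c.1.1.curryLeft x) w
      + (∑ j : Fin (k + 1), (-1) ^ (j : ℕ) •
        (lieD (𝔸.ρ (w j)) f • c.1.1 (Matrix.vecCons x (j.removeNth w))))
      + s • (T (bracketSum 𝔸.bracket k (toReal c.1.2) w)
        + (∑ j : Fin (k + 1), (-1) ^ (j : ℕ) •
          (lieD (c.1.2 (j.removeNth w)) f • 𝔸.bracket (w j) x))
        + (∑ j : Fin (k + 1), (-1) ^ (j : ℕ) •
          (lieD (𝔸.ρ (w j)) (lieD (c.1.2 (j.removeNth w)) f) • x))) := by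
    rw [hcur, map_add, AlternatingMap.add_apply, map_zsmul, AlternatingMap.smul_apply,
      koszul_smul 𝔸.act 𝔸.bracket 𝔸.bracket_self 𝔸.bracket 𝔸.leibniz]
    congr 1
    rw [koszul_apply, bracketSum_comp, add_assoc, ← Finset.sum_add_distrib]
    congr 2
    refine Finset.sum_congr rfl fun j _ ↦ ?_
    rw [← smul_add]
    congr 1
    exact 𝔸.leibniz _ _ _
  have hC : lieD (koszul 𝔸.bracket 𝔸.bracket_self (rhoBracket 𝔸) (toReal c.1.2) w +
      s • 𝔸.ρ (c.1.1 w)) f • x = T (bracketSum 𝔸.bracket k (toReal c.1.2) w)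
      + (∑ j : Fin (k + 1), (-1) ^ (j : ℕ) •
          (lieD (𝔸.ρ (w j)) (lieD (c.1.2 (j.removeNth w)) f) • x))
      - (∑ j : Fin (k + 1), (-1) ^ (j : ℕ) •
        (lieD (c.1.2 (j.removeNth w)) (lieD (𝔸.ρ (w j)) f) • x))
      + s • (lieD (𝔸.ρ (c.1.1 w)) f • x) := by
    rw [← hTa, ← hTa, koszul_apply, map_add, map_add, map_zsmul, map_sum, add_sub_assoc,
      ← Finset.sum_sub_distrib]
    congr 2
    refine Finset.sum_congr rfl fun j _ ↦ ?_
    rw [map_zsmul, ← smul_sub, hTa, ← sub_smul]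
    congr 2
    exact lieD_vfBracket _ _ _
  rw [koszul_cons, koszul_cons, hA, hB, hC, 𝔸.bracket_smul_left]
  simp only [smul_add, smul_sub, smul_smul, neg_mul, hsq, neg_smul, one_smul]
  abel

/-- The differential `δ` on multiderivations with at least one argument. -/
def deltaPos (k : ℕ) : Multiderivation A k →ₗ[ℝ] Multiderivation A (k + 1) where
  toFun c := ⟨(koszul 𝔸.bracket 𝔸.bracket_self 𝔸.bracket c.1.1, deltaSymbol 𝔸 c), delta_mem 𝔸 c⟩
  map_add' c c' := by
    ext1
    refine Prod.ext ?_ ?_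
    · exact map_add _ _ _
    · ext1 v
      change deltaSymbol 𝔸 (c + c') v = deltaSymbol 𝔸 c v + deltaSymbol 𝔸 c' v
      simp only [deltaSymbol_apply, Submodule.coe_add, Prod.snd_add, Prod.fst_add, map_add,
        AlternatingMap.add_apply, smul_add]
      abel
  map_smul' r c := by
    ext1
    refine Prod.ext ?_ ?_
    · exact map_smul _ _ _
    · ext1 v
      change deltaSymbol 𝔸 (r • c) v = r • deltaSymbol 𝔸 c v
      simp only [deltaSymbol_apply, Submodule.coe_smul, Prod.smul_snd, Prod.smul_fst, map_smul,
        LinearMap.map_smul_of_tower, AlternatingMap.smul_apply, smul_add,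
        smul_comm ((-1 : ℤ) ^ k) r]

/-- The differential `δ` in degree zero: `δ(γ)(α) = [α, γ]`, with symbol `-ρ(γ)`. -/
def deltaZero : Sec A →ₗ[ℝ] Multiderivation A 0 where
  toFun γ := ⟨(koszul 𝔸.bracket 𝔸.bracket_self 𝔸.bracket
      (AlternatingMap.constOfIsEmpty ℝ (Sec A) (Fin 0) γ),
      AlternatingMap.constOfIsEmpty _ _ (Fin 0) (-𝔸.ρ γ)), by
    rw [mem_multiderivation_iff]
    intro w f x
    simp [koszul_zero_cons, 𝔸.bracket_smul_left, sub_eq_add_neg]⟩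
  map_add' c c' := by
    ext1
    refine Prod.ext ?_ ?_
    · exact map_add (koszul 𝔸.bracket 𝔸.bracket_self 𝔸.bracket)
        (AlternatingMap.constOfIsEmpty ℝ (Sec A) (Fin 0) c)
        (AlternatingMap.constOfIsEmpty ℝ (Sec A) (Fin 0) c')
    · ext1 v
      change -𝔸.ρ (c + c') = -𝔸.ρ c + -𝔸.ρ c'
      rw [map_add, neg_add]
  map_smul' r c := by
    ext1
    refine Prod.ext ?_ ?_
    · exact map_smul (koszul 𝔸.bracket 𝔸.bracket_self 𝔸.bracket) r
        (AlternatingMap.constOfIsEmpty ℝ (Sec A) (Fin 0) c)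
    · ext1 v
      change -𝔸.ρ (r • c) = r • -𝔸.ρ c
      rw [LinearMap.map_smul_of_tower, smul_neg]

variable (A) in
/-- The space `C^k_def(A)` of deformation cochains of degree `k`. -/
def DefCochain : ℕ → Type (max u w)
  | 0 => Sec A
  | k + 1 => Multiderivation A k

instance : (k : ℕ) → AddCommGroup (DefCochain A k)
  | 0 => inferInstanceAs (AddCommGroup (Sec A))
  | k + 1 => inferInstanceAs (AddCommGroup (Multiderivation A k))

instance : (k : ℕ) → Module ℝ (DefCochain A k)
  | 0 => (inferInstance : Module ℝ (Sec A))
  | k + 1 => (inferInstance : Module ℝ (Multiderivation A k))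

/-- The differential `δ : C^k_def(A) → C^{k+1}_def(A)`. -/
def delta : (k : ℕ) → DefCochain A k →ₗ[ℝ] DefCochain A (k + 1)
  | 0 => deltaZero 𝔸
  | k + 1 => deltaPos 𝔸 k

variable (A) in
/-- The deformation cochains of all degrees. -/
abbrev TotDef := ⨁ k : ℕ, DefCochain A k

/-- The differential `δ` of the deformation complex. -/
def deltaTot : TotDef A →ₗ[ℝ] TotDef A :=
  DirectSum.toModule ℝ ℕ _ fun k ↦ DirectSum.lof ℝ ℕ (DefCochain A) (k + 1) ∘ₗ delta 𝔸 k

end Deformation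

/-! ### Representations up to homotopy -/

section Graded

variable {ι : Type*} [DecidableEq ι]

/-- The elements of degree `n` of a direct sum whose summand of index `i` has degree `deg i`. -/
def degreePart (V : ι → Type*) [∀ i, AddCommGroup (V i)] [∀ i, Module ℝ (V i)]
    (deg : ι → ℤ) (n : ℤ) : Submodule ℝ (⨁ i, V i) where
  carrier := {θ | ∀ i, deg i ≠ n → θ i = 0}
  add_mem' {θ θ'} h h' i hi := by rw [DirectSum.add_apply, h i hi, h' i hi, add_zero]
  zero_mem' _ _ := rfl
  smul_mem' c θ h i hi := by rw [DirectSum.smul_apply, h i hi, smul_zero]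

variable {C C' : Type*} [AddCommGroup C] [Module ℝ C] [AddCommGroup C'] [Module ℝ C']

/-- The cocycles of degree `n` of a graded vector space `(C, gr)` with differential `d`. -/
def cocycles (gr : ℤ → Submodule ℝ C) (d : C →ₗ[ℝ] C) (n : ℤ) : Submodule ℝ C :=
  gr n ⊓ LinearMap.ker d

/-- The coboundaries of degree `n`. -/
def coboundaries (gr : ℤ → Submodule ℝ C) (d : C →ₗ[ℝ] C) (n : ℤ) :
    Submodule ℝ (cocycles gr d n) :=
  ((gr (n - 1)).map d).submoduleOf (cocycles gr d n)

/-- The cohomology in degree `n`. -/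
abbrev Cohomology (gr : ℤ → Submodule ℝ C) (d : C →ₗ[ℝ] C) (n : ℤ) :=
  cocycles gr d n ⧸ coboundaries gr d n

/-- The cohomology class of a cocycle. -/
def cohomologyClass (gr : ℤ → Submodule ℝ C) (d : C →ₗ[ℝ] C) (n : ℤ) :
    cocycles gr d n →ₗ[ℝ] Cohomology gr d n :=
  Submodule.mkQ _

/-- The map induced in cohomology by a degree preserving chain map. -/
def cohomologyMap {gr : ℤ → Submodule ℝ C} {d : C →ₗ[ℝ] C} {gr' : ℤ → Submodule ℝ C'}
    {d' : C' →ₗ[ℝ] C'} (f : C →ₗ[ℝ] C') (hgr : ∀ n, ∀ x ∈ gr n, f x ∈ gr' n)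
    (hd : ∀ x, f (d x) = d' (f x)) (n : ℤ) : Cohomology gr d n →ₗ[ℝ] Cohomology gr' d' n :=
  Submodule.mapQ _ _
    (f.restrict (p := cocycles gr d n) (q := cocycles gr' d' n) (fun x hx ↦
      ⟨hgr n x hx.1, by
        have h : d x = 0 := hx.2
        change d' (f x) = 0
        rw [← hd, h, map_zero]⟩))
    (by
      rintro ⟨x, hx⟩ ⟨y, hy, hyx⟩
      exact ⟨f y, hgr _ y hy, by rw [← hd, hyx]; rfl⟩)

end Graded

/-- A graded vector bundle of finite rank over `M`, with components indexed by the integers. -/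
structure GradedVectorBundle (E : Type u) [NormedAddCommGroup E] [NormedSpace ℝ E]
    (M : Type w) [TopologicalSpace M] [ChartedSpace E M] where
  /-- the component of degree `n` -/
  comp : ℤ → SmoothVectorBundle E M
  finite : {n | ∃ x, Nontrivial ((comp n).V x)}.Finite

/-- The space `Ω(A; 𝓔)`: the direct sum of all the spaces `Ω^k(A; 𝓔^j)`. -/
abbrev TotForms (A : SmoothVectorBundle E M) (𝓔 : GradedVectorBundle E M) :=
  ⨁ p : ℕ × ℤ, Form A (𝓔.comp p.2) p.1

/-- `Ω(A; 𝓔)^n`, the direct sum of the spaces `Ω^k(A; 𝓔^j)` with `k + j = n`. -/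
def formDegree (A : SmoothVectorBundle E M) (𝓔 : GradedVectorBundle E M) (n : ℤ) :
    Submodule ℝ (TotForms A 𝓔) :=
  degreePart (fun p : ℕ × ℤ ↦ Form A (𝓔.comp p.2) p.1) (fun p ↦ (p.1 : ℤ) + p.2) n

instance (A B : SmoothVectorBundle E M) (k : ℕ) : IsScalarTower ℝ (Cinf E M) (Form A B k) where
  smul_assoc c f η := by ext1 v; exact smul_assoc c f (η v)

/-- The left multiplication `θ ↦ η ∧ θ` on `Ω(A; 𝓔)` by a form `η ∈ Ω^k(A)`. -/
def leftMul {𝓔 : GradedVectorBundle E M} {k : ℕ} (η : ScalarForm A k) :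
    TotForms A 𝓔 →ₗ[ℝ] TotForms A 𝓔 :=
  DirectSum.toModule ℝ (ℕ × ℤ) _ fun p ↦
    DirectSum.lof ℝ (ℕ × ℤ) (fun p ↦ Form A (𝓔.comp p.2) p.1) (k + p.1, p.2) ∘ₗ
      LinearMap.restrictScalars ℝ
        (wedge (LinearMap.lsmul (Cinf E M) (Sec (𝓔.comp p.2))) η :
          Form A (𝓔.comp p.2) p.1 →ₗ[Cinf E M] Form A (𝓔.comp p.2) (k + p.1))

/-- The structure operators on `Ω(A; 𝓔)`: the operators `D` of degree one with `D² = 0` and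
`D(η ∧ θ) = d_A(η) ∧ θ + (-1)^k η ∧ D(θ)` for all `η ∈ Ω^k(A)`. -/
structure IsStructureOperator (𝔸 : LieAlgebroid A) (𝓔 : GradedVectorBundle E M)
    (D : TotForms A 𝓔 →ₗ[ℝ] TotForms A 𝓔) : Prop where
  degree : ∀ n, ∀ θ ∈ formDegree A 𝓔 n, D θ ∈ formDegree A 𝓔 (n + 1)
  square : ∀ θ, D (D θ) = 0
  derivation : ∀ {k : ℕ} (η : ScalarForm A k) (θ : TotForms A 𝓔),
    D (leftMul η θ) = leftMul (dA 𝔸 η) θ + (-1 : ℤ) ^ k • leftMul η (D θ)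

/-- A representation up to homotopy of the Lie algebroid `A`. -/
structure RepUpToHomotopy (𝔸 : LieAlgebroid A) where
  /-- the underlying graded vector bundle -/
  bundle : GradedVectorBundle E M
  /-- the structure operator -/
  D : TotForms A bundle →ₗ[ℝ] TotForms A bundle
  isStructureOperator : IsStructureOperator 𝔸 bundle D

/-- A morphism of representations up to homotopy: a degree zero `Ω(A)`-linear map which commutes
with the structure operators. -/
@[ext] structure RepHom {𝔸 : LieAlgebroid A} (V W : RepUpToHomotopy 𝔸) where
  /-- the underlying linear map -/
  toLin : TotForms A V.bundle →ₗ[ℝ] TotForms A W.bundle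
  degree : ∀ n, ∀ θ ∈ formDegree A V.bundle n, toLin θ ∈ formDegree A W.bundle n
  linear : ∀ {k : ℕ} (η : ScalarForm A k) (θ : TotForms A V.bundle),
    toLin (leftMul η θ) = leftMul η (toLin θ)
  comm : ∀ θ, toLin (V.D θ) = W.D (toLin θ)

instance (𝔸 : LieAlgebroid A) : CategoryTheory.Category (RepUpToHomotopy 𝔸) where
  Hom V W := RepHom V W
  id V := ⟨LinearMap.id, fun _ _ h ↦ h, fun _ _ ↦ rfl, fun _ ↦ rfl⟩
  comp φ ψ := ⟨ψ.toLin ∘ₗ φ.toLin, fun n θ h ↦ ψ.degree n _ (φ.degree n θ h),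
    fun η θ ↦ by simp only [LinearMap.comp_apply, φ.linear, ψ.linear],
    fun θ ↦ by simp only [LinearMap.comp_apply, φ.comm, ψ.comm]⟩

/-- The set `Rep^∞(A)` of isomorphism classes of representations up to homotopy of `A`. -/
def RepInfty (𝔸 : LieAlgebroid A) := Quotient (CategoryTheory.isIsomorphicSetoid (RepUpToHomotopy 𝔸))

/-- The isomorphism class of a representation up to homotopy. -/
def RepUpToHomotopy.isoClass {𝔸 : LieAlgebroid A} (V : RepUpToHomotopy 𝔸) : RepInfty 𝔸 :=
  Quotient.mk (CategoryTheory.isIsomorphicSetoid (RepUpToHomotopy 𝔸)) V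

/-- The cocycles of degree `n` of `(Ω(A; 𝓔), D)`. -/
abbrev RepUpToHomotopy.Cocycles {𝔸 : LieAlgebroid A} (V : RepUpToHomotopy 𝔸) (n : ℤ) :=
  cocycles (formDegree A V.bundle) V.D n

/-- The cohomology `H^n(A; 𝓔)` of `A` with values in a representation up to homotopy. -/
abbrev RepUpToHomotopy.H {𝔸 : LieAlgebroid A} (V : RepUpToHomotopy 𝔸) (n : ℤ) :=
  Cohomology (formDegree A V.bundle) V.D n

/-- The class in `H^n(A; 𝓔)` of a cocycle. -/
abbrev RepUpToHomotopy.cls {𝔸 : LieAlgebroid A} (V : RepUpToHomotopy 𝔸) (n : ℤ) :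
    V.Cocycles n →ₗ[ℝ] V.H n :=
  cohomologyClass (formDegree A V.bundle) V.D n

/-- The map induced in cohomology by a morphism of representations up to homotopy. -/
def RepHom.mapH {𝔸 : LieAlgebroid A} {V W : RepUpToHomotopy 𝔸} (φ : RepHom V W) (n : ℤ) :
    V.H n →ₗ[ℝ] W.H n :=
  cohomologyMap φ.toLin φ.degree φ.comm n

/-! ### Deformation cohomology -/

variable (A) in
/-- The deformation cochains of degree `n`. -/
def defDegree (n : ℤ) : Submodule ℝ (TotDef A) := degreePart (DefCochain A) (fun k ↦ (k : ℤ)) n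

/-- The deformation cocycles of degree `n`. -/
abbrev DefCocycles (𝔸 : LieAlgebroid A) (n : ℤ) := cocycles (defDegree A) (deltaTot 𝔸) n

/-- The deformation cohomology `H^n_def(A)`. -/
abbrev DefH (𝔸 : LieAlgebroid A) (n : ℤ) := Cohomology (defDegree A) (deltaTot 𝔸) n

/-- The deformation cohomology class of a cocycle. -/
abbrev defCls (𝔸 : LieAlgebroid A) (n : ℤ) : DefCocycles 𝔸 n →ₗ[ℝ] DefH 𝔸 n :=
  cohomologyClass (defDegree A) (deltaTot 𝔸) n

/-! ### The adjoint representation -/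

section Adjoint

variable (A) in
/-- The components of the adjoint complex: `A` in degree `0`, `TM` in degree `1`. -/
def adComp : ℤ → SmoothVectorBundle E M
  | .ofNat 0 => A
  | .ofNat 1 => TM E M
  | _ => zeroBundle E M

variable (A) in
/-- The graded vector bundle underlying the adjoint complex `A → TM`. -/
def adBundle : GradedVectorBundle E M where
  comp := adComp A
  finite := by
    refine (Set.toFinite {0, 1}).subset ?_
    rintro n ⟨x, hx⟩
    match n, hx with
    | .ofNat 0, _ => exact Or.inl rfl
    | .ofNat 1, _ => exact Or.inr rfl
    | .ofNat (n + 2), hx => exact absurd hx (not_nontrivial PUnit)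
    | .negSucc n, hx => exact absurd hx (not_nontrivial PUnit)

/-- The inclusion of `Ω^k(A; A)` in `Ω(A; Ad)`. -/
def inclA (k : ℕ) : Form A A k →ₗ[ℝ] TotForms A (adBundle A) :=
  DirectSum.lof ℝ (ℕ × ℤ) (fun p ↦ Form A ((adBundle A).comp p.2) p.1) (k, .ofNat 0)

/-- The inclusion of `Ω^k(A; TM)` in `Ω(A; Ad)`. -/
def inclT (k : ℕ) : Form A (TM E M) k →ₗ[ℝ] TotForms A (adBundle A) :=
  DirectSum.lof ℝ (ℕ × ℤ) (fun p ↦ Form A ((adBundle A).comp p.2) p.1) (k, .ofNat 1)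

variable (𝔸 : LieAlgebroid A) (nabla : Connection A)

/-- The composition `η ↦ ρ ∘ η` from `Ω^k(A; A)` to `Ω^k(A; TM)`. -/
def rhoComp (k : ℕ) : Form A A k →ₗ[ℝ] Form A (TM E M) k where
  toFun η := 𝔸.ρ.compAlternatingMap η
  map_add' η θ := by ext1 v; exact map_add 𝔸.ρ (η v) (θ v)
  map_smul' c η := by ext1 v; exact LinearMap.map_smul_of_tower 𝔸.ρ c (η v)

/-- The wedge product `η ↦ R^bas_∇ ∧ η` from `Ω^k(A; TM)` to `Ω^{k+2}(A; A)`, without sign. -/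
def rBasWedge (k : ℕ) : Form A (TM E M) k →ₗ[ℝ] Form A A (2 + k) :=
  LinearMap.restrictScalars ℝ
    (wedge (LinearMap.id : (Sec (TM E M) →ₗ[Cinf E M] Sec A) →ₗ[Cinf E M] _) (rBas 𝔸 nabla))

/-- The components of the operator `ρ + ∇^bas + R^bas_∇`. With the usual sign conventions for
graded objects, it sends `η ∈ Ω^k(A; A)` to `(-1)^k ρ ∘ η + d_{∇^bas} η` and
`η ∈ Ω^k(A; TM)` to `d_{∇^bas} η + (-1)^k R^bas_∇ ∧ η`. -/
def adOperatorComp (k : ℕ) : (j : ℤ) → Form A (adComp A j) k →ₗ[ℝ] TotForms A (adBundle A)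
  | .ofNat 0 => (-1 : ℤ) ^ k • (inclT k ∘ₗ rhoComp 𝔸 k) + inclA (k + 1) ∘ₗ dConn (basA 𝔸 nabla)
  | .ofNat 1 => inclT (k + 1) ∘ₗ dConn (basT 𝔸 nabla) +
      (-1 : ℤ) ^ k • (inclA (2 + k) ∘ₗ rBasWedge 𝔸 nabla k)
  | .ofNat (_ + 2) => 0
  | .negSucc _ => 0

/-- The operator `D_∇ = ρ + ∇^bas + R^bas_∇` on `Ω(A; Ad)`. -/
def adOperator : TotForms A (adBundle A) →ₗ[ℝ] TotForms A (adBundle A) :=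
  DirectSum.toModule ℝ (ℕ × ℤ) _ fun p ↦ adOperatorComp 𝔸 nabla p.1 p.2

theorem adOperator_inclA (k : ℕ) (η : Form A A k) : adOperator 𝔸 nabla (inclA k η) =
    (-1 : ℤ) ^ k • inclT k (rhoComp 𝔸 k η) + inclA (k + 1) (dConn (basA 𝔸 nabla) η) :=
  DirectSum.toModule_lof ..

theorem adOperator_inclT (k : ℕ) (η : Form A (TM E M) k) : adOperator 𝔸 nabla (inclT k η) =
    inclT (k + 1) (dConn (basT 𝔸 nabla) η) +
      (-1 : ℤ) ^ k • inclA (2 + k) (rBasWedge 𝔸 nabla k η) :=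
  DirectSum.toModule_lof ..

/-- The representation up to homotopy `Ad_∇`, once `D_∇` is known to be a structure operator. -/
def adRep (h : IsStructureOperator 𝔸 (adBundle A) (adOperator 𝔸 nabla)) : RepUpToHomotopy 𝔸 where
  bundle := adBundle A
  D := adOperator 𝔸 nabla
  isStructureOperator := h

/-- The alternating map `(α₀, …, α_k) ↦ ∑_i (-1)^i ∇_{σ(α₀, …, α̂_i, …, α_k)} α_i`. -/
def symbolTerm {k : ℕ} (σ : Form A (TM E M) k) : Sec A [⋀^Fin (k + 1)]→ₗ[ℝ] Sec A :=
  AlternatingMap.alternatizeUncurryFin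
    { toFun := fun α ↦
        ((LinearMap.restrictScalars ℝ nabla.conn).flip α).compAlternatingMap (toReal σ)
      map_add' := fun α β ↦ by ext1 v; simp
      map_smul' := fun c α ↦ by ext1 v; simp }

theorem symbolTerm_apply {k : ℕ} (σ : Form A (TM E M) k) (v : Fin (k + 1) → Sec A) :
    symbolTerm nabla σ v =
      ∑ i : Fin (k + 1), (-1) ^ (i : ℕ) • nabla.conn (σ (i.removeNth v)) (v i) := by
  simp [symbolTerm, AlternatingMap.alternatizeUncurryFin_apply]

theorem splitting_tensorial {k : ℕ} (c : Multiderivation A k) (f : Cinf E M) (x : Sec A)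
    (w : Fin k → Sec A) :
    (c.1.1 - (-1 : ℤ) ^ k • symbolTerm nabla c.1.2) (Matrix.vecCons (f • x) w) =
      f • (c.1.1 - (-1 : ℤ) ^ k • symbolTerm nabla c.1.2) (Matrix.vecCons x w) := by
  have hc := (mem_multiderivation_iff c.1).1 c.2 w f x
  have key : symbolTerm nabla c.1.2 (Matrix.vecCons (f • x) w) =
      f • symbolTerm nabla c.1.2 (Matrix.vecCons x w) + lieD (c.1.2 w) f • x := by
    rw [symbolTerm_apply, symbolTerm_apply, Fin.sum_univ_succ, Fin.sum_univ_succ]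
    have e0 : ∀ y : Sec A, (0 : Fin (k + 1)).removeNth (Matrix.vecCons y w) = w := fun _ ↦ rfl
    have hs : ∀ i : Fin k, nabla.conn (c.1.2 (i.succ.removeNth (Matrix.vecCons (f • x) w)))
        (Matrix.vecCons (f • x) w i.succ) =
        f • nabla.conn (c.1.2 (i.succ.removeNth (Matrix.vecCons x w)))
          (Matrix.vecCons x w i.succ) := by
      intro i
      cases k with
      | zero => exact i.elim0
      | succ k =>
        rw [removeNth_succ_cons, removeNth_succ_cons, map_cons_smul, map_smul]
        rfl
    simp only [e0, hs, Matrix.cons_val_zero, nabla.leibniz', Fin.val_zero, pow_zero, one_smul,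
      smul_add, Finset.smul_sum, smul_comm f]
    abel
  simp only [AlternatingMap.sub_apply, AlternatingMap.smul_apply, hc, key, smul_add, smul_sub,
    smul_comm f]
  abel

/-- The form `c_∇ ∈ Ω^{k+1}(A; A)` of a multiderivation `c` with `k + 1` arguments and symbol `σ`:
`c_∇(α₀, …, α_k) = c(α₀, …, α_k) - (-1)^k ∑_i (-1)^i ∇_{σ(α₀, …, α̂_i, …, α_k)} α_i`, with the
arguments numbered from `0`. -/
def splitting {k : ℕ} (c : Multiderivation A k) : Form A A (k + 1) :=
  ofReal (c.1.1 - (-1 : ℤ) ^ k • symbolTerm nabla c.1.2) (splitting_tensorial nabla c)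

theorem splitting_apply {k : ℕ} (c : Multiderivation A k) (v : Fin (k + 1) → Sec A) :
    splitting nabla c v = c.1.1 v - (-1 : ℤ) ^ k •
      ∑ i : Fin (k + 1), (-1) ^ (i : ℕ) • nabla.conn (c.1.2 (i.removeNth v)) (v i) := by
  rw [← symbolTerm_apply]; rfl

theorem splitting_add {k : ℕ} (c c' : Multiderivation A k) :
    splitting nabla (c + c') = splitting nabla c + splitting nabla c' := by
  ext1 v
  rw [AlternatingMap.add_apply, splitting_apply, splitting_apply, splitting_apply]
  simp only [Submodule.coe_add, Prod.fst_add, Prod.snd_add, AlternatingMap.add_apply,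
    map_add, LinearMap.add_apply, smul_add, Finset.sum_add_distrib]
  abel

theorem splitting_smul {k : ℕ} (r : ℝ) (c : Multiderivation A k) :
    splitting nabla (r • c) = r • splitting nabla c := by
  ext1 v
  rw [AlternatingMap.smul_apply, splitting_apply, splitting_apply]
  simp only [Submodule.coe_smul, Prod.smul_fst, Prod.smul_snd, AlternatingMap.smul_apply,
    LinearMap.map_smul_of_tower, LinearMap.smul_apply, smul_sub, Finset.smul_sum]
  simp only [smul_comm _ r]

/-- The map `c ↦ (c_∇, -σ)` on multiderivations. -/
def psiPos (k : ℕ) : Multiderivation A k →ₗ[ℝ] TotForms A (adBundle A) where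
  toFun c := inclA (k + 1) (splitting nabla c) + inclT k (-c.1.2)
  map_add' c c' := by
    rw [splitting_add, Submodule.coe_add, Prod.snd_add, neg_add, map_add, map_add]
    abel
  map_smul' r c := by
    rw [splitting_smul, Submodule.coe_smul, Prod.smul_snd, ← smul_neg, map_smul, map_smul,
      RingHom.id_apply, smul_add]

/-- The components of the map `Ψ_∇` from deformation cochains to forms:
`γ ↦ γ` on `C^0_def(A) = Γ(A)`, and `c ↦ (c_∇, -σ)` on `C^{k+1}_def(A)`. -/
def psiComp : (k : ℕ) → DefCochain A k →ₗ[ℝ] TotForms A (adBundle A)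
  | 0 => inclA 0 ∘ₗ
    { toFun := fun γ : Sec A ↦ AlternatingMap.constOfIsEmpty _ _ (Fin 0) γ
      map_add' := fun _ _ ↦ rfl
      map_smul' := fun _ _ ↦ rfl }
  | k + 1 => psiPos nabla k

/-- The map `Ψ_∇` from deformation cochains to `Ω(A; Ad)`. -/
def psi : TotDef A →ₗ[ℝ] TotForms A (adBundle A) :=
  DirectSum.toModule ℝ ℕ _ (psiComp nabla)

end Adjoint

end AdjointRep

end

open AdjointRep

/-! Everything rests on `psi`, the map Ψ_∇. It is a linear bijection of graded spaces: an A-valued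
form is a multiderivation with symbol zero, and (-1)^k ∑ ± ∇_{σ(…)} α_i is a multiderivation with
prescribed symbol σ, so that a connection splits the deformation cochains into A-valued forms and
symbols (`psi_surjective`, `psi_injective`, `psi_mem_formDegree_iff`). Moreover Ψ_∇ δ = D_∇ Ψ_∇
(`psi_deltaTot`). Most of the theorem is then transport of structure: D_∇² = 0 follows from δ² = 0
without any further identity for the curvature, Ψ_∇ induces e_∇, and Ψ_∇' ∘ Ψ_∇⁻¹ is a chain
isomorphism from Ad_∇ to Ad_∇' compatible with e_∇ and e_∇'. Only the compatibility with Ω(A) is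
checked by hand: the derivation rule for D_∇ (`adOperator_leftMul`) and the linearity of Ψ_∇' ∘
Ψ_∇⁻¹ (`psi_symm_leftMul`).

The chain map property becomes transparent once tensoriality is given up. Let θ be the one-cochain α
↦ (X ↦ ∇_X α) with values in Hom(TM, A), which is only ℝ-linear in α; let s be the sign (-1)^degree,
and let d be the Koszul operator of the actions [α, ·] on Γ(A), [ρ(α), ·] on Γ(TM), and of φ ↦
∇^bas_α ∘ φ - φ ∘ [ρ(α), ·] on homomorphisms. Then Ψ_∇(c, σ) = (c - θ ∧ sσ, -σ) and δ(c, σ) = (dc,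
dσ - ρ(sc)), while d_{∇^bas} is f ↦ df + θ ∧ ρ(f) on A and g ↦ dg + ρ(θ ∧ g) on TM, and R^bas = -dθ
(`ofFun_splitting`, `dL_basA`, `dL_basT`, `dL_covDiff`). Thus D_∇ is (f, g) ↦ (df, dg + ρ(sf))
conjugated by the unipotent map (f, g) ↦ (f + θ ∧ sg, g), and the check takes a few lines.

For δ² = 0, the Jacobi identity of A gives d² = 0 on maps. On symbols one needs in addition that ρ
preserves brackets. This is no axiom; it is deduced from Jacobi, Leibniz and the existence of enough
global sections and functions (`LieAlgebroid.rho_bracket`).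

To avoid shuffles and index bookkeeping, cochains of all degrees are treated as functions on lists
of sections, zero on lists of the wrong length. Wedge product, Lie derivative and d are defined
recursively by their contraction formulas (Cartan calculus), so an identity is proved by evaluating
on the empty list and contracting with the head. `ofFun_koszul` and `ofFun_wedge` identify these
operators with the original ones. -/

noncomputable section

namespace AdjointRep

section

/-! ### Calculus of functions on lists -/

section ListCalculus

variable {L N N₁ N₂ N₃ N₄ N₅ : Type*} [AddCommGroup L] [Module ℝ L] [AddCommGroup N] [Module ℝ N]
  [AddCommGroup N₁] [Module ℝ N₁] [AddCommGroup N₂] [Module ℝ N₂] [AddCommGroup N₃] [Module ℝ N₃]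
  [AddCommGroup N₄] [Module ℝ N₄] [AddCommGroup N₅] [Module ℝ N₅]

/-- The interior product of a function on lists: `(ι_x f)(l) = f(x :: l)`. -/
def contr (x : L) : (List L → N) →ₗ[ℝ] List L → N where
  toFun f l := f (x :: l)
  map_add' _ _ := rfl
  map_smul' _ _ := rfl

@[simp] theorem contr_apply (x : L) (f : List L → N) (l : List L) : contr x f l = f (x :: l) := rfl

/-- The sign involution `(s f)(l) = (-1)^{|l|} f(l)`. -/
def sgnL : (List L → N) →ₗ[ℝ] List L → N where
  toFun f l := (-1 : ℝ) ^ l.length • f l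
  map_add' _ _ := by ext; simp
  map_smul' c f := by ext l; exact smul_comm _ c (f l)

theorem sgnL_apply (f : List L → N) (l : List L) : sgnL f l = (-1 : ℝ) ^ l.length • f l := rfl

@[simp] theorem sgnL_nil (f : List L → N) : sgnL f [] = f [] := by simp [sgnL_apply]

/-- Contraction uses up one entry, so the two lengths in question differ by one. -/
theorem contr_sgnL (x : L) (f : List L → N) : contr x (sgnL f) = - sgnL (contr x f) := by
  ext l; simp [sgnL_apply, pow_succ]

@[simp] theorem sgnL_sgnL (f : List L → N) : sgnL (sgnL f) = f := by
  ext l; simp [sgnL_apply, smul_smul, ← mul_pow]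

/-- Composition with a linear map of the values. -/
def mapL (g : N₁ →ₗ[ℝ] N₂) : (List L → N₁) →ₗ[ℝ] List L → N₂ where
  toFun f l := g (f l)
  map_add' _ _ := by ext; simp
  map_smul' _ _ := by ext; simp

@[simp] theorem mapL_apply (g : N₁ →ₗ[ℝ] N₂) (f : List L → N₁) (l : List L) :
    mapL g f l = g (f l) := rfl

theorem contr_mapL (g : N₁ →ₗ[ℝ] N₂) (x : L) (f : List L → N₁) :
    contr x (mapL g f) = mapL g (contr x f) := rfl

theorem sgnL_mapL (g : N₁ →ₗ[ℝ] N₂) (f : List L → N₁) :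
    sgnL (mapL g f) = mapL g (sgnL f) := by
  ext l; simp [sgnL_apply]

/-- The wedge product of functions on lists:
`ι_x (f ∧ g) = ι_x f ∧ g + s f ∧ ι_x g`. -/
def wedgeL (h : N₁ →ₗ[ℝ] N₂ →ₗ[ℝ] N₃) : (List L → N₁) → (List L → N₂) → List L → N₃
  | f, g, [] => h (f []) (g [])
  | f, g, x :: l => wedgeL h (contr x f) g l + wedgeL h (sgnL f) (contr x g) l
termination_by _ _ l => l

variable (h : N₁ →ₗ[ℝ] N₂ →ₗ[ℝ] N₃)

@[simp] theorem wedgeL_nil (f : List L → N₁) (g : List L → N₂) :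
    wedgeL h f g [] = h (f []) (g []) := by rw [wedgeL]

theorem wedgeL_cons (f : List L → N₁) (g : List L → N₂) (x : L) (l : List L) :
    wedgeL h f g (x :: l) = wedgeL h (contr x f) g l + wedgeL h (sgnL f) (contr x g) l := by
  rw [wedgeL]

theorem contr_wedgeL (f : List L → N₁) (g : List L → N₂) (x : L) :
    contr x (wedgeL h f g) = wedgeL h (contr x f) g + wedgeL h (sgnL f) (contr x g) := by
  ext l; exact wedgeL_cons h f g x l

theorem wedgeL_add_left (f f' : List L → N₁) (g : List L → N₂) :
    wedgeL h (f + f') g = wedgeL h f g + wedgeL h f' g := by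
  ext l
  induction l generalizing f f' g with
  | nil => simp
  | cons x l ih => simp only [wedgeL_cons, Pi.add_apply, map_add, ih]; abel

theorem wedgeL_smul_left (c : ℝ) (f : List L → N₁) (g : List L → N₂) :
    wedgeL h (c • f) g = c • wedgeL h f g := by
  ext l
  induction l generalizing f g with
  | nil => simp
  | cons x l ih => simp only [wedgeL_cons, Pi.smul_apply, map_smul, ih, smul_add]

theorem wedgeL_add_right (f : List L → N₁) (g g' : List L → N₂) :
    wedgeL h f (g + g') = wedgeL h f g + wedgeL h f g' := by
  ext l
  induction l generalizing f g g' with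
  | nil => simp
  | cons x l ih => simp only [wedgeL_cons, Pi.add_apply, map_add, ih]; abel

theorem wedgeL_smul_right (c : ℝ) (f : List L → N₁) (g : List L → N₂) :
    wedgeL h f (c • g) = c • wedgeL h f g := by
  ext l
  induction l generalizing f g with
  | nil => simp
  | cons x l ih => simp only [wedgeL_cons, Pi.smul_apply, map_smul, ih, smul_add]

theorem wedgeL_neg_left (f : List L → N₁) (g : List L → N₂) :
    wedgeL h (-f) g = - wedgeL h f g := by
  rw [← neg_one_smul ℝ, wedgeL_smul_left, neg_one_smul]

theorem wedgeL_neg_right (f : List L → N₁) (g : List L → N₂) :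
    wedgeL h f (-g) = - wedgeL h f g := by
  rw [← neg_one_smul ℝ, wedgeL_smul_right, neg_one_smul]

theorem wedgeL_sub_left (f f' : List L → N₁) (g : List L → N₂) :
    wedgeL h (f - f') g = wedgeL h f g - wedgeL h f' g := by
  rw [sub_eq_add_neg, wedgeL_add_left, wedgeL_neg_left, ← sub_eq_add_neg]

theorem wedgeL_sub_right (f : List L → N₁) (g g' : List L → N₂) :
    wedgeL h f (g - g') = wedgeL h f g - wedgeL h f g' := by
  rw [sub_eq_add_neg, wedgeL_add_right, wedgeL_neg_right, ← sub_eq_add_neg]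

@[simp] theorem wedgeL_zero_left (g : List L → N₂) : wedgeL h (0 : List L → N₁) g = 0 := by
  simpa using wedgeL_smul_left h 0 (0 : List L → N₁) g

@[simp] theorem wedgeL_zero_right (f : List L → N₁) : wedgeL h f (0 : List L → N₂) = 0 := by
  simpa using wedgeL_smul_right h 0 f (0 : List L → N₂)

theorem sgnL_wedgeL (f : List L → N₁) (g : List L → N₂) :
    sgnL (wedgeL h f g) = wedgeL h (sgnL f) (sgnL g) := by
  ext l
  induction l generalizing f g with
  | nil => simp
  | cons x l ih =>
    have e := congrFun (contr_sgnL x (wedgeL h f g)) l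
    simp only [contr_apply, Pi.neg_apply] at e
    rw [e, wedgeL_cons, contr_wedgeL, map_add, contr_sgnL, contr_sgnL, wedgeL_neg_left,
      wedgeL_neg_right]
    simp only [Pi.add_apply, Pi.neg_apply, ih]
    abel

/-- The wedge product with coefficients transported along linear maps of the values. -/
theorem mapL_wedgeL {N₁' N₂' N₃' : Type*} [AddCommGroup N₁'] [Module ℝ N₁'] [AddCommGroup N₂']
    [Module ℝ N₂'] [AddCommGroup N₃'] [Module ℝ N₃'] (h' : N₁' →ₗ[ℝ] N₂' →ₗ[ℝ] N₃')
    (a : N₁ →ₗ[ℝ] N₁') (b : N₂ →ₗ[ℝ] N₂') (c : N₃ →ₗ[ℝ] N₃')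
    (hc : ∀ m n, c (h m n) = h' (a m) (b n)) (f : List L → N₁) (g : List L → N₂) :
    mapL c (wedgeL h f g) = wedgeL h' (mapL a f) (mapL b g) := by
  ext l
  induction l generalizing f g with
  | nil => simp [hc]
  | cons x l ih =>
    simp only [mapL_apply] at ih
    simp only [mapL_apply, wedgeL_cons, map_add, contr_mapL, sgnL_mapL, ih]

/-- Graded commutation of two left multiplications. -/
theorem wedgeL_left_comm {h₂ : N₂ →ₗ[ℝ] N₃ →ₗ[ℝ] N₃} {h₁ : N₁ →ₗ[ℝ] N₃ →ₗ[ℝ] N₄}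
    {h₃ : N₂ →ₗ[ℝ] N₄ →ₗ[ℝ] N₄} (hc : ∀ a b c, h₁ a (h₂ b c) = h₃ b (h₁ a c)) (r : ℕ)
    (S : List L → N₁) (hS : sgnL S = (-1 : ℝ) ^ r • S) (f : List L → N₂) (g : List L → N₃) :
    wedgeL h₁ S (wedgeL h₂ f g) = wedgeL h₃ (sgnL^[r] f) (wedgeL h₁ S g) := by
  have hcs : ∀ (r : ℕ) (x : L) (f : List L → N₂),
      contr x (sgnL^[r] f) = (-1 : ℝ) ^ r • sgnL^[r] (contr x f) := by
    intro r x f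
    induction r generalizing f with
    | zero => simp
    | succ r ih =>
      simp only [Function.iterate_succ, Function.comp, ih, contr_sgnL]
      have : ∀ u : List L → N₂, sgnL^[r] (-u) = - sgnL^[r] u := by
        intro u
        exact (Function.Semiconj.iterate_right (f := fun u : List L → N₂ ↦ -u)
          (fun v ↦ (map_neg sgnL v).symm) r u).symm
      rw [this, smul_neg, pow_succ, mul_neg_one, neg_smul]
  have hz : ∀ (r : ℕ) (f : List L → N₂), (sgnL^[r] f) [] = f [] := by
    intro r f
    induction r generalizing f with
    | zero => rfl
    | succ r ih => simp [Function.iterate_succ, ih]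
  ext l
  -- `S` is known only through its parity `r`. Contraction with the head changes the parity, hence
  -- both `r` and `S` vary in the induction.
  induction l generalizing r S f g with
  | nil => simp [hc, hz]
  | cons x l ih =>
    have hS' : sgnL (contr x S) = (-1 : ℝ) ^ (r + 1) • contr x S := by
      rw [← neg_eq_iff_eq_neg.mpr (contr_sgnL x S), hS, map_smul, pow_succ, mul_neg_one, neg_smul]
    rw [wedgeL_cons, wedgeL_cons, contr_wedgeL, contr_wedgeL, hS, hcs]
    simp only [wedgeL_add_right, wedgeL_smul_left, wedgeL_smul_right, Pi.add_apply, Pi.smul_apply,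
      ih _ _ hS', ih _ _ hS, Function.iterate_succ, Function.comp]
    have e : sgnL (sgnL^[r] f) = sgnL^[r] (sgnL f) :=
      (Function.Commute.self_iterate sgnL r) f
    rw [e]
    abel

/-! ### Cartan calculus: Lie derivative and Koszul operator. -/

variable (br : L →ₗ[ℝ] L →ₗ[ℝ] L)

/-- The Lie derivative of functions on lists:
`(𝓛_x f)(l) = D_x (f(l)) - ∑_j f(l₀, …, [x, l_j], …)`. -/
def lieL (D : L →ₗ[ℝ] N →ₗ[ℝ] N) (x : L) : (List L → N) → List L → N
  | f, [] => D x (f [])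
  | f, y :: l => lieL D x (contr y f) l - f (br x y :: l)
termination_by _ l => l

/-- The Koszul operator on functions on lists: `ι_x d = 𝓛_x - d ι_x`. -/
def dL (D : L →ₗ[ℝ] N →ₗ[ℝ] N) : (List L → N) → List L → N
  | _, [] => 0
  | f, x :: l => lieL br D x f l - dL D (contr x f) l
termination_by _ l => l

variable (D : L →ₗ[ℝ] N →ₗ[ℝ] N)

@[simp] theorem lieL_nil (x : L) (f : List L → N) : lieL br D x f [] = D x (f []) := by rw [lieL]

theorem lieL_cons (x y : L) (f : List L → N) (l : List L) :
    lieL br D x f (y :: l) = lieL br D x (contr y f) l - f (br x y :: l) := by rw [lieL]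

@[simp] theorem dL_nil (f : List L → N) : dL br D f [] = 0 := by rw [dL]

theorem dL_cons (x : L) (f : List L → N) (l : List L) :
    dL br D f (x :: l) = lieL br D x f l - dL br D (contr x f) l := by rw [dL]

/-- The Cartan relation [𝓛_x, ι_y] = ι_{[x, y]}, as an identity of functions, so that it can be used
below other operators. -/
theorem contr_lieL (x y : L) (f : List L → N) :
    contr y (lieL br D x f) = lieL br D x (contr y f) - contr (br x y) f := by
  ext l; exact lieL_cons br D x y f l

theorem contr_dL (x : L) (f : List L → N) :
    contr x (dL br D f) = lieL br D x f - dL br D (contr x f) := by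
  ext l; exact dL_cons br D x f l

theorem lieL_add (x : L) (f g : List L → N) :
    lieL br D x (f + g) = lieL br D x f + lieL br D x g := by
  ext l
  induction l generalizing f g with
  | nil => simp
  | cons y l ih => simp only [lieL_cons, Pi.add_apply, map_add, ih]; abel

theorem lieL_smul (x : L) (c : ℝ) (f : List L → N) :
    lieL br D x (c • f) = c • lieL br D x f := by
  ext l
  induction l generalizing f with
  | nil => simp
  | cons y l ih => simp only [lieL_cons, Pi.smul_apply, map_smul, ih, smul_sub]

theorem dL_add (f g : List L → N) : dL br D (f + g) = dL br D f + dL br D g := by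
  ext l
  induction l generalizing f g with
  | nil => simp
  | cons y l ih => simp only [dL_cons, Pi.add_apply, map_add, lieL_add, ih]; abel

theorem dL_smul (c : ℝ) (f : List L → N) : dL br D (c • f) = c • dL br D f := by
  ext l
  induction l generalizing f with
  | nil => simp
  | cons y l ih => simp only [dL_cons, Pi.smul_apply, map_smul, lieL_smul, ih, smul_sub]

theorem lieL_neg (x : L) (f : List L → N) : lieL br D x (-f) = - lieL br D x f := by
  rw [← neg_one_smul ℝ, lieL_smul, neg_one_smul]

theorem dL_neg (f : List L → N) : dL br D (-f) = - dL br D f := by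
  rw [← neg_one_smul ℝ, dL_smul, neg_one_smul]

theorem lieL_sub (x : L) (f g : List L → N) :
    lieL br D x (f - g) = lieL br D x f - lieL br D x g := by
  rw [sub_eq_add_neg, lieL_add, lieL_neg, ← sub_eq_add_neg]

theorem dL_sub (f g : List L → N) : dL br D (f - g) = dL br D f - dL br D g := by
  rw [sub_eq_add_neg, dL_add, dL_neg, ← sub_eq_add_neg]

@[simp] theorem lieL_zero (x : L) : lieL br D x (0 : List L → N) = 0 := by
  simpa using lieL_smul br D x 0 (0 : List L → N)

@[simp] theorem dL_zero : dL br D (0 : List L → N) = 0 := by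
  simpa using dL_smul br D 0 (0 : List L → N)

/-- The Lie derivative preserves the length of lists, so it commutes with the sign; the Koszul
operator shifts it by one and anticommutes (`dL_sgnL`). -/
theorem lieL_sgnL (x : L) (f : List L → N) :
    lieL br D x (sgnL f) = sgnL (lieL br D x f) := by
  ext l
  induction l generalizing f with
  | nil => simp
  | cons y l ih =>
    have e := congrFun (contr_sgnL y (lieL br D x f)) l
    simp only [contr_apply, Pi.neg_apply] at e
    have e' := congrFun (contr_sgnL (br x y) f) l
    simp only [contr_apply, Pi.neg_apply] at e'
    rw [e, lieL_cons, contr_sgnL, contr_lieL, map_sub, lieL_neg, e']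
    simp only [Pi.neg_apply, Pi.sub_apply, ih]
    abel

theorem dL_sgnL (f : List L → N) : dL br D (sgnL f) = - sgnL (dL br D f) := by
  ext l
  induction l generalizing f with
  | nil => simp
  | cons y l ih =>
    have e := congrFun (contr_sgnL y (dL br D f)) l
    simp only [contr_apply, Pi.neg_apply] at e
    rw [Pi.neg_apply, e, dL_cons, contr_sgnL, contr_dL, map_sub, dL_neg, lieL_sgnL]
    simp only [Pi.neg_apply, Pi.sub_apply, ih]
    abel

theorem mapL_lieL (D₁ : L →ₗ[ℝ] N₁ →ₗ[ℝ] N₁) (D₂ : L →ₗ[ℝ] N₂ →ₗ[ℝ] N₂) (g : N₁ →ₗ[ℝ] N₂)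
    (hg : ∀ x n, g (D₁ x n) = D₂ x (g n)) (x : L) (f : List L → N₁) :
    mapL g (lieL br D₁ x f) = lieL br D₂ x (mapL g f) := by
  ext l
  induction l generalizing f with
  | nil => simp [hg]
  | cons y l ih =>
    simp only [mapL_apply] at ih
    simp only [mapL_apply, lieL_cons, map_sub, contr_mapL, ih]

/-- A linear map of the values which intertwines two connections commutes with the Koszul
operators. -/
theorem mapL_dL (D₁ : L →ₗ[ℝ] N₁ →ₗ[ℝ] N₁) (D₂ : L →ₗ[ℝ] N₂ →ₗ[ℝ] N₂) (g : N₁ →ₗ[ℝ] N₂)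
    (hg : ∀ x n, g (D₁ x n) = D₂ x (g n)) (f : List L → N₁) :
    mapL g (dL br D₁ f) = dL br D₂ (mapL g f) := by
  ext l
  induction l generalizing f with
  | nil => simp
  | cons y l ih =>
    simp only [mapL_apply] at ih
    have e := congrFun (mapL_lieL br D₁ D₂ g hg y f) l
    simp only [mapL_apply] at e
    simp only [mapL_apply, dL_cons, map_sub, contr_mapL, ih, e]

section Leibniz

variable {D₁ : L →ₗ[ℝ] N₁ →ₗ[ℝ] N₁} {D₂ : L →ₗ[ℝ] N₂ →ₗ[ℝ] N₂} {D₃ : L →ₗ[ℝ] N₃ →ₗ[ℝ] N₃}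

/-- Contracting with `y`, the relation [𝓛_x, ι_y] = ι_{[x, y]} reduces the claim to a shorter list.
On the empty list it is the compatibility of the connections with the pairing. -/
theorem lieL_wedgeL (hD : ∀ x m n, D₃ x (h m n) = h (D₁ x m) n + h m (D₂ x n)) (x : L)
    (f : List L → N₁) (g : List L → N₂) :
    lieL br D₃ x (wedgeL h f g) = wedgeL h (lieL br D₁ x f) g + wedgeL h f (lieL br D₂ x g) := by
  ext l
  induction l generalizing f g with
  | nil => simp [hD]
  | cons y l ih =>
    simp only [lieL_cons, Pi.add_apply, wedgeL_cons, contr_wedgeL, lieL_add, contr_lieL,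
      ih, wedgeL_sub_left, wedgeL_sub_right, Pi.sub_apply, lieL_sgnL]
    abel

/-- The Leibniz rule `d(f ∧ g) = df ∧ g + s f ∧ dg`. -/
theorem dL_wedgeL (hD : ∀ x m n, D₃ x (h m n) = h (D₁ x m) n + h m (D₂ x n))
    (f : List L → N₁) (g : List L → N₂) :
    dL br D₃ (wedgeL h f g) = wedgeL h (dL br D₁ f) g + wedgeL h (sgnL f) (dL br D₂ g) := by
  ext l
  induction l generalizing f g with
  | nil => simp
  | cons y l ih =>
    -- By ι_y d = 𝓛_y - d ι_y the claim follows from the Leibniz rule of 𝓛_y and the induction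
    -- hypothesis. The mixed terms df ∧ ι_y g cancel because ds = -sd.
    simp only [dL_cons, Pi.add_apply, wedgeL_cons, contr_wedgeL, dL_add, contr_dL,
      ih, wedgeL_sub_left, wedgeL_sub_right, Pi.sub_apply, lieL_wedgeL h br hD, dL_sgnL, contr_sgnL,
      wedgeL_neg_left, Pi.neg_apply, sgnL_sgnL]
    abel

end Leibniz

/-- The function on lists which is `a` on the lists of length one and vanishes on all others. -/
def degOne (a : L →ₗ[ℝ] N) : List L → N
  | [x] => a x
  | _ => 0

theorem sgnL_degOne (a : L →ₗ[ℝ] N) : sgnL (degOne a) = - degOne a := by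
  ext l
  rcases l with _ | ⟨x, _ | ⟨y, l⟩⟩ <;> simp [degOne, sgnL_apply]

/-- The function on lists concentrated in length zero. -/
def degZero (n : N) : List L → N
  | [] => n
  | _ => 0

theorem contr_degOne (a : L →ₗ[ℝ] N) (x : L) : contr x (degOne a) = degZero (a x) := by
  ext l
  rcases l with _ | ⟨y, l⟩ <;> simp [degOne, degZero]

theorem contr_degZero (n : N) (x : L) : contr x (degZero n) = 0 := rfl

theorem sgnL_degZero (n : N) : sgnL (degZero n : List L → N) = degZero n := by
  ext l
  rcases l with _ | ⟨y, l⟩ <;> simp [degZero, sgnL_apply]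

theorem wedgeL_degZero (m : N₁) (g : List L → N₂) : wedgeL h (degZero m) g = mapL (h m) g := by
  ext l
  induction l generalizing g with
  | nil => rw [wedgeL_nil]; rfl
  | cons x l ih =>
    rw [wedgeL_cons, contr_degZero, wedgeL_zero_left, sgnL_degZero, ih]; simp

/-- If two connections differ by `n ↦ h (a x) n`, then their Koszul operators differ by the wedge
product with `a`. -/
theorem dL_eq_add_wedgeL {h : N₁ →ₗ[ℝ] N →ₗ[ℝ] N} {D D' : L →ₗ[ℝ] N →ₗ[ℝ] N} (a : L →ₗ[ℝ] N₁)
    (hD : ∀ x n, D' x n = D x n + h (a x) n) (f : List L → N) :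
    dL br D' f = dL br D f + wedgeL h (degOne a) f := by
  -- Only the value on the empty list involves the connection. The correction h(a x) f equals ι_x(a
  -- ∧ f) + a ∧ ι_x f, which is what Cartan's formula requires for d' - d = a ∧ ·.
  have hl : ∀ x (f : List L → N), lieL br D' x f = lieL br D x f + mapL (h (a x)) f := by
    intro x f
    ext l
    induction l generalizing f with
    | nil => simp [hD]
    | cons y l ih => simp only [lieL_cons, ih, Pi.add_apply, mapL_apply, contr_apply]; abel
  ext l
  induction l generalizing f with
  | nil => simp [degOne]
  | cons x l ih =>
    simp only [dL_cons, hl, ih, Pi.add_apply, wedgeL_cons, contr_degOne, wedgeL_degZero,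
      sgnL_degOne, wedgeL_neg_left, Pi.neg_apply]
    abel

/-! ### The square of the Koszul operator of a flat connection. -/

section Flat

/-- A function on lists is subtractive in every entry. -/
def IsSubtractive (f : List L → N) : Prop :=
  ∀ l₁ u v l₂, f (l₁ ++ (u - v) :: l₂) = f (l₁ ++ u :: l₂) - f (l₁ ++ v :: l₂)

theorem IsSubtractive.contr {f : List L → N} (hf : IsSubtractive f) (x : L) :
    IsSubtractive (contr x f) := fun l₁ u v l₂ ↦ hf (x :: l₁) u v l₂

variable (hj : ∀ x y z, br x (br y z) = br (br x y) z + br y (br x z))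
  (hflat : ∀ x y n, D (br x y) n = D x (D y n) - D y (D x n))

include hj hflat

/-- Flatness gives the claim on the empty list; each further entry contributes a Jacobi identity. -/
theorem lieL_br (x y : L) {f : List L → N} (hf : IsSubtractive f) :
    lieL br D (br x y) f = lieL br D x (lieL br D y f) - lieL br D y (lieL br D x f) := by
  ext l
  induction l generalizing f with
  | nil => simp [hflat]
  | cons z l ih =>
    have e : br (br x y) z = br x (br y z) - br y (br x z) := by rw [hj]; abel
    -- Here additivity in the entries matters: Jacobi turns the entry [[x, y], z] into a difference,
    -- which `f` has to respect.
    have e2 := hf [] (br x (br y z)) (br y (br x z)) l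
    simp only [List.nil_append] at e2
    simp only [Pi.sub_apply, lieL_cons, contr_lieL, lieL_sub, ih (hf.contr _), e, e2]
    abel

/-- Contracting the commutator of 𝓛_x and d with `y` leaves 𝓛_x 𝓛_y - 𝓛_y 𝓛_x - 𝓛_{[x, y]}, which is
zero by `lieL_br`, and a commutator on a shorter list. -/
theorem lieL_dL (x : L) {f : List L → N} (hf : IsSubtractive f) :
    lieL br D x (dL br D f) = dL br D (lieL br D x f) := by
  ext l
  induction l generalizing f with
  | nil => simp
  | cons y l ih =>
    simp only [lieL_cons, dL_cons, contr_dL, contr_lieL, lieL_sub, dL_sub, Pi.sub_apply,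
      ih (hf.contr y), lieL_br br D hj hflat x y hf]
    abel

/-- The Koszul operator of a flat connection has square zero. -/
theorem dL_dL {f : List L → N} (hf : IsSubtractive f) : dL br D (dL br D f) = 0 := by
  ext l
  induction l generalizing f with
  | nil => simp
  | cons x l ih =>
    -- Cartan's formula gives ι_x d² = (𝓛_x d - d 𝓛_x) + d² ι_x; the bracket vanishes by `lieL_dL`.
    simp only [dL_cons, contr_dL, dL_sub, Pi.sub_apply, ih (hf.contr x),
      lieL_dL br D hj hflat x hf]
    simp

end Flat

end ListCalculus

end

section

/-! ### Alternating maps as functions on lists -/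

section OfFun

variable {L N N' : Type*} [AddCommGroup L] [Module ℝ L] [AddCommGroup N] [Module ℝ N]
  [AddCommGroup N'] [Module ℝ N']

/-- A function of `k` variables, regarded as a function on lists which vanishes on the lists of
length different from `k`. -/
def ofFun {k : ℕ} (g : (Fin k → L) → N) : List L → N := fun l ↦
  if h : l.length = k then g (fun i ↦ l.get (i.cast h.symm)) else 0

theorem ofFun_apply_ofFn {k : ℕ} (g : (Fin k → L) → N) (v : Fin k → L) :
    ofFun g (List.ofFn v) = g v := by
  rw [ofFun, dif_pos (List.length_ofFn)]
  congr 1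
  funext i
  simp

theorem ofFun_of_length_ne {k : ℕ} (g : (Fin k → L) → N) {l : List L} (h : l.length ≠ k) :
    ofFun g l = 0 := dif_neg h

@[simp] theorem ofFun_zero_nil (g : (Fin 0 → L) → N) : ofFun g [] = g ![] := by
  simpa using ofFun_apply_ofFn g ![]

@[simp] theorem ofFun_succ_nil {k : ℕ} (g : (Fin (k + 1) → L) → N) : ofFun g [] = 0 :=
  ofFun_of_length_ne g (by simp)

theorem contr_ofFun_zero (g : (Fin 0 → L) → N) (x : L) : contr x (ofFun g) = 0 := by
  ext l
  exact ofFun_of_length_ne g (l := x :: l) (by simp)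

theorem contr_ofFun_succ {k : ℕ} (g : (Fin (k + 1) → L) → N) (x : L) :
    contr x (ofFun g) = ofFun fun w ↦ g (Matrix.vecCons x w) := by
  ext l
  rw [contr_apply]
  by_cases h : l.length = k
  · rw [ofFun, ofFun, dif_pos h, dif_pos (by simp [h])]
    congr 1
    funext i
    refine Fin.cases ?_ (fun i ↦ ?_) i <;> simp
  · rw [ofFun_of_length_ne _ h, ofFun_of_length_ne _ (by simpa using h)]

theorem ofFun_succ_cons {k : ℕ} (g : (Fin (k + 1) → L) → N) (x : L) (l : List L) :
    ofFun g (x :: l) = ofFun (fun w ↦ g (Matrix.vecCons x w)) l :=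
  congrFun (contr_ofFun_succ g x) l

theorem sgnL_ofFun {k : ℕ} (g : (Fin k → L) → N) :
    sgnL (ofFun g) = (-1 : ℝ) ^ k • ofFun g := by
  ext l
  by_cases h : l.length = k
  · rw [sgnL_apply, h]; rfl
  · rw [sgnL_apply, Pi.smul_apply, ofFun_of_length_ne g h, smul_zero, smul_zero]

theorem mapL_ofFun (a : N →ₗ[ℝ] N') {k : ℕ} (g : (Fin k → L) → N) :
    mapL a (ofFun g) = ofFun fun v ↦ a (g v) := by
  ext l
  by_cases h : l.length = k
  · rw [mapL_apply, ofFun, ofFun, dif_pos h, dif_pos h]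
  · rw [mapL_apply, ofFun_of_length_ne _ h, ofFun_of_length_ne _ h, map_zero]

theorem ofFun_add {k : ℕ} (g g' : (Fin k → L) → N) : ofFun (g + g') = ofFun g + ofFun g' := by
  ext l
  simp only [ofFun, Pi.add_apply]
  split_ifs <;> simp

theorem ofFun_smul {k : ℕ} (c : ℝ) (g : (Fin k → L) → N) : ofFun (c • g) = c • ofFun g := by
  ext l
  simp only [ofFun, Pi.smul_apply]
  split_ifs <;> simp

theorem ofFun_sub {k : ℕ} (g g' : (Fin k → L) → N) : ofFun (g - g') = ofFun g - ofFun g' := by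
  rw [sub_eq_add_neg, ofFun_add, ← neg_one_smul ℝ g', ofFun_smul, neg_one_smul, ← sub_eq_add_neg]

/-- Supplies the additivity on which `dL_dL` depends. On lists of the wrong length all three terms
are zero. -/
theorem isSubtractive_ofFun {k : ℕ} (η : L [⋀^Fin k]→ₗ[ℝ] N) : IsSubtractive (ofFun η) := by
  intro l₁ a b l₂
  induction l₁ generalizing k with
  | nil =>
    simp only [List.nil_append, ← contr_apply]
    cases k with
    | zero => simp only [contr_ofFun_zero, Pi.zero_apply, sub_zero]
    | succ k =>
      have e : ∀ c, (fun w ↦ η (Matrix.vecCons c w)) = η.curryLeft c := fun _ ↦ rfl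
      simp only [contr_ofFun_succ, e, map_sub]
      exact congrFun (ofFun_sub (η.curryLeft a) (η.curryLeft b)) l₂
  | cons x l₁ ih =>
    simp only [List.cons_append, ← contr_apply x]
    cases k with
    | zero => simp only [contr_ofFun_zero, Pi.zero_apply, sub_zero]
    | succ k => simp only [contr_ofFun_succ]; exact ih (η.curryLeft x)

section Koszul

variable (br : L →ₗ[ℝ] L →ₗ[ℝ] L) (hbr : ∀ x, br x x = 0) (D : L →ₗ[ℝ] N →ₗ[ℝ] N)

theorem lieL_ofFun_zero (η : (Fin 0 → L) → N) (x : L) :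
    lieL br D x (ofFun η) = ofFun fun w ↦ D x (η w) := by
  ext l
  rcases l with _ | ⟨y, l⟩
  · simp
  · rw [lieL_cons, contr_ofFun_zero, lieL_zero, ofFun_of_length_ne _ (by simp),
      ofFun_of_length_ne _ (by simp), Pi.zero_apply, sub_zero]

/-- The recursion of `lieL` replaces an entry by its bracket in place, whereas this sum moves the
bracket to the front; the sign (-1)^j pays for the move. In the induction it arises one
transposition at a time, through `map_cons_cons`. -/
theorem lieL_ofFun_succ {k : ℕ} (η : L [⋀^Fin (k + 1)]→ₗ[ℝ] N) (x : L) :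
    lieL br D x (ofFun η) = ofFun fun w ↦ D x (η w) -
      ∑ j : Fin (k + 1), (-1) ^ (j : ℕ) • η (Matrix.vecCons (br x (w j)) (j.removeNth w)) := by
  induction k with
  | zero =>
    ext l
    rcases l with _ | ⟨y, l⟩
    · simp
    · have e : (fun w : Fin 0 → L ↦ (D x (η (Matrix.vecCons y w)) -
          ∑ j : Fin 1, (-1) ^ (j : ℕ) • η (Matrix.vecCons (br x (Matrix.vecCons y w j))
            (j.removeNth (Matrix.vecCons y w))))) =
          (fun w ↦ D x (η (Matrix.vecCons y w))) - fun w ↦ η (Matrix.vecCons (br x y) w) := by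
        funext w
        simp only [Fin.sum_univ_one, Pi.sub_apply]
        simp [Subsingleton.elim _ w]
      rw [lieL_cons, contr_ofFun_succ, lieL_ofFun_zero, ofFun_succ_cons, ofFun_succ_cons, e,
        ofFun_sub, Pi.sub_apply]
  | succ k ih =>
    ext l
    rcases l with _ | ⟨y, l⟩
    · simp
    · have e : (fun w : Fin (k + 1) → L ↦ (D x (η (Matrix.vecCons y w)) -
          ∑ j : Fin (k + 2), (-1) ^ (j : ℕ) • η (Matrix.vecCons (br x (Matrix.vecCons y w j))
            (j.removeNth (Matrix.vecCons y w))))) =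
          (fun w ↦ D x (η.curryLeft y w) - ∑ j : Fin (k + 1),
            (-1) ^ (j : ℕ) • η.curryLeft y (Matrix.vecCons (br x (w j)) (j.removeNth w))) -
          fun w ↦ η (Matrix.vecCons (br x y) w) := by
        funext w
        have e0 : (0 : Fin (k + 2)).removeNth (Matrix.vecCons y w) = w := rfl
        simp only [Pi.sub_apply, Fin.sum_univ_succ (n := k + 1), removeNth_succ_cons,
          AlternatingMap.curryLeft_apply_apply, e0, Matrix.cons_val_succ, Matrix.cons_val_zero,
          Fin.val_zero, pow_zero, one_smul, Fin.val_succ, pow_succ, mul_neg, mul_one, neg_smul,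
          map_cons_cons η y, smul_neg, Finset.sum_neg_distrib]
        abel
      rw [lieL_cons, contr_ofFun_succ, ofFun_succ_cons, ofFun_succ_cons, e, ofFun_sub,
        Pi.sub_apply, ← ih]
      rfl

/-- Both sides obey the same recursion in the first argument: `koszul_cons` on the left, the
definition of `dL` on the right. -/
theorem ofFun_koszul {k : ℕ} (η : L [⋀^Fin k]→ₗ[ℝ] N) :
    ofFun (koszul br hbr D η) = dL br D (ofFun η) := by
  ext l
  induction l generalizing k with
  | nil => simp
  | cons x l ih =>
    rw [ofFun_succ_cons, dL_cons]
    cases k with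
    | zero =>
      simp only [koszul_zero_cons, contr_ofFun_zero, dL_zero, lieL_ofFun_zero, Pi.zero_apply,
        sub_zero]
    | succ k =>
      have e : (fun w ↦ koszul br hbr D η (Matrix.vecCons x w)) = (fun w ↦ D x (η w) -
          ∑ j : Fin (k + 1), (-1) ^ (j : ℕ) • η (Matrix.vecCons (br x (w j)) (j.removeNth w))) -
          fun w ↦ koszul br hbr D (η.curryLeft x) w := by
        funext w; exact koszul_cons br hbr D η x w
      rw [e, ofFun_sub, Pi.sub_apply, ← lieL_ofFun_succ, ih, contr_ofFun_succ]
      rfl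

end Koszul

end OfFun

/-! ### The shuffle product and sums over all permutations. -/

section Wedge

variable {R L N₁ N₂ N₃ : Type*} [CommRing R] [Algebra ℝ R] [AddCommGroup L] [Module ℝ L]
  [Module R L] [IsScalarTower ℝ R L] [AddCommGroup N₁] [Module ℝ N₁] [Module R N₁]
  [IsScalarTower ℝ R N₁] [AddCommGroup N₂] [Module ℝ N₂] [Module R N₂] [IsScalarTower ℝ R N₂]
  [AddCommGroup N₃] [Module ℝ N₃] [Module R N₃] [IsScalarTower ℝ R N₃]

/-- The alternating sum of a function over all permutations of its arguments. -/
def permSum {n : ℕ} (G : (Fin n → L) → N₃) (v : Fin n → L) : N₃ :=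
  ∑ σ : Equiv.Perm (Fin n), Equiv.Perm.sign σ • G (v ∘ σ)

theorem permSum_smul {n : ℕ} (c : ℝ) (G : (Fin n → L) → N₃) (v : Fin n → L) :
    permSum (c • G) v = c • permSum G v := by
  simp only [permSum, Finset.smul_sum, Pi.smul_apply, smul_comm _ c]

/-- The permutations of `Fin (n + 1)`, sorted by the preimage of `0`. -/
theorem permSum_cons {n : ℕ} (G : (Fin (n + 1) → L) → N₃) (x : L) (w : Fin n → L) :
    permSum G (Matrix.vecCons x w) = ∑ i : Fin (n + 1),
      (-1 : ℝ) ^ (i : ℕ) • permSum (fun u ↦ G (i.insertNth x u)) w := by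
  -- Every permutation of `Fin (n + 1)` is, in exactly one way, a permutation fixing 0 composed with
  -- the cycle moving some `i` to 0, of sign (-1)^i. Injectivity holds because `i` is recovered as
  -- the preimage of 0; bijectivity then follows from (n + 1)! = (n + 1) · n!.
  have hinj : Function.Injective fun z : Fin (n + 1) × Equiv.Perm (Fin n) ↦
      Equiv.Perm.decomposeFin.symm (0, z.2) * z.1.cycleRange := by
    rintro ⟨i, σ⟩ ⟨j, τ⟩ h
    have h0 : ∀ (k : Fin (n + 1)) (ρ : Equiv.Perm (Fin n)),
        (Equiv.Perm.decomposeFin.symm (0, ρ) * k.cycleRange) k = 0 := by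
      intro k ρ
      rw [Equiv.Perm.mul_apply, Fin.cycleRange_self, Equiv.Perm.decomposeFin_symm_apply_zero]
    have hij : i = j := by
      have h1 := h0 i σ
      simp only at h
      rw [h] at h1
      exact Equiv.injective _ (h1.trans (h0 j τ).symm)
    subst hij
    simpa using h
  have hbij := (Fintype.bijective_iff_injective_and_card _).2 ⟨hinj, by
    rw [Fintype.card_prod, Fintype.card_perm, Fintype.card_perm, Fintype.card_fin,
      Fintype.card_fin, Nat.factorial_succ]⟩
  rw [permSum, ← hbij.sum_comp, Fintype.sum_prod_type]
  refine Finset.sum_congr rfl fun i _ ↦ ?_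
  rw [permSum, Finset.smul_sum]
  refine Finset.sum_congr rfl fun σ _ ↦ ?_
  have e : Matrix.vecCons x w ∘ ⇑(Equiv.Perm.decomposeFin.symm (0, σ) * i.cycleRange) =
      i.insertNth x (w ∘ σ) := by
    rw [← Fin.cons_comp_cycleRange, Equiv.Perm.coe_mul, ← Function.comp_assoc]
    congr 1
    funext j
    refine Fin.cases ?_ (fun j ↦ ?_) j
    · simp
    · simp [Equiv.Perm.decomposeFin_symm_apply_succ]
  rw [e, Equiv.Perm.sign_mul, Equiv.Perm.decomposeFin.symm_sign, Fin.sign_cycleRange]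
  simp only [if_true, one_mul]
  rw [mul_comm, mul_smul]
  rcases Nat.even_or_odd (i : ℕ) with h | h <;> simp [h.neg_one_pow]

/-- The pairing of the first `p` variables with the last `q` variables. -/
def pairFun (h : N₁ →ₗ[ℝ] N₂ →ₗ[ℝ] N₃) {p q n : ℕ} (hn : p + q = n) (f : (Fin p → L) → N₁)
    (g : (Fin q → L) → N₂) (u : Fin n → L) : N₃ :=
  h (f fun a ↦ u ⟨a, by omega⟩) (g fun b ↦ u ⟨p + b, by omega⟩)

variable (h : N₁ →ₗ[ℝ] N₂ →ₗ[ℝ] N₃)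

/-- The new argument falls into the first block, at slot `i`; moving it to the front of `η` costs
(-1)^i. -/
theorem pairFun_insertNth_left {p q n : ℕ} (hn : p + 1 + q = n + 1) (η : L [⋀^Fin (p + 1)]→ₗ[ℝ] N₁)
    (g : (Fin q → L) → N₂) (i : Fin (n + 1)) (hi : i < p + 1) (x : L) (u : Fin n → L) :
    pairFun h hn η g (i.insertNth x u) =
      (-1 : ℝ) ^ (i : ℕ) • pairFun h (by omega : p + q = n) (η.curryLeft x) g u := by
  have e1 : (fun a : Fin (p + 1) ↦ (i.insertNth x u : Fin (n + 1) → L) ⟨a, by omega⟩) =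
      (⟨i, hi⟩ : Fin (p + 1)).insertNth x (fun a : Fin p ↦ u ⟨a, by omega⟩) := by
    rw [Fin.eq_insertNth_iff]
    constructor
    · exact Fin.insertNth_apply_same (α := fun _ ↦ L) i x u
    · funext a
      simp only [Fin.removeNth]
      have : (⟨((⟨i, hi⟩ : Fin (p + 1)).succAbove a : ℕ), by omega⟩ : Fin (n + 1)) =
          i.succAbove ⟨a, by omega⟩ := by
        ext; simp only [Fin.succAbove, Fin.lt_def, Fin.val_castSucc]; split_ifs <;> simp
      rw [this, Fin.insertNth_apply_succAbove]
  have e2 : (fun b : Fin q ↦ (i.insertNth x u : Fin (n + 1) → L) ⟨p + 1 + b, by omega⟩) =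
      fun b : Fin q ↦ u ⟨p + b, by omega⟩ := by
    funext b
    have : (⟨p + 1 + b, by omega⟩ : Fin (n + 1)) = i.succAbove ⟨p + b, by omega⟩ := by
      ext; simp only [Fin.succAbove, Fin.lt_def, Fin.val_castSucc]; split_ifs <;> simp <;> omega
    rw [this, Fin.insertNth_apply_succAbove]
  rw [pairFun, e1, e2, AlternatingMap.map_insertNth]
  have : ∀ (k : ℕ) (a : N₁), ((-1) ^ k : ℤ) • a = ((-1) ^ k : ℝ) • a := by
    intro k a
    rcases Nat.even_or_odd k with h | h <;> simp [h.neg_one_pow]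
  simp only [this, map_smul, LinearMap.smul_apply]
  rfl

/-- The new argument falls into the second block, at slot `i - p`, so the sign is (-1)^(i - p) =
(-1)^(p + i). -/
theorem pairFun_insertNth_right {p q n : ℕ} (hn : p + (q + 1) = n + 1) (f : (Fin p → L) → N₁)
    (θ : L [⋀^Fin (q + 1)]→ₗ[ℝ] N₂) (i : Fin (n + 1)) (hi : p ≤ i) (x : L) (u : Fin n → L) :
    pairFun h hn f θ (i.insertNth x u) =
      (-1 : ℝ) ^ (p + i : ℕ) • pairFun h (by omega : p + q = n) f (θ.curryLeft x) u := by
  have e1 : (fun a : Fin p ↦ (i.insertNth x u : Fin (n + 1) → L) ⟨a, by omega⟩) =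
      fun a : Fin p ↦ u ⟨a, by omega⟩ := by
    funext a
    have : (⟨a, by omega⟩ : Fin (n + 1)) = i.succAbove ⟨a, by omega⟩ := by
      ext; simp only [Fin.succAbove, Fin.lt_def, Fin.val_castSucc]; split_ifs <;> simp; omega
    rw [this, Fin.insertNth_apply_succAbove]
  have e2 : (fun b : Fin (q + 1) ↦ (i.insertNth x u : Fin (n + 1) → L) ⟨p + b, by omega⟩) =
      (⟨i - p, by omega⟩ : Fin (q + 1)).insertNth x (fun b : Fin q ↦ u ⟨p + b, by omega⟩) := by
    rw [Fin.eq_insertNth_iff]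
    constructor
    · have : (⟨p + (i - p), by omega⟩ : Fin (n + 1)) = i := by ext; simp; omega
      simp only [this, Fin.insertNth_apply_same]
    · funext b
      simp only [Fin.removeNth]
      have : (⟨p + ((⟨i - p, by omega⟩ : Fin (q + 1)).succAbove b : ℕ), by omega⟩ : Fin (n + 1)) =
          i.succAbove ⟨p + b, by omega⟩ := by
        ext; simp only [Fin.succAbove, Fin.lt_def, Fin.val_castSucc]
        split_ifs <;> simp <;> omega
      rw [this, Fin.insertNth_apply_succAbove]
  rw [pairFun, e1, e2, AlternatingMap.map_insertNth]
  have : ∀ (k : ℕ) (a : N₂), ((-1) ^ k : ℤ) • a = ((-1) ^ k : ℝ) • a := by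
    intro k a
    rcases Nat.even_or_odd k with h | h <;> simp [h.neg_one_pow]
  have hs : (-1 : ℝ) ^ (p + i : ℕ) = (-1) ^ (i - p : ℕ) := by
    have : p + i = 2 * p + (i - p : ℕ) := by omega
    rw [this, pow_add, pow_mul]; simp
  simp only [this, map_smul, hs]
  rfl

/-- Sort the permutations by the slot that receives the first argument `x`. The `p` slots of the
first block contribute equally, in total the term with ι_x η; the `q` slots of the second block
contribute equally, in total the term with sη ∧ ι_x θ. This is the recursion defining `wedgeL`. -/
theorem permSum_pairFun {n : ℕ} {p q : ℕ} (hn : p + q = n) (η : L [⋀^Fin p]→ₗ[ℝ] N₁)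
    (θ : L [⋀^Fin q]→ₗ[ℝ] N₂) (v : Fin n → L) :
    permSum (pairFun h hn η θ) v =
      (p.factorial * q.factorial : ℝ) • wedgeL h (ofFun η) (ofFun θ) (List.ofFn v) := by
  induction n generalizing p q with
  | zero =>
    obtain rfl : p = 0 := by omega
    obtain rfl : q = 0 := by omega
    rw [List.ofFn_zero, wedgeL_nil, ofFun_zero_nil, ofFun_zero_nil, permSum,
      Fintype.sum_unique, Equiv.Perm.default_eq, Equiv.Perm.sign_one]
    simp [pairFun, Subsingleton.elim _ (![] : Fin 0 → L)]
  | succ n ih =>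
    obtain ⟨x, w, rfl⟩ : ∃ x w, v = Matrix.vecCons x w :=
      ⟨v 0, fun i ↦ v i.succ, (Matrix.cons_head_tail v).symm⟩
    have hl : List.ofFn (Matrix.vecCons x w) = x :: List.ofFn w := by
      rw [List.ofFn_succ]; rfl
    have hsq : ∀ k : ℕ, (-1 : ℝ) ^ k * (-1) ^ k = 1 := fun k ↦ by rw [← mul_pow]; simp
    -- The factor `p` completes the (p - 1)! of the induction hypothesis to p!. The sign (-1)^i of
    -- the slot cancels the one from `permSum_cons`.
    have hA : ∀ i : Fin (n + 1), (i : ℕ) < p → (p : ℝ) • ((-1 : ℝ) ^ (i : ℕ) •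
        permSum (fun u ↦ pairFun h hn η θ (i.insertNth x u)) w) =
        (p.factorial * q.factorial : ℝ) • wedgeL h (contr x (ofFun η)) (ofFun θ) (List.ofFn w) := by
      intro i hi
      obtain ⟨p, rfl⟩ : ∃ p', p = p' + 1 := ⟨p - 1, by omega⟩
      have e : (fun u ↦ pairFun h hn η θ (i.insertNth x u)) =
          (-1 : ℝ) ^ (i : ℕ) • pairFun h (by omega : p + q = n) (η.curryLeft x) θ := by
        funext u; exact pairFun_insertNth_left h hn η θ i hi x u
      rw [e, permSum_smul, smul_smul ((-1 : ℝ) ^ (i : ℕ)), hsq, one_smul, ih, smul_smul,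
        contr_ofFun_succ, Nat.factorial_succ, Nat.cast_mul, mul_assoc]
      rfl
    -- In the second block a factor (-1)^p survives the cancellation; it is the operator `sgnL` on
    -- η.
    have hB : ∀ i : Fin (n + 1), ¬ (i : ℕ) < p → (q : ℝ) • ((-1 : ℝ) ^ (i : ℕ) •
        permSum (fun u ↦ pairFun h hn η θ (i.insertNth x u)) w) =
        (p.factorial * q.factorial : ℝ) •
          wedgeL h (sgnL (ofFun η)) (contr x (ofFun θ)) (List.ofFn w) := by
      intro i hi
      obtain ⟨q, rfl⟩ : ∃ q', q = q' + 1 := ⟨q - 1, by omega⟩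
      have e : (fun u ↦ pairFun h hn η θ (i.insertNth x u)) =
          (-1 : ℝ) ^ (p + i : ℕ) • pairFun h (by omega : p + q = n) η (θ.curryLeft x) := by
        funext u; exact pairFun_insertNth_right h hn η θ i (by omega) x u
      have ec : (fun w ↦ θ (Matrix.vecCons x w)) = θ.curryLeft x := rfl
      rw [e, permSum_smul, ih, sgnL_ofFun, wedgeL_smul_left, contr_ofFun_succ, ec, Pi.smul_apply]
      simp only [smul_smul, Nat.factorial_succ, Nat.cast_mul, pow_add]
      congr 1
      linear_combination ((q + 1 : ℕ) * p.factorial * q.factorial * (-1) ^ p : ℝ) * hsq i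
    rw [permSum_cons, hl, wedgeL_cons, smul_add]
    set a := (p.factorial * q.factorial : ℝ) •
      wedgeL h (contr x (ofFun η)) (ofFun θ) (List.ofFn w)
    set b := (p.factorial * q.factorial : ℝ) •
      wedgeL h (sgnL (ofFun η)) (contr x (ofFun θ)) (List.ofFn w)
    have hi : ∀ i : Fin (n + 1), (-1 : ℝ) ^ (i : ℕ) •
        permSum (fun u ↦ pairFun h hn η θ (i.insertNth x u)) w =
        if (i : ℕ) < p then (p : ℝ)⁻¹ • a else (q : ℝ)⁻¹ • b := by
      intro i
      split_ifs with hip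
      · rw [← hA i hip, inv_smul_smul₀ (Nat.cast_ne_zero.2 (by omega))]
      · rw [← hB i hip, inv_smul_smul₀ (Nat.cast_ne_zero.2 (by omega))]
    have hcard : (Finset.univ.filter fun i : Fin (n + 1) ↦ (i : ℕ) < p).card = p := by
      rw [Fin.card_filter_val_lt]; omega
    have hcard' : (Finset.univ.filter fun i : Fin (n + 1) ↦ ¬ (i : ℕ) < p).card = q := by
      have := Finset.card_filter_add_card_filter_not (s := (Finset.univ : Finset (Fin (n + 1))))
        fun i : Fin (n + 1) ↦ (i : ℕ) < p
      rw [hcard, Finset.card_univ, Fintype.card_fin] at this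
      omega
    rw [Finset.sum_congr rfl fun i _ ↦ hi i, Finset.sum_ite, Finset.sum_const, Finset.sum_const,
      hcard, hcard', ← Nat.cast_smul_eq_nsmul ℝ, ← Nat.cast_smul_eq_nsmul ℝ]
    congr 1
    -- If p = 0 there is no slot to sum over, but then `a` is zero too, since a function of no
    -- variables has zero contraction. Likewise for `q` and `b`.
    · rcases Nat.eq_zero_or_pos p with rfl | hp
      · simp [a, contr_ofFun_zero]
      · exact smul_inv_smul₀ (Nat.cast_ne_zero.2 hp.ne') a
    · rcases Nat.eq_zero_or_pos q with rfl | hq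
      · simp [b, contr_ofFun_zero]
      · exact smul_inv_smul₀ (Nat.cast_ne_zero.2 hq.ne') b

theorem wedgeL_ofFun_of_length_ne {p q : ℕ} (f : (Fin p → L) → N₁) (g : (Fin q → L) → N₂)
    {l : List L} (hl : l.length ≠ p + q) : wedgeL h (ofFun f) (ofFun g) l = 0 := by
  induction l generalizing p q with
  | nil =>
    rw [wedgeL_nil]
    rcases p with _ | p
    · rcases q with _ | q
      · simp at hl
      · simp
    · simp
  | cons x l ih =>
    rw [List.length_cons] at hl
    have h1 : wedgeL h (contr x (ofFun f)) (ofFun g) l = 0 := by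
      rcases p with _ | p
      · simp [contr_ofFun_zero]
      · rw [contr_ofFun_succ, ih _ _ (by omega)]
    have h2 : wedgeL h (sgnL (ofFun f)) (contr x (ofFun g)) l = 0 := by
      rcases q with _ | q
      · simp [contr_ofFun_zero]
      · rw [contr_ofFun_succ, sgnL_ofFun, wedgeL_smul_left, Pi.smul_apply, ih _ _ (by omega),
          smul_zero]
    rw [wedgeL_cons, h1, h2, add_zero]

/-- `wedge` sums over shuffles, that is, over cosets of S_p × S_q. Since `η` and `θ` are
alternating, the sum over all permutations counts each coset p! q! times. -/
theorem factorial_smul_wedge {p q : ℕ} (hR : N₁ →ₗ[R] N₂ →ₗ[R] N₃) (hh : ∀ m n, h m n = hR m n)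
    (η : L [⋀^Fin p]→ₗ[R] N₁) (θ : L [⋀^Fin q]→ₗ[R] N₂) (v : Fin (p + q) → L) :
    (p.factorial * q.factorial : ℝ) • wedge hR η θ v = permSum (pairFun h rfl η θ) v := by
  have key := congrArg (fun F ↦ TensorProduct.lift hR (F (v ∘ finSumFinEquiv)))
    (MultilinearMap.domCoprod_alternization_eq η θ)
  simp only [Fintype.card_fin, MultilinearMap.alternatization_apply, AlternatingMap.smul_apply,
    map_nsmul, map_sum] at key
  rw [← Nat.cast_mul, Nat.cast_smul_eq_nsmul ℝ]
  refine key.symm.trans ?_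
  rw [permSum, ← (Equiv.permCongr finSumFinEquiv).sum_comp]
  refine Finset.sum_congr rfl fun σ _ ↦ ?_
  rw [Equiv.Perm.sign_permCongr, LinearMap.map_smul_of_tower]
  congr 1
  rw [MultilinearMap.domDomCongr_apply, MultilinearMap.domCoprod_apply, TensorProduct.lift.tmul,
    pairFun, hh]
  have e1 : (fun a : Fin p ↦ (v ∘ finSumFinEquiv.permCongr σ) ⟨a, by omega⟩) =
      fun a ↦ (v ∘ finSumFinEquiv) (σ (Sum.inl a)) := by
    funext a
    have : (⟨a, by omega⟩ : Fin (p + q)) = finSumFinEquiv (Sum.inl a) := rfl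
    simp [this, -finSumFinEquiv_apply_left]
  have e2 : (fun b : Fin q ↦ (v ∘ finSumFinEquiv.permCongr σ) ⟨p + b, by omega⟩) =
      fun b ↦ (v ∘ finSumFinEquiv) (σ (Sum.inr b)) := by
    funext b
    have : (⟨p + b, by omega⟩ : Fin (p + q)) = finSumFinEquiv (Sum.inr b) := rfl
    simp [this, -finSumFinEquiv_apply_right]
  rw [e1, e2]
  rfl

/-- The wedge product of alternating maps as a wedge product of functions on lists. -/
theorem ofFun_wedge {p q : ℕ} (hR : N₁ →ₗ[R] N₂ →ₗ[R] N₃) (hh : ∀ m n, h m n = hR m n)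
    (η : L [⋀^Fin p]→ₗ[R] N₁) (θ : L [⋀^Fin q]→ₗ[R] N₂) :
    ofFun (wedge hR η θ) = wedgeL h (ofFun η) (ofFun θ) := by
  ext l
  by_cases hl : l.length = p + q
  · obtain ⟨v, rfl⟩ : ∃ v : Fin (p + q) → L, l = List.ofFn v :=
      ⟨fun i ↦ l.get (i.cast hl.symm), by
        rw [← List.ofFn_congr hl, List.ofFn_get]⟩
    have h1 := factorial_smul_wedge h hR hh η θ v
    have h2 := permSum_pairFun h rfl (toReal η) (toReal θ) v
    rw [ofFun_apply_ofFn]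
    -- Both wedge products, multiplied by p! q!, equal the same sum over permutations; this factor
    -- is invertible over ℝ.
    exact smul_right_injective N₃
      (by positivity : (p.factorial * q.factorial : ℝ) ≠ 0) (h1.trans h2)
  · rw [wedgeL_ofFun_of_length_ne h _ _ hl, ofFun_of_length_ne _ hl]

end Wedge

end

section

/-! ### The anchor is a morphism of Lie algebras -/

section Anchor

variable {E : Type u} [NormedAddCommGroup E] [NormedSpace ℝ E]
  {M : Type w} [TopologicalSpace M] [ChartedSpace E M]
  [FiniteDimensional ℝ E] [IsManifold 𝓘(ℝ, E) ∞ M] {A : SmoothVectorBundle E M}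

/-- A local extension of `v` is multiplied by a bump function at `p` whose closed support lies in
the open set where the extension is smooth. -/
theorem exists_sec_eq [T2Space M] {p : M} (v : A.V p) : ∃ s : Sec A, s p = v := by
  obtain ⟨u, hu, hs⟩ := FiberBundle.exists_contMDiffOn_extend 𝓘(ℝ, E) (k := ∞) A.F v
  obtain ⟨o, hou, ho, hpo⟩ := mem_nhds_iff.1 hu
  obtain ⟨ψ, -, hψ⟩ := (SmoothBumpFunction.nhds_basis_tsupport (I := 𝓘(ℝ, E)) p).mem_iff.1
    (ho.mem_nhds hpo)
  refine ⟨⟨(ψ : M → ℝ) • FiberBundle.extend A.F v, ψ.contMDiff.contMDiffOn.smul_section_of_tsupport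
    ho hψ (hs.mono hou)⟩, ?_⟩
  change ψ p • FiberBundle.extend A.F v p = v
  rw [ψ.eq_one, one_smul, FiberBundle.extend_apply_self]

/-- A nonzero tangent vector has nonzero image under the differential of the chart, which some
linear functional detects. A bump function makes the resulting local function global without
changing its germ at `p`. -/
theorem vf_eq_zero_of_lieD [T2Space M] {X : Sec (TM E M)} {p : M} (h : ∀ f, lieD X f p = 0) :
    vf X p = 0 := by
  obtain ⟨ψ⟩ : Nonempty (SmoothBumpFunction 𝓘(ℝ, E) p) := inferInstance
  have hx : MDifferentiableAt 𝓘(ℝ, E) 𝓘(ℝ, E) (extChartAt 𝓘(ℝ, E) p) p :=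
    mdifferentiableAt_extChartAt (mem_chart_source E p)
  have hd : mfderiv 𝓘(ℝ, E) 𝓘(ℝ, E) (extChartAt 𝓘(ℝ, E) p) p (vf X p) = 0 := by
    by_contra hne
    obtain ⟨e, he⟩ : ∃ e : E, e = mfderiv 𝓘(ℝ, E) 𝓘(ℝ, E) (extChartAt 𝓘(ℝ, E) p) p (vf X p) :=
      ⟨_, rfl⟩
    have hne' : e ≠ 0 := fun h ↦ hne (he.symm.trans h)
    obtain ⟨ℓ, hℓ⟩ := SeparatingDual.exists_ne_zero (R := ℝ) hne'
    rw [he] at hℓ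
    have hg : ContMDiffOn 𝓘(ℝ, E) 𝓘(ℝ, ℝ) ∞ (ℓ ∘ extChartAt 𝓘(ℝ, E) p) (chartAt E p).source :=
      ℓ.contMDiff.comp_contMDiffOn contMDiffOn_extChartAt
    have h0 := h ⟨fun x ↦ ψ x • (ℓ ∘ extChartAt 𝓘(ℝ, E) p) x, ψ.contMDiff_smul hg⟩
    have hev : (fun x ↦ ψ x • (ℓ ∘ extChartAt 𝓘(ℝ, E) p) x) =ᶠ[nhds p]
        ℓ ∘ extChartAt 𝓘(ℝ, E) p := by
      filter_upwards [ψ.eventuallyEq_one] with x hx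
      rw [hx, Pi.one_apply, one_smul]
    change mfderiv 𝓘(ℝ, E) 𝓘(ℝ, ℝ) (fun x ↦ ψ x • (ℓ ∘ extChartAt 𝓘(ℝ, E) p) x) p (vf X p) = 0
      at h0
    rw [hev.mfderiv_eq, mfderiv_comp p ℓ.mdifferentiableAt hx, ContinuousLinearMap.mfderiv_eq] at h0
    exact hℓ h0
  exact (isInvertible_mfderiv_extChartAt (mem_extChartAt_source (I := 𝓘(ℝ, E)) p)).injective
    (hd.trans (map_zero _).symm)

/-- All fibres are isomorphic to the one typical fibre, so a single zero fibre makes the whole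
bundle zero. This settles rank zero in `LieAlgebroid.rho_bracket`. -/
theorem subsingleton_sec {p : M} (h : Subsingleton (A.V p)) : Subsingleton (Sec A) := by
  have e := (trivializationAt A.F A.V p).continuousLinearEquivAt ℝ p (mem_baseSet_trivializationAt A.F A.V p)
  have hF : Subsingleton A.F := e.symm.toEquiv.subsingleton
  refine ⟨fun s t ↦ ?_⟩
  ext x
  have e := (trivializationAt A.F A.V x).continuousLinearEquivAt ℝ x (mem_baseSet_trivializationAt A.F A.V x)
  have := e.toEquiv.subsingleton
  exact Subsingleton.elim _ _

/-- Expand the Jacobi identity for α, β, f γ and remove f times the one for α, β, γ. The terms with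
one derivative of f cancel and those multiplying γ remain. -/
theorem LieAlgebroid.lieD_rho_bracket (𝔸 : LieAlgebroid A) (α β γ : Sec A) (f : Cinf E M) :
    lieD (𝔸.ρ (𝔸.bracket α β) - vfBracket (𝔸.ρ α) (𝔸.ρ β)) f • γ = 0 := by
  have h1 := 𝔸.jacobi α β (f • γ)
  have h0 := 𝔸.jacobi α β γ
  simp only [𝔸.leibniz, map_add, h0, smul_add] at h1
  rw [map_sub, LinearMap.sub_apply, lieD_vfBracket, sub_smul, sub_smul, ← neg_eq_zero, ← sub_eq_zero.2 h1]
  abel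

/-- The anchor of a Lie algebroid is compatible with the brackets. -/
theorem LieAlgebroid.rho_bracket [T2Space M] (𝔸 : LieAlgebroid A) (α β : Sec A) :
    𝔸.ρ (𝔸.bracket α β) = vfBracket (𝔸.ρ α) (𝔸.ρ β) := by
  rw [← sub_eq_zero]
  ext p
  by_cases h : Subsingleton (A.V p)
  · have := subsingleton_sec h
    rw [Subsingleton.elim α 0]
    simp
  · rw [not_subsingleton_iff_nontrivial] at h
    obtain ⟨v, hv⟩ := exists_ne (0 : A.V p)
    -- A section which is nonzero at `p` can be cancelled from `LieAlgebroid.lieD_rho_bracket`.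
    obtain ⟨γ, hγ⟩ := exists_sec_eq v
    refine vf_eq_zero_of_lieD fun f ↦ ?_
    have := congrArg (fun s : Sec A ↦ s p) (𝔸.lieD_rho_bracket α β γ f)
    simp only [smul_sec_apply, hγ] at this
    exact (smul_eq_zero.1 this).resolve_right hv

end Anchor

end

section

/-! ### One-cochains on lists. -/

section DegreeOne

variable {L N N₁ N₂ N₃ : Type*} [AddCommGroup L] [Module ℝ L] [AddCommGroup N] [Module ℝ N]
  [AddCommGroup N₁] [Module ℝ N₁] [AddCommGroup N₂] [Module ℝ N₂] [AddCommGroup N₃] [Module ℝ N₃]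

theorem negOnePow_zsmul (k : ℕ) (n : N) : ((-1 : ℤ) ^ k) • n = ((-1 : ℝ) ^ k) • n := by
  rcases Nat.even_or_odd k with h | h <;> simp [h.neg_one_pow]

theorem ofFun_zero_eq_degZero (g : (Fin 0 → L) → N) : ofFun g = degZero (g ![]) := by
  ext l
  rcases l with _ | ⟨x, l⟩
  · rw [ofFun_zero_nil]; rfl
  · exact ofFun_of_length_ne g (l := x :: l) (by simp)

theorem ofFun_one_eq_degOne (a : L →ₗ[ℝ] N) :
    ofFun (fun v : Fin 1 → L ↦ a (v 0)) = degOne a := by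
  ext l
  rcases l with _ | ⟨x, _ | ⟨y, l⟩⟩
  · rw [ofFun_succ_nil]; rfl
  · rw [ofFun_succ_cons, ofFun_zero_nil]; rfl
  · exact ofFun_of_length_ne _ (l := x :: y :: l) (by simp)

theorem mapL_degOne (g : N₁ →ₗ[ℝ] N₂) (a : L →ₗ[ℝ] N₁) : mapL g (degOne a) = degOne (g ∘ₗ a) := by
  rw [← ofFun_one_eq_degOne, ← ofFun_one_eq_degOne, mapL_ofFun]; rfl

theorem degOne_sub (a b : L →ₗ[ℝ] N) : degOne (a - b) = degOne a - degOne b := by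
  rw [← ofFun_one_eq_degOne, ← ofFun_one_eq_degOne, ← ofFun_one_eq_degOne, ← ofFun_sub]; rfl

/-- The wedge product with a form of degree one, as an alternating sum. -/
theorem wedgeL_degOne_ofFun (h : N₁ →ₗ[ℝ] N₂ →ₗ[ℝ] N₃) (a : L →ₗ[ℝ] N₁) {k : ℕ}
    (g : (Fin k → L) → N₂) : wedgeL h (degOne a) (ofFun g) =
      ofFun fun v : Fin (k + 1) → L ↦
        ∑ i : Fin (k + 1), (-1 : ℝ) ^ (i : ℕ) • h (a (v i)) (g (i.removeNth v)) := by
  ext l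
  induction l generalizing k with
  | nil => simp [degOne]
  | cons x l ih =>
    rw [wedgeL_cons, contr_degOne, wedgeL_degZero, mapL_ofFun, sgnL_degOne, wedgeL_neg_left,
      Pi.neg_apply, ofFun_succ_cons]
    cases k with
    | zero =>
      rw [contr_ofFun_zero, wedgeL_zero_right, Pi.zero_apply, neg_zero, add_zero]
      congr 1
      funext w
      rw [Fin.sum_univ_one, Fin.val_zero, pow_zero, one_smul]
      rfl
    | succ k =>
      rw [contr_ofFun_succ, ih, ← Pi.neg_apply, ← neg_one_smul ℝ, ← ofFun_smul, ← Pi.add_apply,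
        ← ofFun_add]
      congr 1
      funext w
      rw [Fin.sum_univ_succ]
      simp only [removeNth_succ_cons, Pi.add_apply, Fin.val_succ,
        pow_succ, mul_neg_one, neg_smul, Finset.sum_neg_distrib, Fin.val_zero, pow_zero, one_smul]
      rfl

theorem dL_degOne (br : L →ₗ[ℝ] L →ₗ[ℝ] L) (hbr : ∀ x, br x x = 0) (D : L →ₗ[ℝ] N →ₗ[ℝ] N)
    (a : L →ₗ[ℝ] N) : dL br D (degOne a) = ofFun fun v : Fin 2 → L ↦
      D (v 0) (a (v 1)) - D (v 1) (a (v 0)) - a (br (v 0) (v 1)) := by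
  rw [← ofFun_one_eq_degOne]
  have := ofFun_koszul br hbr D (AlternatingMap.ofSubsingleton ℝ L N (0 : Fin 1) a)
  refine Eq.trans this.symm ?_
  congr 1
  funext v
  rw [koszul_apply]
  simp [bracketSum, Fin.sum_univ_succ, Fin.removeNth]
  abel

end DegreeOne

variable {E : Type u} [NormedAddCommGroup E] [NormedSpace ℝ E]
  {M : Type w} [TopologicalSpace M] [ChartedSpace E M]
  [FiniteDimensional ℝ E] [IsManifold 𝓘(ℝ, E) ∞ M] {A B C : SmoothVectorBundle E M}

/-! ### The pairings and connections as real-bilinear maps. -/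

section Pairings

variable (B C) in
/-- The multiplication of sections by functions, as an `ℝ`-bilinear map. -/
def smulBilin : Cinf E M →ₗ[ℝ] Sec B →ₗ[ℝ] Sec B :=
  LinearMap.mk₂ ℝ (fun f s ↦ f • s) add_smul (fun c f s ↦ smul_assoc c f s) smul_add
    (fun c f s ↦ smul_comm f c s)

variable (B C) in
/-- The evaluation of homomorphisms on sections, as an `ℝ`-bilinear map. -/
def evalBilin : (Sec B →ₗ[Cinf E M] Sec C) →ₗ[ℝ] Sec B →ₗ[ℝ] Sec C :=
  LinearMap.mk₂ ℝ (fun φ s ↦ φ s) (fun _ _ _ ↦ rfl) (fun _ _ _ ↦ rfl) (fun φ ↦ map_add φ)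
    (fun c φ s ↦ LinearMap.map_smul_of_tower φ c s)

/-- The `ℝ`-bilinear map underlying a connection. -/
def AConnection.bilin {𝔸 : LieAlgebroid A} (nabla : AConnection 𝔸 B) :
    Sec A →ₗ[ℝ] Sec B →ₗ[ℝ] Sec B := LinearMap.restrictScalars ℝ nabla.conn

theorem ofFun_dConn {𝔸 : LieAlgebroid A} (nabla : AConnection 𝔸 B) {k : ℕ} (η : Form A B k) :
    ofFun (dConn nabla η) = dL 𝔸.bracket nabla.bilin (ofFun η) :=
  ofFun_koszul 𝔸.bracket 𝔸.bracket_self nabla.bilin (toReal η)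

theorem ofFun_dA (𝔸 : LieAlgebroid A) {k : ℕ} (η : ScalarForm A k) :
    ofFun (dA 𝔸 η) = dL 𝔸.bracket (LinearMap.restrictScalars ℝ 𝔸.act) (ofFun η) :=
  ofFun_koszul 𝔸.bracket 𝔸.bracket_self (LinearMap.restrictScalars ℝ 𝔸.act) (toReal η)

end Pairings

/-! ### The two components of Ω(A; Ad), and the derivation rule for D_∇. -/

section Components

/-- The component of an element of `Ω(A; Ad)` in `Ω(A; A)`, as a function on lists. -/
def compA : TotForms A (adBundle A) →ₗ[ℝ] List (Sec A) → Sec A where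
  toFun θ l := (θ (l.length, .ofNat 0) : Form A A l.length) l.get
  map_add' _ _ := rfl
  map_smul' _ _ := rfl

/-- The component of an element of `Ω(A; Ad)` in `Ω(A; TM)`, as a function on lists. -/
def compT : TotForms A (adBundle A) →ₗ[ℝ] List (Sec A) → Sec (TM E M) where
  toFun θ l := (θ (l.length, .ofNat 1) : Form A (TM E M) l.length) l.get
  map_add' _ _ := rfl
  map_smul' _ _ := rfl

theorem inclA_apply_of_ne {k : ℕ} (η : Form A A k) {p : ℕ × ℤ} (h : p ≠ (k, .ofNat 0)) :
    inclA k η p = 0 := DirectSum.of_eq_of_ne _ _ _ h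

theorem inclT_apply_of_ne {k : ℕ} (η : Form A (TM E M) k) {p : ℕ × ℤ} (h : p ≠ (k, .ofNat 1)) :
    inclT k η p = 0 := DirectSum.of_eq_of_ne _ _ _ h

theorem inclA_apply (k : ℕ) (η : Form A A k) : inclA k η (k, .ofNat 0) = η :=
  DirectSum.of_eq_same (β := fun p : ℕ × ℤ ↦ Form A ((adBundle A).comp p.2) p.1) (k, .ofNat 0) η

theorem inclT_apply (k : ℕ) (η : Form A (TM E M) k) : inclT k η (k, .ofNat 1) = η :=
  DirectSum.of_eq_same (β := fun p : ℕ × ℤ ↦ Form A ((adBundle A).comp p.2) p.1) (k, .ofNat 1) η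

theorem compA_inclA (k : ℕ) (η : Form A A k) : compA (inclA k η) = ofFun η := by
  ext1 l
  by_cases h : l.length = k
  · subst h
    rw [ofFun, dif_pos rfl]
    exact congrArg (fun ζ : Form A A l.length ↦ ζ l.get) (inclA_apply l.length η)
  · rw [ofFun_of_length_ne _ h]
    have e : (inclA k η (l.length, .ofNat 0) : Form A A l.length) = 0 :=
      inclA_apply_of_ne η fun e ↦ h (congrArg Prod.fst e)
    exact congrArg (fun ζ : Form A A l.length ↦ ζ l.get) e

theorem compT_inclT (k : ℕ) (η : Form A (TM E M) k) : compT (inclT k η) = ofFun η := by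
  ext1 l
  by_cases h : l.length = k
  · subst h
    rw [ofFun, dif_pos rfl]
    exact congrArg (fun ζ : Form A (TM E M) l.length ↦ ζ l.get) (inclT_apply l.length η)
  · rw [ofFun_of_length_ne _ h]
    have e : (inclT k η (l.length, .ofNat 1) : Form A (TM E M) l.length) = 0 :=
      inclT_apply_of_ne η fun e ↦ h (congrArg Prod.fst e)
    exact congrArg (fun ζ : Form A (TM E M) l.length ↦ ζ l.get) e

theorem compA_inclT (k : ℕ) (η : Form A (TM E M) k) : compA (inclT k η) = 0 := by
  ext1 l
  have e : (inclT k η (l.length, .ofNat 0) : Form A A l.length) = 0 :=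
    inclT_apply_of_ne η fun e ↦ by simpa using congrArg Prod.snd e
  exact congrArg (fun ζ : Form A A l.length ↦ ζ l.get) e

theorem compT_inclA (k : ℕ) (η : Form A A k) : compT (inclA k η) = 0 := by
  ext1 l
  have e : (inclA k η (l.length, .ofNat 1) : Form A (TM E M) l.length) = 0 :=
    inclA_apply_of_ne η fun e ↦ by simpa using congrArg Prod.snd e
  exact congrArg (fun ζ : Form A (TM E M) l.length ↦ ζ l.get) e

theorem adBundle_form_subsingleton (k : ℕ) : (j : ℤ) → j ≠ 0 → j ≠ 1 →
    Subsingleton (Form A ((adBundle A).comp j) k)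
  | .ofNat 0, h, _ => absurd rfl h
  | .ofNat 1, _, h => absurd rfl h
  | .ofNat (n + 2), _, _ => by
    refine ⟨fun η θ ↦ ?_⟩
    ext v x
    exact Subsingleton.elim (α := PUnit) _ _
  | .negSucc n, _, _ => by
    refine ⟨fun η θ ↦ ?_⟩
    ext v x
    exact Subsingleton.elim (α := PUnit) _ _

theorem form_eq_of_get {k : ℕ} {η θ : Form A B k}
    (h : ∀ (l : List (Sec A)) (hl : l.length = k),
      η (fun i ↦ l.get (i.cast hl.symm)) = θ (fun i ↦ l.get (i.cast hl.symm))) : η = θ := by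
  ext1 v
  have := h (List.ofFn v) List.length_ofFn
  simpa using this

/-- The bundle is zero outside degrees 0 and 1, so two functions on lists determine an element.
Identities in Ω(A; Ad) thereby become pairs of identities in the list calculus. -/
theorem adForms_ext {θ θ' : TotForms A (adBundle A)} (hA : compA θ = compA θ')
    (hT : compT θ = compT θ') : θ = θ' := by
  refine DFinsupp.ext ?_
  rintro ⟨k, j⟩
  by_cases h0 : j = 0
  · subst h0
    refine form_eq_of_get (B := A) (k := k) fun l hl ↦ ?_
    subst hl
    exact congrFun hA l
  by_cases h1 : j = 1
  · subst h1
    refine form_eq_of_get (B := TM E M) (k := k) fun l hl ↦ ?_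
    subst hl
    exact congrFun hT l
  exact (adBundle_form_subsingleton k j h0 h1).elim _ _

theorem adForms_induction {P : TotForms A (adBundle A) → Prop} (zero : P 0)
    (inclA : ∀ k η, P (inclA k η)) (inclT : ∀ k η, P (inclT k η))
    (add : ∀ θ θ', P θ → P θ' → P (θ + θ')) (θ : TotForms A (adBundle A)) : P θ := by
  induction θ using DirectSum.induction_on with
  | zero => exact zero
  | of p η =>
    obtain ⟨k, j⟩ := p
    by_cases h0 : j = 0
    · subst h0; exact inclA k η
    by_cases h1 : j = 1
    · subst h1; exact inclT k η
    have := adBundle_form_subsingleton (A := A) k j h0 h1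
    rw [Subsingleton.elim η 0, map_zero]
    exact zero
  | add θ θ' h h' => exact add θ θ' h h'

theorem compA_leftMul {p : ℕ} (τ : ScalarForm A p) (θ : TotForms A (adBundle A)) :
    compA (leftMul τ θ) = wedgeL (smulBilin A) (ofFun τ) (compA θ) := by
  induction θ using adForms_induction with
  | zero => simp only [map_zero, wedgeL_zero_right]
  | inclA k η =>
    have e : leftMul τ (inclA k η) =
        inclA (p + k) (wedge (LinearMap.lsmul (Cinf E M) (Sec A)) τ η) :=
      DirectSum.toModule_lof ..
    rw [e, compA_inclA, compA_inclA]
    exact ofFun_wedge (R := Cinf E M) (smulBilin A) (LinearMap.lsmul (Cinf E M) (Sec A)) (fun _ _ ↦ rfl) τ η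
  | inclT k η =>
    have e : leftMul τ (inclT k η) =
        inclT (p + k) (wedge (LinearMap.lsmul (Cinf E M) (Sec (TM E M))) τ η) :=
      DirectSum.toModule_lof ..
    rw [e, compA_inclT, compA_inclT, wedgeL_zero_right]
  | add θ θ' h h' => rw [map_add, map_add, map_add, wedgeL_add_right, h, h']

theorem compT_leftMul {p : ℕ} (τ : ScalarForm A p) (θ : TotForms A (adBundle A)) :
    compT (leftMul τ θ) = wedgeL (smulBilin (TM E M)) (ofFun τ) (compT θ) := by
  induction θ using adForms_induction with
  | zero => simp only [map_zero, wedgeL_zero_right]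
  | inclA k η =>
    have e : leftMul τ (inclA k η) =
        inclA (p + k) (wedge (LinearMap.lsmul (Cinf E M) (Sec A)) τ η) :=
      DirectSum.toModule_lof ..
    rw [e, compT_inclA, compT_inclA, wedgeL_zero_right]
  | inclT k η =>
    have e : leftMul τ (inclT k η) =
        inclT (p + k) (wedge (LinearMap.lsmul (Cinf E M) (Sec (TM E M))) τ η) :=
      DirectSum.toModule_lof ..
    rw [e, compT_inclT, compT_inclT]
    exact ofFun_wedge (R := Cinf E M) (smulBilin (TM E M))
      (LinearMap.lsmul (Cinf E M) (Sec (TM E M))) (fun _ _ ↦ rfl) τ η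
  | add θ θ' h h' => rw [map_add, map_add, map_add, wedgeL_add_right, h, h']

variable (𝔸 : LieAlgebroid A) (nabla : Connection A)

/-- The anchor as an `ℝ`-linear map. -/
def rhoR : Sec A →ₗ[ℝ] Sec (TM E M) := LinearMap.restrictScalars ℝ 𝔸.ρ

/-- The sign (-1)^k, which depends on the form degree, becomes the operator `sgnL`; together with
`compT_adOperator` this gives D_∇(f, g) = (d_{∇^bas} f + R^bas ∧ sg, ρ(sf) + d_{∇^bas} g), valid in
all degrees at once. -/
theorem compA_adOperator (θ : TotForms A (adBundle A)) : compA (adOperator 𝔸 nabla θ) =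
    dL 𝔸.bracket (basA 𝔸 nabla).bilin (compA θ) +
      wedgeL (evalBilin (TM E M) A) (ofFun (rBas 𝔸 nabla)) (sgnL (compT θ)) := by
  induction θ using adForms_induction with
  | zero => simp only [map_zero, wedgeL_zero_right, dL_zero, add_zero]
  | inclA k η =>
    rw [adOperator_inclA, map_add, map_zsmul, compA_inclT, compA_inclA, compA_inclA, compT_inclA,
      ofFun_dConn, map_zero, wedgeL_zero_right, smul_zero, zero_add, add_zero]
  | inclT k η =>
    have e : ofFun (rBasWedge 𝔸 nabla k η) =
        wedgeL (evalBilin (TM E M) A) (ofFun (rBas 𝔸 nabla)) (ofFun η) :=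
      ofFun_wedge (R := Cinf E M) (evalBilin (TM E M) A) LinearMap.id (fun _ _ ↦ rfl)
        (rBas 𝔸 nabla) η
    rw [adOperator_inclT, map_add, map_zsmul, compA_inclT, compA_inclT, compA_inclA, compT_inclT,
      e, sgnL_ofFun, wedgeL_smul_right, negOnePow_zsmul, dL_zero]
  | add θ θ' h h' => simp only [map_add, h, h', dL_add, wedgeL_add_right]; abel

theorem compT_adOperator (θ : TotForms A (adBundle A)) : compT (adOperator 𝔸 nabla θ) =
    mapL (rhoR 𝔸) (sgnL (compA θ)) + dL 𝔸.bracket (basT 𝔸 nabla).bilin (compT θ) := by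
  induction θ using adForms_induction with
  | zero => simp only [map_zero, dL_zero, add_zero]
  | inclA k η =>
    have e : ofFun (rhoComp 𝔸 k η) = mapL (rhoR 𝔸) (ofFun η) := (mapL_ofFun (rhoR 𝔸) η).symm
    rw [adOperator_inclA, map_add, map_zsmul, compT_inclT, compT_inclA, compA_inclA, compT_inclA,
      e, sgnL_ofFun, map_smul, dL_zero, negOnePow_zsmul]
  | inclT k η =>
    rw [adOperator_inclT, map_add, map_zsmul, compT_inclT, compT_inclT, compT_inclA, compA_inclT,
      ofFun_dConn, map_zero, map_zero, smul_zero, zero_add, add_zero]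
  | add θ θ' h h' => simp only [map_add, h, h', dL_add]; abel

/-- The parts d_{∇^bas} obey the Leibniz rule because ∇^bas does. The anchor and the values of R^bas
are C^∞(M)-linear, so they pass through `τ`; R^bas has even degree, so the only sign is the (-1)^k
from s(τ ∧ ·). -/
theorem adOperator_leftMul {k : ℕ} (τ : ScalarForm A k) (θ : TotForms A (adBundle A)) :
    adOperator 𝔸 nabla (leftMul τ θ) =
      leftMul (dA 𝔸 τ) θ + (-1 : ℤ) ^ k • leftMul τ (adOperator 𝔸 nabla θ) := by
  have hR : sgnL (ofFun (rBas 𝔸 nabla)) = (-1 : ℝ) ^ 2 • ofFun (rBas 𝔸 nabla) := sgnL_ofFun _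
  have hsq : (-1 : ℝ) ^ k * (-1) ^ k = 1 := by rw [← mul_pow]; simp
  have hleib : ∀ {B : SmoothVectorBundle E M} (D : AConnection 𝔸 B) (α : Sec A) (f : Cinf E M)
      (s : Sec B), D.bilin α (smulBilin B f s) =
      smulBilin B (LinearMap.restrictScalars ℝ 𝔸.act α f) s + smulBilin B f (D.bilin α s) := by
    intro B D α f s
    rw [add_comm]; exact D.leibniz α f s
  refine adForms_ext ?_ ?_
  · rw [compA_adOperator, compA_leftMul, compT_leftMul, map_add, map_zsmul, compA_leftMul,
      compA_leftMul, compA_adOperator, ofFun_dA, dL_wedgeL _ _ (hleib _), sgnL_wedgeL,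
      wedgeL_left_comm (h₃ := smulBilin A) (fun φ f s ↦ map_smul φ f s) 2 _ hR]
    simp only [sgnL_ofFun, wedgeL_smul_left, wedgeL_add_right, negOnePow_zsmul, smul_add,
      Function.iterate_succ, Function.iterate_zero, Function.comp, map_smul, smul_smul, hsq,
      one_mul, id, add_assoc]
  · rw [compT_adOperator, compA_leftMul, compT_leftMul, map_add, map_zsmul, compT_leftMul,
      compT_leftMul, compT_adOperator, ofFun_dA, dL_wedgeL _ _ (hleib _), sgnL_wedgeL,
      mapL_wedgeL (smulBilin A) (smulBilin (TM E M)) LinearMap.id (rhoR 𝔸) (rhoR 𝔸)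
        (fun f s ↦ map_smul 𝔸.ρ f s)]
    have e : mapL (LinearMap.id) (sgnL (ofFun τ)) = sgnL (ofFun τ) := rfl
    rw [e]
    simp only [sgnL_ofFun, wedgeL_smul_left, wedgeL_add_right, negOnePow_zsmul, smul_add]
    abel

end Components

end

section

variable {E : Type u} [NormedAddCommGroup E] [NormedSpace ℝ E]
  {M : Type w} [TopologicalSpace M] [ChartedSpace E M]
  [FiniteDimensional ℝ E] [IsManifold 𝓘(ℝ, E) ∞ M] {A : SmoothVectorBundle E M}

/-! ### The deformation complex on lists, and Ψ_∇ as a chain map. -/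

section DeformationLists

/-- The map underlying a deformation cochain, as a function on lists. -/
def defMapL : (k : ℕ) → DefCochain A k → List (Sec A) → Sec A
  | 0, γ => degZero (show Sec A from γ)
  | k + 1, c => ofFun (show Multiderivation A k from c).1.1

/-- The symbol of a deformation cochain, as a function on lists. -/
def defSymbolL : (k : ℕ) → DefCochain A k → List (Sec A) → Sec (TM E M)
  | 0, _ => 0
  | k + 1, c => ofFun (show Multiderivation A k from c).1.2

theorem isSubtractive_defMapL : (k : ℕ) → (c : DefCochain A k) → IsSubtractive (defMapL k c)
  | 0, γ => by
    have h := isSubtractive_ofFun (AlternatingMap.constOfIsEmpty ℝ (Sec A) (Fin 0)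
      (show Sec A from γ))
    rwa [ofFun_zero_eq_degZero] at h
  | _ + 1, c => isSubtractive_ofFun (show Multiderivation A _ from c).1.1

theorem isSubtractive_defSymbolL : (k : ℕ) → (c : DefCochain A k) → IsSubtractive (defSymbolL k c)
  | 0, _ => fun _ _ _ _ ↦ (sub_zero _).symm
  | _ + 1, c => isSubtractive_ofFun (toReal (show Multiderivation A _ from c).1.2)

variable (𝔸 : LieAlgebroid A) (nabla : Connection A)

/-- δ is the Koszul operator of the adjoint action α ↦ [α, ·]. This action is not C^∞(M)-linear in
α, but the list calculus asks only for ℝ-bilinearity. -/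
theorem defMapL_delta : (k : ℕ) → (c : DefCochain A k) →
    defMapL (k + 1) (delta 𝔸 k c) = dL 𝔸.bracket 𝔸.bracket (defMapL k c)
  | 0, γ => by
    have h := ofFun_koszul 𝔸.bracket 𝔸.bracket_self 𝔸.bracket
      (AlternatingMap.constOfIsEmpty ℝ (Sec A) (Fin 0) (show Sec A from γ))
    rw [ofFun_zero_eq_degZero (AlternatingMap.constOfIsEmpty ℝ (Sec A) (Fin 0) _)] at h
    exact h
  | _ + 1, c => ofFun_koszul 𝔸.bracket 𝔸.bracket_self 𝔸.bracket
      (show Multiderivation A _ from c).1.1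

/-- For a cochain with k + 1 arguments, (-1)^k ρ(c) is -ρ(sc). In this form the formula covers
degree zero as well, where the symbol is -ρ(γ). -/
theorem defSymbolL_delta : (k : ℕ) → (c : DefCochain A k) →
    defSymbolL (k + 1) (delta 𝔸 k c) = dL 𝔸.bracket (rhoBracket 𝔸) (defSymbolL k c) -
      mapL (rhoR 𝔸) (sgnL (defMapL k c))
  | 0, γ => by
    have h : defSymbolL 1 (delta 𝔸 0 γ) = degZero (-𝔸.ρ (show Sec A from γ)) :=
      ofFun_zero_eq_degZero _
    have h' : defMapL 0 γ = ofFun fun _ : Fin 0 → Sec A ↦ (show Sec A from γ) :=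
      (ofFun_zero_eq_degZero fun _ : Fin 0 → Sec A ↦ (show Sec A from γ)).symm
    rw [h, h', sgnL_ofFun, pow_zero, one_smul, mapL_ofFun, ofFun_zero_eq_degZero, defSymbolL,
      dL_zero, zero_sub]
    ext1 l
    rcases l with _ | ⟨x, l⟩
    · rfl
    · exact neg_zero.symm
  | k + 1, c => by
    set c' : Multiderivation A k := c
    have h1 := ofFun_koszul 𝔸.bracket 𝔸.bracket_self (rhoBracket 𝔸) (toReal c'.1.2)
    have h2 : sgnL (defMapL (k + 1) c) = (-1 : ℝ) ^ (k + 1) • ofFun c'.1.1 := sgnL_ofFun _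
    have h3 : defSymbolL (k + 2) (delta 𝔸 (k + 1) c) = ofFun
        ((fun v ↦ koszul 𝔸.bracket 𝔸.bracket_self (rhoBracket 𝔸) (toReal c'.1.2) v) +
          (-1 : ℝ) ^ k • fun v ↦ rhoR 𝔸 (c'.1.1 v)) := by
      change ofFun (fun v ↦ deltaSymbol 𝔸 c' v) = _
      congr 1
      funext v
      rw [deltaSymbol_apply, negOnePow_zsmul]
      rfl
    rw [h2, h3, ofFun_add, ofFun_smul, map_smul, mapL_ofFun, pow_succ, mul_neg_one, neg_smul,
      sub_neg_eq_add]
    exact congrArg (· + _) h1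

/-- `δ² = 0` on the underlying maps. -/
theorem defMapL_delta_delta (k : ℕ) (c : DefCochain A k) :
    defMapL (k + 2) (delta 𝔸 (k + 1) (delta 𝔸 k c)) = 0 := by
  rw [defMapL_delta, defMapL_delta]
  refine dL_dL _ _ 𝔸.jacobi (fun x y z ↦ ?_) (isSubtractive_defMapL k c)
  rw [𝔸.jacobi x y z]; abel

/-- `δ² = 0` on the symbols. -/
theorem defSymbolL_delta_delta [T2Space M] (k : ℕ) (c : DefCochain A k) :
    defSymbolL (k + 2) (delta 𝔸 (k + 1) (delta 𝔸 k c)) = 0 := by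
  -- Flatness of α ↦ [ρ(α), ·] is the Jacobi identity of vector fields once the anchor preserves
  -- brackets.
  have hflat : ∀ (x y : Sec A) (X : Sec (TM E M)), rhoBracket 𝔸 (𝔸.bracket x y) X =
      rhoBracket 𝔸 x (rhoBracket 𝔸 y X) - rhoBracket 𝔸 y (rhoBracket 𝔸 x X) := by
    intro x y X
    change vfBracket (𝔸.ρ (𝔸.bracket x y)) X = vfBracket (𝔸.ρ x) (vfBracket (𝔸.ρ y) X) -
      vfBracket (𝔸.ρ y) (vfBracket (𝔸.ρ x) X)
    rw [𝔸.rho_bracket]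
    exact eq_sub_of_add_eq ((tangentAlgebroid E M).jacobi (𝔸.ρ x) (𝔸.ρ y) X).symm
  -- What is left of d(dσ - ρ(sc)) - ρ(s dc) after d²σ = 0 vanishes because d commutes with ρ and
  -- anticommutes with s.
  rw [defSymbolL_delta, defSymbolL_delta, defMapL_delta, dL_sub,
    dL_dL _ _ 𝔸.jacobi hflat (isSubtractive_defSymbolL k c),
    ← mapL_dL _ 𝔸.bracket (rhoBracket 𝔸) (rhoR 𝔸) (fun x n ↦ 𝔸.rho_bracket x n), dL_sgnL, map_neg]
  abel

/-- The `ℝ`-linear map sending `α` to `X ↦ ∇_X α`. -/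
def covDiff : Sec A →ₗ[ℝ] Sec (TM E M) →ₗ[Cinf E M] Sec A where
  toFun α :=
    { toFun := fun X ↦ nabla.conn X α
      map_add' := fun X Y ↦ by rw [map_add]; rfl
      map_smul' := fun f X ↦ by rw [map_smul]; rfl }
  map_add' α β := by ext1 X; exact map_add (nabla.conn X) α β
  map_smul' c α := by ext1 X; exact map_smul (nabla.conn X) c α

/-- The inclusion of `C^∞(M)`-linear maps in `ℝ`-linear maps. -/
def homToReal : (Sec (TM E M) →ₗ[Cinf E M] Sec A) →ₗ[ℝ] Sec (TM E M) →ₗ[ℝ] Sec A where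
  toFun φ := φ.restrictScalars ℝ
  map_add' _ _ := rfl
  map_smul' _ _ := rfl

/-- The operators `φ ↦ ∇^bas_α ∘ φ - φ ∘ [ρ(α), ·]`. -/
def homConn : Sec A →ₗ[ℝ] (Sec (TM E M) →ₗ[ℝ] Sec A) →ₗ[ℝ] Sec (TM E M) →ₗ[ℝ] Sec A :=
  LinearMap.mk₂ ℝ (fun α φ ↦ (basA 𝔸 nabla).bilin α ∘ₗ φ - φ ∘ₗ rhoBracket 𝔸 α)
    (fun α β φ ↦ by ext1 X; simp; abel)
    (fun c α φ ↦ by ext1 X; simp [smul_sub])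
    (fun α φ ψ ↦ by ext1 X; simp; abel)
    (fun c α φ ↦ by ext1 X; simp [smul_sub])

theorem homConn_apply (α : Sec A) (φ : Sec (TM E M) →ₗ[ℝ] Sec A) (X : Sec (TM E M)) :
    homConn 𝔸 nabla α φ X = (basA 𝔸 nabla).conn α (φ X) - φ (rhoBracket 𝔸 α X) := rfl

theorem basA_conn (α β : Sec A) :
    (basA 𝔸 nabla).conn α β = nabla.conn (𝔸.ρ β) α + 𝔸.bracket α β := rfl

/-- The basic curvature is minus the covariant derivative of `α ↦ (X ↦ ∇_X α)`. -/
theorem dL_covDiff : dL 𝔸.bracket (homConn 𝔸 nabla) (degOne (homToReal ∘ₗ covDiff nabla)) =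
    - mapL homToReal (ofFun (rBas 𝔸 nabla)) := by
  rw [dL_degOne _ 𝔸.bracket_self, mapL_ofFun, ← neg_one_smul ℝ, ← ofFun_smul]
  congr 1
  funext v
  ext1 X
  have hr : rBas 𝔸 nabla v X = rBasFun 𝔸 nabla (v 0) (v 1) X := rfl
  change homConn 𝔸 nabla (v 0) (homToReal (covDiff nabla (v 1))) X -
    homConn 𝔸 nabla (v 1) (homToReal (covDiff nabla (v 0))) X -
      nabla.conn X (𝔸.bracket (v 0) (v 1)) = (-1 : ℝ) • rBas 𝔸 nabla v X
  have h1 : ∀ (α : Sec A) (Y : Sec (TM E M)),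
      homToReal (covDiff nabla α) Y = nabla.conn Y α := fun _ _ ↦ rfl
  have h2 : ∀ α, rhoBracket 𝔸 α X = vfBracket (𝔸.ρ α) X := fun _ ↦ rfl
  rw [hr, neg_one_smul]
  -- Each ∇^bas_α X inside R^bas splits into ρ(∇_X α) and [ρ(α), X]. The first part matches the
  -- anchor term of ∇^bas on A, the second the term φ ∘ [ρ(α), ·] of `homConn`.
  simp only [homConn_apply, h1, h2, basA_conn, rBasFun, basT_conn, map_add, LinearMap.add_apply]
  rw [br_swap 𝔸.bracket 𝔸.bracket_self (nabla.conn X (v 0)) (v 1)]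
  abel

/-- Moves the coefficients to ℝ-linear homomorphisms, where `homConn` acts and the Leibniz rule is
applied. -/
theorem wedgeL_eval_eq (a : Sec A →ₗ[ℝ] Sec (TM E M) →ₗ[Cinf E M] Sec A)
    (g : List (Sec A) → Sec (TM E M)) :
    wedgeL (evalBilin (TM E M) A) (degOne a) g =
      wedgeL LinearMap.id (degOne (homToReal ∘ₗ a)) g := by
  rw [← mapL_degOne]
  exact mapL_wedgeL (evalBilin (TM E M) A) LinearMap.id homToReal LinearMap.id LinearMap.id
    (fun _ _ ↦ rfl) (degOne a) g

/-- `homConn` is chosen so that evaluation is compatible with [ρ(α), ·] on TM and ∇^bas on A. The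
Leibniz rule then gives dθ ∧ g + sθ ∧ dg, where dθ = -R^bas and sθ = -θ. -/
theorem dL_covDiff_wedgeL (g : List (Sec A) → Sec (TM E M)) :
    dL 𝔸.bracket (basA 𝔸 nabla).bilin
        (wedgeL (evalBilin (TM E M) A) (degOne (covDiff nabla)) g) =
      - wedgeL (evalBilin (TM E M) A) (ofFun (rBas 𝔸 nabla)) g -
        wedgeL (evalBilin (TM E M) A) (degOne (covDiff nabla))
          (dL 𝔸.bracket (rhoBracket 𝔸) g) := by
  have hR : wedgeL (evalBilin (TM E M) A) (ofFun (rBas 𝔸 nabla)) g =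
      wedgeL LinearMap.id (mapL homToReal (ofFun (rBas 𝔸 nabla))) g :=
    mapL_wedgeL (evalBilin (TM E M) A) LinearMap.id homToReal LinearMap.id LinearMap.id
      (fun _ _ ↦ rfl) _ g
  rw [wedgeL_eval_eq, wedgeL_eval_eq, dL_wedgeL (D₁ := homConn 𝔸 nabla) (D₂ := rhoBracket 𝔸),
    dL_covDiff, sgnL_degOne, wedgeL_neg_left, wedgeL_neg_left, hR, sub_eq_add_neg]
  intro x φ X
  change (basA 𝔸 nabla).conn x (φ X) = homConn 𝔸 nabla x φ X + φ (rhoBracket 𝔸 x X)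
  rw [homConn_apply]
  abel

/-- ∇^bas_α β exceeds [α, β] by θ(α)(ρ(β)), a term of the kind treated in `dL_eq_add_wedgeL`. -/
theorem dL_basA (f : List (Sec A) → Sec A) : dL 𝔸.bracket (basA 𝔸 nabla).bilin f =
    dL 𝔸.bracket 𝔸.bracket f +
      wedgeL (evalBilin (TM E M) A) (degOne (covDiff nabla)) (mapL (rhoR 𝔸) f) := by
  rw [dL_eq_add_wedgeL 𝔸.bracket (D := 𝔸.bracket) (D' := (basA 𝔸 nabla).bilin)
    (h := (evalBilin (TM E M) A).compl₂ (rhoR 𝔸)) (covDiff nabla)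
    (fun x n ↦ add_comm _ _)]
  congr 1
  exact mapL_wedgeL _ (evalBilin (TM E M) A) LinearMap.id (rhoR 𝔸) LinearMap.id
    (fun _ _ ↦ rfl) _ f

/-- The same θ measures the deviation on TM, now followed by the anchor: ∇^bas_α X exceeds [ρ(α), X]
by ρ(θ(α)(X)). -/
theorem dL_basT (g : List (Sec A) → Sec (TM E M)) : dL 𝔸.bracket (basT 𝔸 nabla).bilin g =
    dL 𝔸.bracket (rhoBracket 𝔸) g +
      mapL (rhoR 𝔸) (wedgeL (evalBilin (TM E M) A) (degOne (covDiff nabla)) g) := by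
  rw [dL_eq_add_wedgeL 𝔸.bracket (D := rhoBracket 𝔸) (D' := (basT 𝔸 nabla).bilin)
    (h := (evalBilin (TM E M) A).compr₂ (rhoR 𝔸)) (covDiff nabla)
    (fun x n ↦ add_comm _ _)]
  congr 1
  exact (mapL_wedgeL (evalBilin (TM E M) A) _ LinearMap.id LinearMap.id (rhoR 𝔸)
    (fun _ _ ↦ rfl) _ g).symm

/-- The inclusion of the deformation cochains of degree `k`. -/
abbrev defIncl (k : ℕ) : DefCochain A k →ₗ[ℝ] TotDef A := DirectSum.lof ℝ ℕ (DefCochain A) k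

/-- The correction terms in c_∇ are a wedge product with the one-cochain θ. Neither summand on the
right need be tensorial; the difference is. -/
theorem ofFun_splitting {k : ℕ} (c : Multiderivation A k) : ofFun (splitting nabla c) =
    ofFun c.1.1 -
      wedgeL (evalBilin (TM E M) A) (degOne (covDiff nabla)) (sgnL (ofFun c.1.2)) := by
  rw [sgnL_ofFun, wedgeL_smul_right, wedgeL_degOne_ofFun, ← ofFun_smul, ← ofFun_sub]
  congr 1
  funext v
  rw [splitting_apply, negOnePow_zsmul]
  simp only [negOnePow_zsmul]
  rfl

theorem compA_psi_defIncl (k : ℕ) (c : DefCochain A k) : compA (psi nabla (defIncl k c)) =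
    defMapL k c -
      wedgeL (evalBilin (TM E M) A) (degOne (covDiff nabla)) (sgnL (defSymbolL k c)) := by
  rw [psi, DirectSum.toModule_lof]
  cases k with
  | zero =>
    change compA (inclA 0 _) = defMapL 0 c - wedgeL _ _ (sgnL 0)
    rw [compA_inclA, map_zero, wedgeL_zero_right, sub_zero]
    exact ofFun_zero_eq_degZero _
  | succ k =>
    change compA (inclA (k + 1) _ + inclT k _) = _
    rw [map_add, compA_inclA, compA_inclT, add_zero]
    exact ofFun_splitting nabla _

theorem compT_psi_defIncl (k : ℕ) (c : DefCochain A k) : compT (psi nabla (defIncl k c)) =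
    - defSymbolL k c := by
  rw [psi, DirectSum.toModule_lof]
  cases k with
  | zero =>
    change compT (inclA 0 _) = - 0
    rw [compT_inclA, neg_zero]
  | succ k =>
    change compT (inclA (k + 1) _ + inclT k (- (show Multiderivation A k from c).1.2)) = _
    rw [map_add, compT_inclA, map_neg, map_neg, compT_inclT, zero_add]
    rfl

theorem deltaTot_defIncl (k : ℕ) (c : DefCochain A k) :
    deltaTot 𝔸 (defIncl k c) = defIncl (k + 1) (delta 𝔸 k c) := DirectSum.toModule_lof ..

/-- `Ψ_∇` is a chain map. -/
theorem psi_deltaTot (c : TotDef A) :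
    psi nabla (deltaTot 𝔸 c) = adOperator 𝔸 nabla (psi nabla c) := by
  induction c using DirectSum.induction_on with
  | zero => simp only [map_zero]
  | add c c' h h' => simp only [map_add, h, h']
  | of k c =>
    change psi nabla (deltaTot 𝔸 (defIncl k c)) = adOperator 𝔸 nabla (psi nabla (defIncl k c))
    rw [deltaTot_defIncl]
    refine adForms_ext ?_ ?_
    -- The curvature term of D_∇ cancels the R^bas produced by differentiating θ ∧ sσ. Both sides
    -- become dc + θ ∧ ρ(c) - θ ∧ s(dσ).
    · rw [compA_adOperator, compA_psi_defIncl, compA_psi_defIncl, compT_psi_defIncl, dL_sub,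
        dL_covDiff_wedgeL, dL_basA, defMapL_delta, defSymbolL_delta, map_sub, wedgeL_sub_right,
        sgnL_mapL, sgnL_sgnL, dL_sgnL, map_neg, wedgeL_neg_right, wedgeL_neg_right]
      abel
    -- The term ρ(θ ∧ σ) from the correction in c_∇ cancels the one by which ∇^bas on TM differs
    -- from [ρ(α), ·].
    · rw [compT_adOperator, compA_psi_defIncl, compT_psi_defIncl, compT_psi_defIncl, dL_neg,
        dL_basT, defSymbolL_delta, map_sub, sgnL_wedgeL, sgnL_degOne, sgnL_sgnL, wedgeL_neg_left,
        map_sub, map_neg]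
      abel

theorem psi_deltaTot_deltaTot [T2Space M] (c : TotDef A) :
    psi nabla (deltaTot 𝔸 (deltaTot 𝔸 c)) = 0 := by
  induction c using DirectSum.induction_on with
  | zero => simp only [map_zero]
  | add c c' h h' => simp only [map_add, h, h', add_zero]
  | of k c =>
    change psi nabla (deltaTot 𝔸 (deltaTot 𝔸 (defIncl k c))) = 0
    rw [deltaTot_defIncl, deltaTot_defIncl]
    refine adForms_ext ?_ ?_
    · rw [compA_psi_defIncl, defMapL_delta_delta, defSymbolL_delta_delta, map_zero, map_zero,
        wedgeL_zero_right, sub_zero]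
    · rw [compT_psi_defIncl, defSymbolL_delta_delta, neg_zero, map_zero]

/-- The dependence of `Ψ_∇` on the connection. -/
theorem compA_psi_change (nabla' : Connection A) (c : TotDef A) :
    compA (psi nabla' c) = compA (psi nabla c) - wedgeL (evalBilin (TM E M) A)
      (degOne (covDiff nabla - covDiff nabla')) (sgnL (compT (psi nabla c))) := by
  induction c using DirectSum.induction_on with
  | zero => simp only [map_zero, wedgeL_zero_right, sub_zero]
  | add c c' h h' => simp only [map_add, h, h', wedgeL_add_right]; abel
  | of k c =>
    change compA (psi nabla' (defIncl k c)) = compA (psi nabla (defIncl k c)) -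
      wedgeL _ _ (sgnL (compT (psi nabla (defIncl k c))))
    rw [compA_psi_defIncl, compA_psi_defIncl, compT_psi_defIncl, map_neg, wedgeL_neg_right,
      degOne_sub, wedgeL_sub_left]
    abel

theorem compT_psi_change (nabla' : Connection A) (c : TotDef A) :
    compT (psi nabla' c) = compT (psi nabla c) := by
  induction c using DirectSum.induction_on with
  | zero => simp only [map_zero]
  | add c c' h h' => simp only [map_add, h, h']
  | of k c =>
    change compT (psi nabla' (defIncl k c)) = compT (psi nabla (defIncl k c))
    rw [compT_psi_defIncl, compT_psi_defIncl]

end DeformationLists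

end

section

variable {E : Type u} [NormedAddCommGroup E] [NormedSpace ℝ E]
  {M : Type w} [TopologicalSpace M] [ChartedSpace E M]
  [FiniteDimensional ℝ E] [IsManifold 𝓘(ℝ, E) ∞ M] {A : SmoothVectorBundle E M}

/-! ### Ψ_∇ is an isomorphism of graded spaces, and D_∇ is a structure operator. -/

section Bijectivity

variable (𝔸 : LieAlgebroid A) (nabla : Connection A)

/-- Only the summand in which the first argument is differentiated produces a derivative of `f`.
Hence symbolTerm has, up to the sign (-1)^k, symbol exactly σ; this is how the connection lifts
symbols to multiderivations. -/
theorem symbolTerm_cons_smul {k : ℕ} (σ : Form A (TM E M) k) (f : Cinf E M) (x : Sec A)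
    (w : Fin k → Sec A) : symbolTerm nabla σ (Matrix.vecCons (f • x) w) =
      f • symbolTerm nabla σ (Matrix.vecCons x w) + lieD (σ w) f • x := by
  rw [symbolTerm_apply, symbolTerm_apply, Fin.sum_univ_succ, Fin.sum_univ_succ]
  have e0 : ∀ y : Sec A, (0 : Fin (k + 1)).removeNth (Matrix.vecCons y w) = w := fun _ ↦ rfl
  have hs : ∀ i : Fin k, nabla.conn (σ (i.succ.removeNth (Matrix.vecCons (f • x) w)))
      (Matrix.vecCons (f • x) w i.succ) =
      f • nabla.conn (σ (i.succ.removeNth (Matrix.vecCons x w))) (Matrix.vecCons x w i.succ) := by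
    intro i
    cases k with
    | zero => exact i.elim0
    | succ k =>
      rw [removeNth_succ_cons, removeNth_succ_cons, map_cons_smul, map_smul]
      rfl
  simp only [e0, hs, Matrix.cons_val_zero, nabla.leibniz', Fin.val_zero, pow_zero, one_smul,
    smul_add, Finset.smul_sum, smul_comm f]
  abel

/-- A form with values in `A`, as a multiderivation with symbol zero. -/
def ofForm {k : ℕ} (η : Form A A (k + 1)) : Multiderivation A k :=
  ⟨(toReal η, 0), (mem_multiderivation_iff _).2 fun w f x ↦ by
    change η _ = f • η _ + (-1 : ℤ) ^ k • (lieD 0 f • x)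
    rw [map_cons_smul, map_zero, LinearMap.zero_apply, zero_smul, smul_zero, add_zero]⟩

theorem splitting_ofForm {k : ℕ} (η : Form A A (k + 1)) : splitting nabla (ofForm η) = η := by
  ext1 v
  rw [splitting_apply]
  change η v - (-1 : ℤ) ^ k • ∑ i : Fin (k + 1), (-1) ^ (i : ℕ) • nabla.conn 0 (v i) = η v
  simp

/-- The multiderivation with symbol `σ` which is sent to `-σ` by `Ψ_∇`. -/
def ofSymbol {k : ℕ} (σ : Form A (TM E M) k) : Multiderivation A k :=
  ⟨((-1 : ℤ) ^ k • symbolTerm nabla σ, σ), (mem_multiderivation_iff _).2 fun w f x ↦ by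
    simp only [AlternatingMap.smul_apply, symbolTerm_cons_smul, smul_add, smul_comm f]⟩

theorem splitting_ofSymbol {k : ℕ} (σ : Form A (TM E M) k) :
    splitting nabla (ofSymbol nabla σ) = 0 := by
  ext1 v
  rw [splitting_apply, ← symbolTerm_apply]
  exact sub_self _

theorem psi_defIncl_zero (γ : Sec A) : psi nabla (defIncl 0 γ) =
    inclA 0 (AlternatingMap.constOfIsEmpty _ _ (Fin 0) γ) := DirectSum.toModule_lof ..

theorem psi_defIncl_succ (k : ℕ) (c : Multiderivation A k) : psi nabla (defIncl (k + 1) c) =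
    inclA (k + 1) (splitting nabla c) + inclT k (-c.1.2) := DirectSum.toModule_lof ..

/-- Preimages of homogeneous generators suffice: an A-valued form is a multiderivation with symbol
zero, and a TM-valued form is lifted by means of the connection. -/
theorem psi_surjective : Function.Surjective (psi nabla) := by
  intro θ
  induction θ using adForms_induction with
  | zero => exact ⟨0, map_zero _⟩
  | add θ θ' h h' =>
    obtain ⟨c, rfl⟩ := h
    obtain ⟨c', rfl⟩ := h'
    exact ⟨c + c', map_add _ _ _⟩
  | inclA k η =>
    cases k with
    | zero =>
      refine ⟨defIncl 0 (η ![] : Sec A), ?_⟩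
      rw [psi_defIncl_zero]
      congr 1
      ext1 v
      rw [Subsingleton.elim v ![]]
      rfl
    | succ k =>
      refine ⟨defIncl (k + 1) (ofForm η), ?_⟩
      have e : -(ofForm η).1.2 = 0 := neg_zero
      rw [psi_defIncl_succ, splitting_ofForm, e, map_zero, add_zero]
  | inclT k σ =>
    -- Ψ_∇ reverses the sign of the symbol, hence -σ.
    refine ⟨defIncl (k + 1) (ofSymbol nabla (-σ)), ?_⟩
    have e : -(ofSymbol nabla (-σ)).1.2 = σ := neg_neg σ
    rw [psi_defIncl_succ, splitting_ofSymbol, e, map_zero, zero_add]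

theorem defIncl_apply_self (k : ℕ) (c : DefCochain A k) : defIncl k c k = c :=
  DirectSum.of_eq_same k c

theorem defIncl_apply_of_ne {k i : ℕ} (c : DefCochain A k) (h : i ≠ k) : defIncl k c i = 0 :=
  DirectSum.of_eq_of_ne _ _ _ h

theorem psi_defIncl_zero_apply (γ : Sec A) (p : ℕ × ℤ) : psi nabla (defIncl 0 γ) p =
    inclA 0 (AlternatingMap.constOfIsEmpty _ _ (Fin 0) γ) p := by
  rw [psi_defIncl_zero]

theorem psi_defIncl_succ_apply (k : ℕ) (c : Multiderivation A k) (p : ℕ × ℤ) :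
    psi nabla (defIncl (k + 1) c) p =
      inclA (k + 1) (splitting nabla c) p + inclT k (-c.1.2) p := by
  rw [psi_defIncl_succ, DirectSum.add_apply]

/-- This and the next two component formulas show that the part of Ψ_∇(c) in bidegree (k, j) depends
only on the part of c in degree k + j. Injectivity and compatibility with degrees follow from them.
-/
theorem psi_apply_zero (c : TotDef A) : psi nabla c (0, .ofNat 0) =
    AlternatingMap.constOfIsEmpty (Cinf E M) (Sec A) (Fin 0) (show Sec A from c 0) := by
  induction c using DirectSum.induction_on with
  | zero => rw [map_zero]; rfl
  | add c c' h h' =>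
    rw [map_add, DirectSum.add_apply, h, h', DirectSum.add_apply]
    rfl
  | of k c =>
    cases k with
    | zero =>
      refine (psi_defIncl_zero_apply nabla c _).trans ((inclA_apply 0 _).trans ?_)
      exact congrArg (fun γ : Sec A ↦ AlternatingMap.constOfIsEmpty (Cinf E M) (Sec A) (Fin 0) γ)
        (defIncl_apply_self 0 c).symm
    | succ k =>
      refine (psi_defIncl_succ_apply nabla k c _).trans ?_
      rw [inclA_apply_of_ne _ (by simp), inclT_apply_of_ne _ (by simp), add_zero]
      exact congrArg (fun γ : Sec A ↦ AlternatingMap.constOfIsEmpty (Cinf E M) (Sec A) (Fin 0) γ)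
        (defIncl_apply_of_ne (k := k + 1) (i := 0) c (by simp)).symm

theorem splitting_zero {k : ℕ} : splitting nabla (0 : Multiderivation A k) = 0 := by
  simpa using splitting_smul nabla 0 (0 : Multiderivation A k)

theorem psi_apply_succ (k : ℕ) (c : TotDef A) : psi nabla c (k + 1, .ofNat 0) =
    splitting nabla (show Multiderivation A k from c (k + 1)) := by
  induction c using DirectSum.induction_on with
  | zero => rw [map_zero]; exact (splitting_zero nabla).symm
  | add c c' h h' =>
    rw [map_add, DirectSum.add_apply, h, h', DirectSum.add_apply]
    exact (splitting_add nabla _ _).symm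
  | of i c =>
    cases i with
    | zero =>
      refine ((psi_defIncl_zero_apply nabla c _).trans
        (inclA_apply_of_ne _ (by simp))).trans ((splitting_zero nabla).symm.trans ?_)
      exact congrArg (fun γ : Multiderivation A k ↦ splitting nabla γ)
        (defIncl_apply_of_ne (k := 0) (i := k + 1) c (by simp)).symm
    | succ i =>
      refine (psi_defIncl_succ_apply nabla i c _).trans ?_
      rw [inclT_apply_of_ne _ (by simp), add_zero]
      by_cases h : k = i
      · subst h
        refine (inclA_apply _ _).trans ?_
        exact congrArg (fun γ : Multiderivation A k ↦ splitting nabla γ)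
          (defIncl_apply_self (k + 1) c).symm
      · rw [inclA_apply_of_ne _ (by simpa using h)]
        refine (splitting_zero nabla).symm.trans ?_
        exact congrArg (fun γ : Multiderivation A k ↦ splitting nabla γ)
          (defIncl_apply_of_ne (k := i + 1) (i := k + 1) c (by simpa using h)).symm

theorem psi_apply_symbol (k : ℕ) (c : TotDef A) : psi nabla c (k, .ofNat 1) =
    -(show Multiderivation A k from c (k + 1)).1.2 := by
  induction c using DirectSum.induction_on with
  | zero => rw [map_zero]; exact neg_zero.symm
  | add c c' h h' =>
    rw [map_add, DirectSum.add_apply, h, h', DirectSum.add_apply]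
    exact (neg_add _ _).symm
  | of i c =>
    cases i with
    | zero =>
      refine ((psi_defIncl_zero_apply nabla c _).trans
        (inclA_apply_of_ne _ (by simp))).trans ((neg_zero (G := Form A (TM E M) k)).symm.trans ?_)
      exact congrArg (fun γ : Multiderivation A k ↦ -γ.1.2)
        (defIncl_apply_of_ne (k := 0) (i := k + 1) c (by simp)).symm
    | succ i =>
      refine (psi_defIncl_succ_apply nabla i c _).trans ?_
      rw [inclA_apply_of_ne _ (by simp), zero_add]
      by_cases h : k = i
      · subst h
        refine (inclT_apply _ _).trans ?_
        exact congrArg (fun γ : Multiderivation A k ↦ -γ.1.2)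
          (defIncl_apply_self (k + 1) c).symm
      · rw [inclT_apply_of_ne _ (by simpa using h)]
        refine (neg_zero (G := Form A (TM E M) k)).symm.trans ?_
        exact congrArg (fun γ : Multiderivation A k ↦ -γ.1.2)
          (defIncl_apply_of_ne (k := i + 1) (i := k + 1) c (by simpa using h)).symm

/-- With zero symbol there is no correction, so c coincides with c_∇. -/
theorem eq_zero_of_splitting {k : ℕ} {c : Multiderivation A k} (h : splitting nabla c = 0)
    (hσ : c.1.2 = 0) : c = 0 := by
  ext1
  refine Prod.ext ?_ hσ
  ext1 v
  have h1 := splitting_apply nabla c v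
  rw [h, hσ] at h1
  simpa using h1.symm

/-- The map `Ψ_∇` detects the vanishing of the homogeneous components. -/
theorem def_apply_eq_zero {c : TotDef A} : {k : ℕ} →
    (∀ p : ℕ × ℤ, (p.1 : ℤ) + p.2 = k → psi nabla c p = 0) → c k = 0
  | 0, h => by
    have h0 := (psi_apply_zero nabla c).symm.trans (h (0, .ofNat 0) rfl)
    exact congrArg (fun η : Form A A 0 ↦ η ![]) h0
  | k + 1, h => by
    -- Both bidegrees (k, 1) and (k + 1, 0) have total degree k + 1. They carry the symbol and the
    -- form c_∇.
    have h1 := (psi_apply_symbol nabla k c).symm.trans (h (k, .ofNat 1) rfl)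
    have h0 := (psi_apply_succ nabla k c).symm.trans (h (k + 1, .ofNat 0) (by simp))
    exact eq_zero_of_splitting nabla h0 (neg_eq_zero.1 h1)

theorem psi_apply_eq_zero {c : TotDef A} {p : ℕ × ℤ}
    (h : ∀ k : ℕ, (k : ℤ) = (p.1 : ℤ) + p.2 → c k = 0) : psi nabla c p = 0 := by
  obtain ⟨k, j⟩ := p
  by_cases h0 : j = 0
  · subst h0
    cases k with
    | zero =>
      refine (psi_apply_zero nabla c).trans ?_
      rw [h 0 (by simp)]
      rfl
    | succ k =>
      refine (psi_apply_succ nabla k c).trans ?_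
      rw [h (k + 1) (by simp)]
      exact splitting_zero nabla
  by_cases h1 : j = 1
  · subst h1
    refine (psi_apply_symbol nabla k c).trans ?_
    rw [h (k + 1) (by simp)]
    exact neg_zero
  exact (adBundle_form_subsingleton k j h0 h1).elim _ _

theorem psi_injective : Function.Injective (psi nabla) := by
  rw [← LinearMap.ker_eq_bot, LinearMap.ker_eq_bot']
  intro c hc
  refine DFinsupp.ext fun k ↦ def_apply_eq_zero nabla fun p _ ↦ ?_
  rw [hc]; rfl

/-- An equivalence, not just one implication: the inverse of Ψ_∇ must preserve degrees as well, both
for D_∇ and for the inverse map in cohomology. -/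
theorem psi_mem_formDegree_iff (n : ℤ) (c : TotDef A) :
    psi nabla c ∈ formDegree A (adBundle A) n ↔ c ∈ defDegree A n := by
  constructor
  · intro h k hk
    exact def_apply_eq_zero nabla fun p hp ↦ h p (fun e ↦ hk (hp.symm.trans e))
  · intro h p hp
    exact psi_apply_eq_zero nabla fun k hk ↦ h k (fun e ↦ hp (hk.symm.trans e))

/-- The map `Ψ_∇` as a linear equivalence. -/
def psiEquiv : TotDef A ≃ₗ[ℝ] TotForms A (adBundle A) :=
  LinearEquiv.ofBijective (psi nabla) ⟨psi_injective nabla, psi_surjective nabla⟩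

theorem deltaTot_mem_defDegree {n : ℤ} {c : TotDef A} (hc : c ∈ defDegree A n) :
    deltaTot 𝔸 c ∈ defDegree A (n + 1) := by
  have h0 : ∀ c : TotDef A, deltaTot 𝔸 c 0 = 0 := by
    intro c
    induction c using DirectSum.induction_on with
    | zero => rw [map_zero]; rfl
    | add c c' h h' => rw [map_add, DirectSum.add_apply, h, h', add_zero]
    | of k c =>
      change deltaTot 𝔸 (defIncl k c) 0 = 0
      rw [deltaTot_defIncl, defIncl_apply_of_ne _ (by simp)]
  have hs : ∀ (c : TotDef A) (k : ℕ), deltaTot 𝔸 c (k + 1) = delta 𝔸 k (c k) := by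
    intro c k
    induction c using DirectSum.induction_on with
    | zero => rw [map_zero, DirectSum.zero_apply, DirectSum.zero_apply, map_zero]
    | add c c' h h' => rw [map_add, DirectSum.add_apply, h, h', DirectSum.add_apply, map_add]
    | of i c =>
      change deltaTot 𝔸 (defIncl i c) (k + 1) = delta 𝔸 k (defIncl i c k)
      rw [deltaTot_defIncl]
      by_cases h : k = i
      · subst h
        rw [defIncl_apply_self, defIncl_apply_self]
      · rw [defIncl_apply_of_ne _ h, defIncl_apply_of_ne _ (by simpa using h), map_zero]
  intro k hk
  cases k with
  | zero => exact h0 c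
  | succ k => rw [hs, hc k (fun h ↦ hk (by rw [← h]; simp)), map_zero]

/-- The operator `D_∇` is a structure operator. -/
theorem isStructureOperator_adOperator [T2Space M] :
    IsStructureOperator 𝔸 (adBundle A) (adOperator 𝔸 nabla) where
  degree n θ hθ := by
    -- Writing θ = Ψ_∇(c) turns D_∇ into δ. The degree of D_∇, and below its square, are therefore
    -- inherited from the deformation complex.
    obtain ⟨c, rfl⟩ := psi_surjective nabla θ
    rw [← psi_deltaTot, psi_mem_formDegree_iff]
    exact deltaTot_mem_defDegree 𝔸 ((psi_mem_formDegree_iff nabla n c).1 hθ)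
  square θ := by
    obtain ⟨c, rfl⟩ := psi_surjective nabla θ
    rw [← psi_deltaTot, ← psi_deltaTot, psi_deltaTot_deltaTot]
  derivation τ θ := adOperator_leftMul 𝔸 nabla τ θ

end Bijectivity

/-! ### Isomorphisms of graded complexes in cohomology. -/

section CohomologyEquiv

variable {C C' : Type*} [AddCommGroup C] [Module ℝ C] [AddCommGroup C'] [Module ℝ C']

/-- The isomorphism in cohomology induced by an isomorphism of graded complexes. -/
def cohomologyEquiv {gr : ℤ → Submodule ℝ C} {d : C →ₗ[ℝ] C} {gr' : ℤ → Submodule ℝ C'}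
    {d' : C' →ₗ[ℝ] C'} (f : C ≃ₗ[ℝ] C') (hgr : ∀ n x, f x ∈ gr' n ↔ x ∈ gr n)
    (hd : ∀ x, f (d x) = d' (f x)) (n : ℤ) : Cohomology gr d n ≃ₗ[ℝ] Cohomology gr' d' n :=
  LinearEquiv.ofLinearMap (cohomologyMap f.toLinearMap (fun n x ↦ (hgr n x).2) hd n)
    (cohomologyMap f.symm.toLinearMap
      (fun n x hx ↦ (hgr n _).1 (by simpa using hx))
      (fun x ↦ f.injective (by simp [hd])) n)
    (by
      refine Submodule.linearMap_qext _ (LinearMap.ext fun x ↦ ?_)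
      refine congrArg (Submodule.mkQ _) (Subtype.ext ?_)
      exact f.apply_symm_apply x.1)
    (by
      refine Submodule.linearMap_qext _ (LinearMap.ext fun x ↦ ?_)
      refine congrArg (Submodule.mkQ _) (Subtype.ext ?_)
      exact f.symm_apply_apply x.1)

end CohomologyEquiv

/-! ### Independence of the connection. -/

section ChangeOfConnection

variable [T2Space M] (𝔸 : LieAlgebroid A)

/-- The representation up to homotopy `Ad_∇`. -/
abbrev adjointRep (nabla : Connection A) : RepUpToHomotopy 𝔸 :=
  adRep 𝔸 nabla (isStructureOperator_adOperator 𝔸 nabla)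

theorem psi_symm_psi (nabla : Connection A) (c : TotDef A) :
    (psiEquiv nabla).symm (psi nabla c) = c := (psiEquiv nabla).symm_apply_apply c

theorem psi_psi_symm (nabla : Connection A) (θ : TotForms A (adBundle A)) :
    psi nabla ((psiEquiv nabla).symm θ) = θ := (psiEquiv nabla).apply_symm_apply θ

/-- Explicitly, Ψ_∇' ∘ Ψ_∇⁻¹ is (f, g) ↦ (f - (θ - θ') ∧ sg, g). Moving the one-cochain θ - θ' past
τ turns τ into sτ, and s(τ ∧ g) = sτ ∧ sg supplies the same sign, so the two cancel. -/
theorem psi_symm_leftMul (nabla nabla' : Connection A) {k : ℕ} (τ : ScalarForm A k)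
    (θ : TotForms A (adBundle A)) : psi nabla' ((psiEquiv nabla).symm (leftMul τ θ)) =
      leftMul τ (psi nabla' ((psiEquiv nabla).symm θ)) := by
  have hA : ∀ θ, compA (psi nabla' ((psiEquiv nabla).symm θ)) = compA θ -
      wedgeL (evalBilin (TM E M) A) (degOne (covDiff nabla - covDiff nabla'))
        (sgnL (compT θ)) := by
    intro θ
    obtain ⟨c, rfl⟩ := psi_surjective nabla θ
    rw [psi_symm_psi]
    exact compA_psi_change nabla nabla' c
  have hT : ∀ θ, compT (psi nabla' ((psiEquiv nabla).symm θ)) = compT θ := by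
    intro θ
    obtain ⟨c, rfl⟩ := psi_surjective nabla θ
    rw [psi_symm_psi]
    exact compT_psi_change nabla nabla' c
  refine adForms_ext ?_ ?_
  · rw [hA, compA_leftMul, compT_leftMul, compA_leftMul, hA, wedgeL_sub_right, sgnL_wedgeL,
      wedgeL_left_comm (h₃ := smulBilin A) (fun φ f s ↦ map_smul φ f s) 1 _
        (by rw [sgnL_degOne, pow_one, neg_one_smul])]
    simp only [Function.iterate_one, sgnL_sgnL]
  · rw [hT, compT_leftMul, compT_leftMul, hT]

/-- Both D_∇ and D_∇' correspond to the same δ, so passing through the deformation complex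
intertwines them. -/
theorem psi_symm_adOperator (nabla nabla' : Connection A) (θ : TotForms A (adBundle A)) :
    psi nabla' ((psiEquiv nabla).symm (adOperator 𝔸 nabla θ)) =
      adOperator 𝔸 nabla' (psi nabla' ((psiEquiv nabla).symm θ)) := by
  obtain ⟨c, rfl⟩ := psi_surjective nabla θ
  rw [← psi_deltaTot, psi_symm_psi, psi_symm_psi, psi_deltaTot]

theorem psi_symm_mem_formDegree (nabla nabla' : Connection A) (n : ℤ)
    {θ : TotForms A (adBundle A)} (hθ : θ ∈ formDegree A (adBundle A) n) :
    psi nabla' ((psiEquiv nabla).symm θ) ∈ formDegree A (adBundle A) n := by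
  obtain ⟨c, rfl⟩ := psi_surjective nabla θ
  rw [psi_symm_psi, psi_mem_formDegree_iff]
  exact (psi_mem_formDegree_iff nabla n c).1 hθ

theorem psi_symm_psi_symm (nabla nabla' : Connection A) (θ : TotForms A (adBundle A)) :
    psi nabla ((psiEquiv nabla').symm (psi nabla' ((psiEquiv nabla).symm θ))) = θ := by
  rw [psi_symm_psi, psi_psi_symm]

/-- The morphism `Ψ_∇' ∘ Ψ_∇⁻¹ : Ad_∇ → Ad_∇'`. -/
def changeConn (nabla nabla' : Connection A) :
    RepHom (adjointRep 𝔸 nabla) (adjointRep 𝔸 nabla') where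
  toLin := psi nabla' ∘ₗ (psiEquiv nabla).symm.toLinearMap
  degree n _ hθ := psi_symm_mem_formDegree nabla nabla' n hθ
  linear τ θ := psi_symm_leftMul nabla nabla' τ θ
  comm θ := psi_symm_adOperator 𝔸 nabla nabla' θ

/-- The isomorphism `Ad_∇ ≅ Ad_∇'`. -/
def changeConnIso (nabla nabla' : Connection A) :
    CategoryTheory.Iso (adjointRep 𝔸 nabla) (adjointRep 𝔸 nabla') where
  hom := changeConn 𝔸 nabla nabla'
  inv := changeConn 𝔸 nabla' nabla
  hom_inv_id := RepHom.ext (LinearMap.ext fun θ ↦ psi_symm_psi_symm nabla nabla' θ)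
  inv_hom_id := RepHom.ext (LinearMap.ext fun θ ↦ psi_symm_psi_symm nabla' nabla θ)

/-- The isomorphism from deformation cohomology to the cohomology of `Ad_∇` induced by `Ψ_∇`. -/
def defHEquiv (nabla : Connection A) (n : ℤ) : DefH 𝔸 n ≃ₗ[ℝ] (adjointRep 𝔸 nabla).H n :=
  cohomologyEquiv (psiEquiv nabla) (psi_mem_formDegree_iff nabla) (psi_deltaTot 𝔸 nabla) n

end ChangeOfConnection

end

end AdjointRep

end

/-! ### The theorem. -/

theorem mainTheorem1 {E : Type*} [NormedAddCommGroup E] [NormedSpace ℝ E] [FiniteDimensional ℝ E]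
    {M : Type*} [TopologicalSpace M] [ChartedSpace E M] [IsManifold 𝓘(ℝ, E) ∞ M]
    [T2Space M] [SigmaCompactSpace M] (A : SmoothVectorBundle E M) (𝔸 : LieAlgebroid A) :
    ∃ hD : ∀ nabla : Connection A, IsStructureOperator 𝔸 (adBundle A) (adOperator 𝔸 nabla),
      (∀ nabla nabla' : Connection A,
        (adRep 𝔸 nabla (hD nabla)).isoClass = (adRep 𝔸 nabla' (hD nabla')).isoClass) ∧
      ∃ e : ∀ (nabla : Connection A) (n : ℤ), DefH 𝔸 n ≃ₗ[ℝ] (adRep 𝔸 nabla (hD nabla)).H n,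
        (∀ (nabla : Connection A) (n : ℤ) (c : DefCocycles 𝔸 n),
          ∃ z : (adRep 𝔸 nabla (hD nabla)).Cocycles n,
            z.1 = psi nabla c.1 ∧
              e nabla n (defCls 𝔸 n c) = (adRep 𝔸 nabla (hD nabla)).cls n z) ∧
        (∀ nabla nabla' : Connection A,
          ∃ φ : CategoryTheory.Iso (adRep 𝔸 nabla (hD nabla)) (adRep 𝔸 nabla' (hD nabla')),
            ∀ (n : ℤ) (x : DefH 𝔸 n), RepHom.mapH φ.hom n (e nabla n x) = e nabla' n x) := by
  refine ⟨fun nabla ↦ isStructureOperator_adOperator 𝔸 nabla, fun nabla nabla' ↦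
    Quotient.sound ⟨changeConnIso 𝔸 nabla nabla'⟩, defHEquiv 𝔸, fun nabla n c ↦
    ⟨⟨psi nabla c.1, (psi_mem_formDegree_iff nabla n c.1).2 c.2.1, ?_⟩, rfl, rfl⟩,
    fun nabla nabla' ↦ ⟨changeConnIso 𝔸 nabla nabla', fun n x ↦ ?_⟩⟩
  -- Ψ_∇(c) is closed because Ψ_∇ is a chain map; on classes e_∇ is given by Ψ_∇ by construction.
  · have hc : deltaTot 𝔸 c.1 = 0 := c.2.2
    change adOperator 𝔸 nabla (psi nabla c.1) = 0
    rw [← psi_deltaTot, hc, map_zero]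
  -- On a representing cocycle the claim reads Ψ_∇'(Ψ_∇⁻¹(Ψ_∇(c))) = Ψ_∇'(c).
  · obtain ⟨c, rfl⟩ := Submodule.mkQ_surjective _ x
    refine congrArg (Submodule.mkQ _) (Subtype.ext ?_)
    exact congrArg (psi nabla') ((psiEquiv nabla).symm_apply_apply c.1)
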